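/- **Setting.** Let $\hat V:\mathbb Z^3\to[0,\infty)$ with $\|\hat V\|_1=\sum_k\hat V(k)<\infty$, and let $0<\delta<1/6$. For $k_F>0$ let $B_F=\{p\in\mathbb Z^3:|p|\le k_F\}$, $N=|B_F|$, $\hbar=N^{-1/3}$, $\kappa=k_FN^{-1/3}$. Let $\mathcal F$ be the fermionic Fock space over $L^2(\mathbb T^3)$ and $a_p^*,a_p$ $(p\in\mathbb Z^3)$ the creation and annihilation operators of the plane waves. Put $\mathcal N=\sum_p a_p^*a_p$ and, for a fixed number $q\in(0,\tfrac12)$, $\mathcal N_\delta=\sum_{p:\,||p|-k_F|>qN^{-\delta}}a_p^*a_p$. *Patches.* Let $R>0$ and let $M$ be even. The northern half of the unit sphere contains $M/2$ regions $p_\alpha=\{\theta\in[\theta_1,\theta_2],\ \varphi\in[\varphi_1,\varphi_2]\}$ in spherical coordinates (inclination $\theta$, azimuth $\varphi$), with $0\le\theta_1<\theta_2\le\pi/2$, $\varphi_1<\varphi_2\le\varphi_1+2\pi$, and $\varphi_2=\varphi_1+2\pi$ if $\theta_1=0$ (polar cap); $\hat\omega_\alpha$ is the center of $p_\alpha$ (the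 point with the mean angles; the pole for the cap). The other $M/2$ regions, with their centers, are the reflections of these at the origin. The patches are $B_\alpha=\{x\in\mathbb R^3: k_F-R\le|x|\le k_F+R,\ x\in|x|\,p_\alpha\}$, $\alpha=1,\dots,M$. For a fixed constant $K$ it is assumed that both sidelengths $\theta_2-\theta_1$ and $\sin(\theta_2)(\varphi_2-\varphi_1)$ lie in $[K^{-1}M^{-1/2},KM^{-1/2}]$, that the area of every $p_\alpha$ differs from $4\pi/M$ by at most $KRN^{-1/3}M^{-1/2}$, and that points of different patches have distance larger than $R$. *Pair operators.* Let $\Gamma^{\rm nor}$ be the set of $k\in\mathbb Z^3$ with $|k|<R$ and $k_3>0$, or $k_3=0<k_2$, or $k_3=k_2=0<k_1$. For $k\in\Gamma^{\rm nor}$ let $\mathcal I_k^{+}=\{\alpha:k\cdot\hat\omega_\alpha\ge N^{-\delta}\}$, $\mathcal I_k^{-}=\{\alpha:k\cdot\hat\omega_\alpha\le -N^{-\delta}\}$, $\mathcal I_k=\mathcal I_k^+\cup\mathcal I_k^-$. For $\alpha\in\mathcal I_k^{\pm}$ put $$c_\alpha^*(k)=\frac1{n_\alpha(k)}\sum_{p}a_p^*a_{p\mp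 k}^*,$$ where the sum is over the $p\in\mathbb Z^3$ with $p\in B_F^c\cap B_\alpha$, $p\mp k\in B_F\cap B_\alpha$, and $n_\alpha(k)^2$ is the number of these $p$. Let $c_\alpha(k)$ be the adjoint of $c_\alpha^*(k)$. *Kernel.* On $\mathcal I_k$ let $D_{\alpha\beta}=\delta_{\alpha\beta}|k\cdot\hat\omega_\alpha|/|k|$, and let $W_{\alpha\beta}$ equal $\frac{\hat V(k)}{2\hbar\kappa N|k|}n_\alpha(k)n_\beta(k)$ if $\alpha,\beta$ lie both in $\mathcal I_k^+$ or both in $\mathcal I_k^-$, and $0$ otherwise; let $\widetilde W_{\alpha\beta}$ be given by the same expression with the two cases exchanged. Put $E=[(D+W-\widetilde W)^{1/2}(D+W+\widetilde W)(D+W-\widetilde W)^{1/2}]^{1/2}$ and $S_1=(D+W-\widetilde W)^{1/2}E^{-1/2}$, and let $O$ be the orthogonal factor in the polar decomposition $S_1=O|S_1|$. Let $d,b$ be the restrictions of $D,W$ to $\mathcal I_k^+$ and $A$ the orthogonal factor in the polar decomposition of $(d+2b)^{1/2}d^{1/2}$. Identifying $\mathcal I_k^-$ with $\mathcal I_k^+$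 by reflection of the patches, put $U=\frac1{\sqrt2}\begin{pmatrix}1&1\\1&-1\end{pmatrix}$ and $\widetilde O=U\begin{pmatrix}1&0\\0&A\end{pmatrix}U^T$. Finally let $L(k)=\log(O\widetilde O)$, for a fixed branch of the logarithm with $\log1=0$ (imaginary part in $(t-2\pi,t]$ for a fixed $t\in(0,2\pi)$), and $$Z_\lambda=\exp\Big(\lambda\sum_{k\in\Gamma^{\rm nor}}\sum_{\alpha,\beta\in\mathcal I_k}L(k)_{\alpha,\beta}\,c_\alpha^*(k)c_\beta(k)\Big).$$ **Lemma (approximate bosonic one-particle unitary).** Assume $R^2N^{2\delta}\ll M\ll N^{2/3-2\delta}R^{-4}$ as $k_F\to\infty$. Then for all $\ell\in\Gamma^{\rm nor}$, $\gamma\in\mathcal I_\ell$ and $\lambda\in[-1,1]$ $$Z_\lambda^*c_\gamma(\ell)Z_\lambda=\sum_{\beta\in\mathcal I_\ell}\exp(\lambda L(\ell))_{\gamma,\beta}\,c_\beta(\ell)+\mathfrak F_\gamma(\lambda,\ell),$$ where, with a constant $C$, for all $\psi$ in the domain of the (closed) operator $\mathcal N_\delta^{1/2}\mathcal N$, $$\sum_{\gamma\in\mathcal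 I_\ell}\|\mathfrak F_\gamma(\lambda,\ell)\psi\|\le C\,N^{-2/3+\delta}M^{3/2}\,\|\mathcal N_\delta^{1/2}\mathcal N\psi\|.$$ Precisely: there are $C,\eta>0$, depending only on $\hat V,\delta,t,q,K$, such that this holds for every patch decomposition as above with $k_F\ge\eta^{-1}$, $R^2N^{2\delta}\le\eta M$ and $M\le\eta N^{2/3-2\delta}R^{-4}$. -/

import Mathlib

open scoped Matrix.Norms.L2Operator

noncomputable section

/-! ### Momenta and fermionic Fock space -/

/-- Momenta of the torus `ℝ³ / (2πℤ³)`. -/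
abbrev Momentum : Type := Fin 3 → ℤ

/-- A momentum as a vector of Euclidean space. -/
def Momentum.toVec (p : Momentum) : EuclideanSpace ℝ (Fin 3) :=
  WithLp.toLp 2 fun i => (p i : ℝ)

/-- The finite set `{p ∈ ℤ³ : |p| ≤ r}`; see `mem_latticeBall`. -/
def latticeBall (r : ℝ) : Finset Momentum :=
  open scoped Classical in
  (Fintype.piFinset fun _ : Fin 3 => Finset.Icc (-⌊r⌋) ⌊r⌋).filter fun p => ‖p.toVec‖ ≤ r

theorem mem_latticeBall (r : ℝ) (p : Momentum) : p ∈ latticeBall r ↔ ‖p.toVec‖ ≤ r := by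
  classical
  refine ⟨fun h => (Finset.mem_filter.1 h).2, fun h => Finset.mem_filter.2 ⟨?_, h⟩⟩
  refine Fintype.mem_piFinset.2 fun i => ?_
  have h1 : |(p i : ℝ)| ≤ r := by
    have h2 := PiLp.norm_apply_le p.toVec i
    rw [Real.norm_eq_abs] at h2
    exact h2.trans h
  rw [abs_le] at h1
  rw [Finset.mem_Icc]
  constructor
  · have h2 : -(p i) ≤ ⌊r⌋ := Int.le_floor.2 (by push_cast; linarith [h1.1])
    omega
  · exact Int.le_floor.2 h1.2

/-- Fermionic Fock space over `L²` of the torus in the occupation number representation: the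
orthonormal basis vector labelled by the finite set `S` is the Slater determinant of the plane
waves with momenta in `S`, ordered lexicographically. -/
abbrev Fock : Type := lp (fun _ : Finset Momentum => ℂ) 2

/-- The sign `(-1) ^ #{q ∈ S : q < p}` (lexicographic order). -/
def fermiSign (p : Momentum) (S : Finset Momentum) : ℂ :=
  open scoped Classical in
  (-1) ^ (S.filter fun q => toLex q < toLex p).card

theorem norm_fermiSign (p : Momentum) (S : Finset Momentum) : ‖fermiSign p S‖ = 1 := by
  simp [fermiSign]

/-- Coefficients of `a_p ψ`, where `a_p` maps the basis vector of `insert p S`, `p ∉ S`, to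
`fermiSign p S` times the basis vector of `S`, and kills the basis vector of `S`. -/
def annihilateFun (p : Momentum) (ψ : Finset Momentum → ℂ) (S : Finset Momentum) : ℂ :=
  if p ∈ S then 0 else fermiSign p S * ψ (insert p S)

theorem annihilateFun_sum_le (p : Momentum) (ψ : Fock) (s : Finset (Finset Momentum)) :
    ∑ S ∈ s, ‖annihilateFun p ψ S‖ ^ (2 : ENNReal).toReal ≤ ‖ψ‖ ^ (2 : ENNReal).toReal := by
  classical
  have h2 : 0 < (2 : ENNReal).toReal := by norm_num
  have h1 : ∑ S ∈ s, ‖annihilateFun p ψ S‖ ^ (2 : ENNReal).toReal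
      = ∑ S ∈ s.filter (fun S => p ∉ S), ‖ψ (insert p S)‖ ^ (2 : ENNReal).toReal := by
    rw [Finset.sum_filter]
    refine Finset.sum_congr rfl fun S _ => ?_
    by_cases h : p ∈ S
    · simp [annihilateFun, h]
    · simp [annihilateFun, h, norm_fermiSign]
  have h3 : Set.InjOn (fun S : Finset Momentum => insert p S)
      (s.filter (fun S => p ∉ S) : Finset (Finset Momentum)) := by
    intro S hS T hT hST
    have hS' : p ∉ S := (Finset.mem_filter.1 hS).2
    have hT' : p ∉ T := (Finset.mem_filter.1 hT).2
    have h := congrArg (fun U : Finset Momentum => U.erase p) hST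
    simpa [Finset.erase_insert hS', Finset.erase_insert hT'] using h
  rw [h1, ← Finset.sum_image (f := fun T => ‖ψ T‖ ^ (2 : ENNReal).toReal) h3]
  exact lp.sum_rpow_le_norm_rpow h2 ψ _

/-- The annihilation operator `a_p`. -/
def annihilate (p : Momentum) : Fock →L[ℂ] Fock :=
  LinearMap.mkContinuous
    { toFun := fun ψ => ⟨annihilateFun p ψ, memℓp_gen' (annihilateFun_sum_le p ψ)⟩
      map_add' := fun ψ χ => by
        ext S
        change annihilateFun p (ψ + χ : Fock) S = annihilateFun p ψ S + annihilateFun p χ S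
        by_cases h : p ∈ S <;> simp [annihilateFun, h, mul_add]
      map_smul' := fun z ψ => by
        ext S
        by_cases h : p ∈ S <;> simp [annihilateFun, h, mul_left_comm] }
    1 (fun ψ => by
      rw [one_mul]
      exact lp.norm_le_of_forall_sum_le (by norm_num) (norm_nonneg ψ)
        (annihilateFun_sum_le p ψ))

/-- The creation operator `a_p^*`. -/
def create (p : Momentum) : Fock →L[ℂ] Fock := ContinuousLinearMap.adjoint (annihilate p)

/-- The (unbounded) operator on Fock space that is diagonal in the occupation number basis with
eigenvalues `w S`, on its maximal domain. For `w S = #{p ∈ S : Q p}` it is `∑_{p : Q p} a_p^* a_p`,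
and functions of such operators are obtained by applying the functions to `w`. -/
def diagOp (w : Finset Momentum → ℝ) : Fock →ₗ.[ℂ] Fock where
  domain :=
    { carrier := {ψ | Memℓp (fun S => (w S : ℂ) * ψ S) 2}
      add_mem' := fun {ψ χ} hψ hχ => by
        have h := Memℓp.add hψ hχ
        have e : (fun S => (w S : ℂ) * ψ S) + (fun S => (w S : ℂ) * χ S)
            = fun S => (w S : ℂ) * (ψ + χ) S := by
          funext S; simp [mul_add]
        rw [e] at h
        exact h
      zero_mem' := by
        have e : (fun S => (w S : ℂ) * (0 : Fock) S) = 0 := by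
          funext S; simp
        change Memℓp (fun S => (w S : ℂ) * (0 : Fock) S) 2
        rw [e]
        exact zero_memℓp
      smul_mem' := fun z ψ hψ => by
        have h := Memℓp.const_smul hψ z
        have e : z • (fun S => (w S : ℂ) * ψ S) = fun S => (w S : ℂ) * (z • ψ) S := by
          funext S; simp [mul_left_comm]
        rw [e] at h
        exact h }
  toFun :=
    { toFun := fun ψ => ⟨fun S => (w S : ℂ) * (ψ : Fock) S, ψ.2⟩
      map_add' := fun ψ χ => by
        ext S
        exact mul_add (w S : ℂ) ((ψ : Fock) S) ((χ : Fock) S)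
      map_smul' := fun z ψ => by ext S; simp [mul_left_comm] }

/-- Eigenvalues of the number operator `𝒩 = ∑_p a_p^* a_p`. -/
def numberWeight (S : Finset Momentum) : ℝ := S.card

/-- Eigenvalues of the gapped number operator `∑_{p : ||p| - kF| > r} a_p^* a_p`. -/
def gappedWeight (kF r : ℝ) (S : Finset Momentum) : ℝ :=
  open scoped Classical in
  ((S.filter fun p => r < |‖p.toVec‖ - kF|).card : ℝ)

/-! ### Patches on the Fermi sphere -/

/-- The point of the unit sphere with inclination `θ` and azimuth `φ`. -/
def sphPoint (θ φ : ℝ) : EuclideanSpace ℝ (Fin 3) :=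
  !₂[Real.sin θ * Real.cos φ, Real.sin θ * Real.sin φ, Real.cos θ]

/-- The data of a decomposition into `M = 2 m` patches: the Fermi momentum, the half thickness `R`
of the patches, and for each of the `m` patches of the northern half sphere its range
`[θ₁, θ₂]` of inclinations and its range `[φ₁, φ₂]` of azimuths. The patches of the southern half
sphere are the reflections of these at the origin. -/
structure PatchSystem where
  kF : ℝ
  R : ℝ
  m : ℕ
  θ₁ : Fin m → ℝ
  θ₂ : Fin m → ℝ
  φ₁ : Fin m → ℝ
  φ₂ : Fin m → ℝ

namespace PatchSystem

variable (P : PatchSystem)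

/-- The number `M` of patches. -/
def M : ℝ := 2 * P.m

/-- The number `N` of points of the Fermi ball. -/
def N : ℝ := (latticeBall P.kF).card

/-- The effective Planck constant. -/
def hbar : ℝ := P.N ^ (-(1 / 3) : ℝ)

/-- `κ`, defined by `kF = κ N^(1/3)`. -/
def kappa : ℝ := P.kF / P.N ^ (1 / 3 : ℝ)

/-- Patch labels; `(i, 1)` is a northern patch and `(i, -1)` its reflection. -/
abbrev Patch : Type := Fin P.m × ℤˣ

/-- The label of the reflected patch. -/
def mirror (α : P.Patch) : P.Patch := (α.1, -α.2)

/-- Radial projection of a northern patch to the unit sphere. -/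
def northRegion (i : Fin P.m) : Set (EuclideanSpace ℝ (Fin 3)) :=
  {ω | ∃ θ ∈ Set.Icc (P.θ₁ i) (P.θ₂ i), ∃ φ ∈ Set.Icc (P.φ₁ i) (P.φ₂ i), ω = sphPoint θ φ}

/-- Radial projection `p_α` of a patch to the unit sphere. -/
def region (α : P.Patch) : Set (EuclideanSpace ℝ (Fin 3)) :=
  {ω | (((α.2 : ℤ) : ℝ) • ω) ∈ P.northRegion α.1}

/-- The patch `B_α`. -/
def patch (α : P.Patch) : Set (EuclideanSpace ℝ (Fin 3)) :=
  {x | P.kF - P.R ≤ ‖x‖ ∧ ‖x‖ ≤ P.kF + P.R ∧ ∃ ω ∈ P.region α, x = ‖x‖ • ω}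

/-- The direction of the center of a northern patch (the pole, for the polar cap). -/
def northCenter (i : Fin P.m) : EuclideanSpace ℝ (Fin 3) :=
  open scoped Classical in
  if P.θ₁ i = 0 then sphPoint 0 0
  else sphPoint ((P.θ₁ i + P.θ₂ i) / 2) ((P.φ₁ i + P.φ₂ i) / 2)

/-- The direction `ω̂_α` of the center of a patch. -/
def center (α : P.Patch) : EuclideanSpace ℝ (Fin 3) :=
  ((α.2 : ℤ) : ℝ) • P.northCenter α.1

/-- The geometric properties of the patch decomposition, with a constant `K` in the orders of
magnitude. The projections of the patches are bounded by circles of latitude and meridians (with a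
cap if the pole belongs to the patch), their two sidelengths are of order `M^(-1/2)` (so their
diameter is at most of this order), their areas are `4π/M` up to corrections due to the corridors,
and the patches are separated by corridors larger than `R`. -/
structure IsPatchDecomposition (K : ℝ) : Prop where
  inclination : ∀ i, 0 ≤ P.θ₁ i ∧ P.θ₁ i < P.θ₂ i ∧ P.θ₂ i ≤ Real.pi / 2
  azimuth : ∀ i, P.φ₁ i < P.φ₂ i ∧ P.φ₂ i ≤ P.φ₁ i + 2 * Real.pi
  cap : ∀ i, P.θ₁ i = 0 → P.φ₂ i = P.φ₁ i + 2 * Real.pi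
  side_inclination : ∀ i, K⁻¹ * P.M ^ (-(1 / 2) : ℝ) ≤ P.θ₂ i - P.θ₁ i ∧
    P.θ₂ i - P.θ₁ i ≤ K * P.M ^ (-(1 / 2) : ℝ)
  side_azimuth : ∀ i, K⁻¹ * P.M ^ (-(1 / 2) : ℝ) ≤ Real.sin (P.θ₂ i) * (P.φ₂ i - P.φ₁ i) ∧
    Real.sin (P.θ₂ i) * (P.φ₂ i - P.φ₁ i) ≤ K * P.M ^ (-(1 / 2) : ℝ)
  area : ∀ i, |(P.φ₂ i - P.φ₁ i) * (Real.cos (P.θ₁ i) - Real.cos (P.θ₂ i)) - 4 * Real.pi / P.M| ≤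
    K * P.R * P.N ^ (-(1 / 3) : ℝ) * P.M ^ (-(1 / 2) : ℝ)
  corridor : ∀ α β, α ≠ β → ∀ x ∈ P.patch α, ∀ y ∈ P.patch β, P.R < dist x y

/-- The set of `k ∈ ℤ³`, `|k| < R`, in the northern half space. -/
def gammaNor : Finset Momentum :=
  open scoped Classical in
  (latticeBall P.R).filter fun k => ‖k.toVec‖ < P.R ∧
    (0 < k 2 ∨ (k 2 = 0 ∧ 0 < k 1) ∨ (k 2 = 0 ∧ k 1 = 0 ∧ 0 < k 0))

variable (δ : ℝ) (k : Momentum)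

/-- `k · ω̂_α`. -/
def slope (α : P.Patch) : ℝ := inner ℝ k.toVec (P.center α)

/-- `α ∈ 𝓘_k^+`. -/
def InPlus (α : P.Patch) : Prop := P.N ^ (-δ) ≤ P.slope k α

/-- `α ∈ 𝓘_k^-`. -/
def InMinus (α : P.Patch) : Prop := P.slope k α ≤ -P.N ^ (-δ)

/-- The index set `𝓘_k^+`. -/
abbrev IPlus : Type := {α : P.Patch // P.InPlus δ k α}

/-- The index set `𝓘_k = 𝓘_k^+ ∪ 𝓘_k^-`. -/
abbrev I : Type := {α : P.Patch // P.InPlus δ k α ∨ P.InMinus δ k α}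

instance : Fintype (P.IPlus δ k) := Fintype.ofFinite _

instance : Fintype (P.I δ k) := Fintype.ofFinite _

/-! ### Pair operators -/

/-- The momenta `p` with `p ∈ B_F^c ∩ B_α` and `p - k ∈ B_F ∩ B_α`. -/
def pairs (α : P.Patch) (k : Momentum) : Finset Momentum :=
  open scoped Classical in
  (latticeBall (P.kF + P.R)).filter fun p =>
    (p ∉ latticeBall P.kF ∧ p.toVec ∈ P.patch α) ∧
      (p - k ∈ latticeBall P.kF ∧ (p - k).toVec ∈ P.patch α)

/-- The number of particle-hole pairs of relative momentum `k` in `B_α`, to the power `1/2`. -/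
def pairNorm (α : P.Patch) (k : Momentum) : ℝ := Real.sqrt (P.pairs α k).card

/-- The operator `b_α^*(k)`. -/
def bStar (α : P.Patch) (k : Momentum) : Fock →L[ℂ] Fock :=
  ((P.pairNorm α k : ℂ)⁻¹) • ∑ p ∈ P.pairs α k, create p * create (p - k)

/-- `n_α(k)` for `α ∈ 𝓘_k`: the normalization of the pair operator `c_α^*(k)`. -/
def nPair (α : P.Patch) : ℝ :=
  open scoped Classical in
  if P.InPlus δ k α then P.pairNorm α k else P.pairNorm α (-k)

/-- `c_α^*(k)` for `α ∈ 𝓘_k`. -/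
def cStar (α : P.Patch) : Fock →L[ℂ] Fock :=
  open scoped Classical in
  if P.InPlus δ k α then P.bStar α k else P.bStar α (-k)

/-- `c_α(k)` for `α ∈ 𝓘_k`. -/
def c (α : P.Patch) : Fock →L[ℂ] Fock := ContinuousLinearMap.adjoint (P.cStar δ k α)

end PatchSystem

/-! ### The one-particle kernel -/

/-- Real power of a real symmetric matrix, through the spectral theorem. -/
def symPow {ι : Type} [Fintype ι] [DecidableEq ι] (A : Matrix ι ι ℝ) (s : ℝ) : Matrix ι ι ℝ :=
  cfc (fun x : ℝ => x ^ s) A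

/-- The orthogonal factor `X |X|⁻¹` in the polar decomposition `X = O |X|`, with
`|X| = (Xᵀ X)^(1/2)`, of an invertible matrix. -/
def polarFactor {ι : Type} [Fintype ι] [DecidableEq ι] (X : Matrix ι ι ℝ) : Matrix ι ι ℝ :=
  X * symPow (X.transpose * X) (-(1 / 2))

/-- The branch of the complex logarithm with imaginary part in `(t - 2π, t]`. -/
def branchLog (t : ℝ) (z : ℂ) : ℂ :=
  (Real.log ‖z‖ : ℂ) + (toIocMod Real.two_pi_pos (t - 2 * Real.pi) z.arg : ℝ) * Complex.I

namespace PatchSystem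

variable (P : PatchSystem) (δ : ℝ) (Vhat : Momentum → ℝ) (k : Momentum)

/-- The matrix `D(k)`, with entries `δ_{α,β} |k̂ · ω̂_α|`. -/
def matD : Matrix (P.I δ k) (P.I δ k) ℝ :=
  Matrix.diagonal fun α => |P.slope k α.1| / ‖k.toVec‖

/-- The common factor `V̂(k) / (2 ħ κ N |k|)`. -/
def coupling : ℝ := Vhat k / (2 * P.hbar * P.kappa * P.N * ‖k.toVec‖)

/-- The matrix `W(k)`, coupling patches of the same hemisphere. -/
def matW : Matrix (P.I δ k) (P.I δ k) ℝ := fun α β =>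
  open scoped Classical in
  if (P.InPlus δ k α.1 ↔ P.InPlus δ k β.1) then
    P.coupling Vhat k * (P.nPair δ k α.1 * P.nPair δ k β.1)
  else 0

/-- The matrix `W̃(k)`, coupling patches of opposite hemispheres. -/
def matWt : Matrix (P.I δ k) (P.I δ k) ℝ := fun α β =>
  open scoped Classical in
  if (P.InPlus δ k α.1 ↔ P.InPlus δ k β.1) then 0
  else P.coupling Vhat k * (P.nPair δ k α.1 * P.nPair δ k β.1)

/-- `E = [(D + W - W̃)^(1/2) (D + W + W̃) (D + W - W̃)^(1/2)]^(1/2)`. -/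
def matE : Matrix (P.I δ k) (P.I δ k) ℝ :=
  symPow (symPow (P.matD δ k + P.matW δ Vhat k - P.matWt δ Vhat k) (1 / 2)
    * (P.matD δ k + P.matW δ Vhat k + P.matWt δ Vhat k)
    * symPow (P.matD δ k + P.matW δ Vhat k - P.matWt δ Vhat k) (1 / 2)) (1 / 2)

/-- `S₁ = (D + W - W̃)^(1/2) E^(-1/2)`. -/
def matS1 : Matrix (P.I δ k) (P.I δ k) ℝ :=
  symPow (P.matD δ k + P.matW δ Vhat k - P.matWt δ Vhat k) (1 / 2)
    * symPow (P.matE δ Vhat k) (-(1 / 2))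

/-- The orthogonal matrix `O(k)`, from the polar decomposition of `S₁`. -/
def matO : Matrix (P.I δ k) (P.I δ k) ℝ := polarFactor (P.matS1 δ Vhat k)

/-- Inclusion of `𝓘_k^+` into `𝓘_k`. -/
def incl (α : P.IPlus δ k) : P.I δ k := ⟨α.1, Or.inl α.2⟩

/-- The block `d` of `D`. -/
def blockd : Matrix (P.IPlus δ k) (P.IPlus δ k) ℝ :=
  (P.matD δ k).submatrix (P.incl δ k) (P.incl δ k)

/-- The block `b` of `W`. -/
def blockb : Matrix (P.IPlus δ k) (P.IPlus δ k) ℝ :=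
  (P.matW δ Vhat k).submatrix (P.incl δ k) (P.incl δ k)

/-- The orthogonal matrix `A`, from the polar decomposition of `X = (d + 2 b)^(1/2) d^(1/2)`. -/
def matA : Matrix (P.IPlus δ k) (P.IPlus δ k) ℝ :=
  polarFactor (symPow (P.blockd δ k + (2 : ℝ) • P.blockb δ Vhat k) (1 / 2)
    * symPow (P.blockd δ k) (1 / 2))

/-- `U = 2^(-1/2) [[1, 1], [1, -1]]`. -/
def matU : Matrix (P.IPlus δ k ⊕ P.IPlus δ k) (P.IPlus δ k ⊕ P.IPlus δ k) ℝ :=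
  (Real.sqrt 2)⁻¹ • Matrix.fromBlocks 1 1 1 (-1)

theorem slope_mirror (α : P.Patch) : P.slope k (P.mirror α) = -P.slope k α := by
  simp [slope, mirror, center, inner_neg_right]

/-- The identification of `𝓘_k` with two copies of `𝓘_k^+`, by reflection of the patches. -/
def toBlocks (α : P.I δ k) : P.IPlus δ k ⊕ P.IPlus δ k :=
  open scoped Classical in
  if h : P.InPlus δ k α.1 then Sum.inl ⟨α.1, h⟩
  else Sum.inr ⟨P.mirror α.1, by
    have h1 : P.slope k α.1 ≤ -P.N ^ (-δ) := α.2.resolve_left h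
    change P.N ^ (-δ) ≤ P.slope k (P.mirror α.1)
    rw [slope_mirror]
    linarith⟩

/-- The orthogonal matrix `Õ(k) = U diag(1, A) Uᵀ`. -/
def matOt : Matrix (P.I δ k) (P.I δ k) ℝ :=
  (P.matU δ k * Matrix.fromBlocks 1 0 0 (P.matA δ Vhat k)
    * (P.matU δ k).transpose).submatrix (P.toBlocks δ k) (P.toBlocks δ k)

/-- `L(k) = log (O(k) Õ(k))`, for the branch `branchLog t` of the logarithm. -/
def matL (t : ℝ) : Matrix (P.I δ k) (P.I δ k) ℂ :=
  cfc (branchLog t) ((P.matO δ Vhat k * P.matOt δ Vhat k).map Complex.ofReal)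

/-- The operator `Z_s = exp (s ∑_k ∑_{α,β} L(k)_{α,β} c_α^*(k) c_β(k))`. -/
def Z (t s : ℝ) : Fock →L[ℂ] Fock :=
  NormedSpace.exp ((s : ℂ) • ∑ k ∈ P.gammaNor, ∑ α : P.I δ k, ∑ β : P.I δ k,
    P.matL δ Vhat k t α β • (P.cStar δ k α.1 * P.c δ k β.1))

end PatchSystem

end

/-! ### Canonical anticommutation relations -/

/-! The pair operators are almost bosonic. By the anticommutation relations, [c_γ(ℓ), c_α^*(k)] is
δ_{kℓ} δ_{γα} plus an error that vanishes unless both operators belong to the same patch. Otherwise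
the error is a sum of hopping operators divided by n_γ n_α, so it is bounded by the number operator
times 2 / min n² (`exists_commutator_error`, `norm_hop_le`). For exact bosons, conjugation with the
exponential of the quadratic generator B would act as the matrix exp(λL). The interpolation
exp((λ-τ)L) Z_τ^* c Z_τ between the approximate and the exact evolution has as its derivative only
the error part of [c, B] (`hasDerivAt_interpolation`). Testing the total error against itself, with
the unitary exp((λ-τ)L) moved to the test vector, bounds its ℓ² norm over γ with no loss in the
number of patches; only the final passage to the ℓ¹ norm costs M^{1/2}
(`sum_norm_evolution_sub_le`).

The number operator commutes with B, and with a pair annihilator up to a shift by 2. The pair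
annihilator left in the error is controlled by 𝒩_δ^{1/2}, because each pair has a mode at distance
more than q N^{-δ} from the Fermi sphere (`gap_of_mem_pairs`), and Grönwall's inequality propagates
𝒩_δ along the flow. As n_α² is at least of order N^{2/3-δ}/M (`le_nPair_sq`), the commutator errors
have size N^{-2/3+δ} M, and the factor M^{1/2} completes the rate.

The kernel enters only through the sum over k of the Hilbert-Schmidt norms of L(k), which is at most
a constant times ‖V̂‖₁ (`sum_hsNorm_matL_le`). In even and odd combinations of reflected patches all
matrices are block diagonal, and Õ is exactly the correction that makes both blocks of OÕ equal to
Q, the orthogonal factor of d^{1/2} E^{-1/2} with E² = d^{1/2}(d+2b)d^{1/2}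
(`polarFactor_mul_polarFactor`). Since b has rank one, E² is a rank one perturbation of d², and two
Sylvester equations, solved entrywise, bound ‖Q-1‖ by a multiple of the sum of g n_α²/d_α, where g
is the coupling (`frobSq_sqrt_perturbation_le`). On the unit circle |log z| ≤ C|z-1|, so L(k) obeys
the same bound. The upper bound on n_α², of order k_F² M^{-1} k·ω̂_α (`card_pairs_le`), cancels the
small denominators and leaves C V̂(k).

Both bounds on n_α² count lattice points in shells that may be thinner than the lattice spacing;
translating the points along the momentum transfer spreads them over a slab of sufficient thickness.
-/

theorem annihilate_apply (p : Momentum) (ψ : Fock) (S : Finset Momentum) :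
    annihilate p ψ S = if p ∈ S then 0 else fermiSign p S * ψ (insert p S) := rfl

theorem star_fermiSign (p : Momentum) (S : Finset Momentum) :
    (starRingEnd ℂ) (fermiSign p S) = fermiSign p S := by
  simp [fermiSign]

theorem fermiSign_mul_self (p : Momentum) (S : Finset Momentum) :
    fermiSign p S * fermiSign p S = 1 := by
  rw [fermiSign, ← mul_pow]; simp

/-- Coefficients are inner products with basis vectors, so the adjoint can be read off from the
action of `annihilate p` on them. -/
theorem create_apply (p : Momentum) (ψ : Fock) (S : Finset Momentum) :
    create p ψ S = if p ∈ S then fermiSign p (S.erase p) * ψ (S.erase p) else 0 := by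
  classical
  have h : inner ℂ (lp.single 2 S (1 : ℂ) : Fock) (create p ψ)
      = inner ℂ (annihilate p (lp.single 2 S (1 : ℂ) : Fock)) ψ := by
    rw [create, ContinuousLinearMap.adjoint_inner_right]
  rw [lp.inner_single_left] at h
  have h1 : inner ℂ (1 : ℂ) (create p ψ S) = create p ψ S := by simp
  rw [h1] at h
  rw [h]
  by_cases hp : p ∈ S
  · have h2 : annihilate p (lp.single 2 S (1 : ℂ) : Fock)
        = lp.single 2 (S.erase p) (fermiSign p (S.erase p)) := by
      ext T
      rw [annihilate_apply, lp.single_apply, lp.single_apply, Pi.single_apply, Pi.single_apply]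
      by_cases hT : p ∈ T
      · have : T ≠ S.erase p := by rintro rfl; simp at hT
        simp [hT, this]
      · by_cases h3 : insert p T = S
        · have : T = S.erase p := by rw [← h3, Finset.erase_insert hT]
          simp [this, hp]
        · have : T ≠ S.erase p := by
            rintro rfl; exact h3 (Finset.insert_erase hp)
          simp [this, h3]
    rw [h2, lp.inner_single_left, if_pos hp]
    simp [star_fermiSign, mul_comm]
  · have h2 : annihilate p (lp.single 2 S (1 : ℂ) : Fock) = 0 := by
      ext T
      rw [annihilate_apply, lp.single_apply, Pi.single_apply]
      by_cases hT : p ∈ T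
      · simp [hT]
      · have : insert p T ≠ S := by rintro rfl; simp at hp
        simp [this]
    rw [h2, if_neg hp]; simp

open scoped Classical in
theorem fermiSign_insert {p q : Momentum} {S : Finset Momentum} (hq : q ∉ S) :
    fermiSign p (insert q S) = (if toLex q < toLex p then -1 else 1) * fermiSign p S := by
  rw [fermiSign, fermiSign]
  by_cases h : toLex q < toLex p
  · rw [Finset.filter_insert, if_pos h, if_pos h, Finset.card_insert_of_notMem (by simp [hq]),
      pow_succ]; ring
  · rw [Finset.filter_insert, if_neg h, if_neg h, one_mul]

-- For distinct modes exactly one of the two orderings holds. This one sign is the source of all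
-- anticommutation.
open scoped Classical in
theorem fermiSign_swap {p q : Momentum} (hpq : p ≠ q) :
    (if toLex q < toLex p then (-1 : ℂ) else 1) = -(if toLex p < toLex q then -1 else 1) := by
  split_ifs with h1 h2 h2
  · exact absurd h2 (lt_asymm h1)
  · rfl
  · ring
  · exact absurd (toLex_inj.1 (le_antisymm (not_lt.1 h1) (not_lt.1 h2))) hpq

theorem annihilate_mul_annihilate (p q : Momentum) :
    annihilate p * annihilate q = -(annihilate q * annihilate p) := by
  ext ψ S
  change annihilate p (annihilate q ψ) S = -(annihilate q (annihilate p ψ) S)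
  simp only [annihilate_apply]
  by_cases hpq : p = q
  · subst hpq; simp
  by_cases hp : p ∈ S <;> by_cases hq : q ∈ S <;> simp [hp, hq, hpq, Ne.symm hpq]
  rw [fermiSign_insert hp, fermiSign_insert hq, fermiSign_swap hpq, Finset.insert_comm p q]
  ring

theorem annihilate_mul_create (p q : Momentum) :
    annihilate p * create q = (if p = q then 1 else 0) - create q * annihilate p := by
  ext ψ S
  by_cases hpq : p = q
  · subst hpq
    rw [if_pos rfl]
    change annihilate p (create p ψ) S = ψ S - create p (annihilate p ψ) S
    simp only [annihilate_apply, create_apply]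
    by_cases hp : p ∈ S
    · simp [hp, ← mul_assoc, fermiSign_mul_self]
    · simp [hp, ← mul_assoc, fermiSign_mul_self]
  · rw [if_neg hpq, zero_sub]
    change annihilate p (create q ψ) S = -(create q (annihilate p ψ) S)
    simp only [annihilate_apply, create_apply]
    by_cases hp : p ∈ S <;> by_cases hq : q ∈ S <;> simp [hp, hq, hpq, Ne.symm hpq]
    -- Only states with `q` occupied and `p` empty survive. Removing `q` exposes both signs on the
    -- common set `T`.
    obtain ⟨T, hT, rfl⟩ : ∃ T, q ∉ T ∧ insert q T = S :=
      ⟨S.erase q, by simp, Finset.insert_erase hq⟩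
    have hpT : p ∉ T := fun h => hp (Finset.mem_insert_of_mem h)
    rw [Finset.insert_comm, Finset.erase_insert (by simp [hT, Ne.symm hpq]),
      Finset.erase_insert hT, fermiSign_insert hT, fermiSign_insert hpT, fermiSign_swap hpq]
    split_ifs <;> ring

theorem annihilate_annihilate (p q : Momentum) (x : Fock) :
    annihilate p (annihilate q x) = -annihilate q (annihilate p x) :=
  DFunLike.congr_fun (annihilate_mul_annihilate p q) x

theorem annihilate_create (p q : Momentum) (x : Fock) :
    annihilate p (create q x) = (if p = q then x else 0) - create q (annihilate p x) := by
  have h := DFunLike.congr_fun (annihilate_mul_create p q) x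
  by_cases hpq : p = q
  · rw [if_pos hpq] at h ⊢; exact h
  · rw [if_neg hpq] at h ⊢; exact h

theorem re_inner_self (x : Fock) : (inner ℂ x x).re = ‖x‖ ^ 2 :=
  inner_self_eq_norm_sq (𝕜 := ℂ) x

theorem adjoint_create (p : Momentum) :
    ContinuousLinearMap.adjoint (create p) = annihilate p := by
  rw [create, ContinuousLinearMap.adjoint_adjoint]

theorem star_annihilate (p : Momentum) : star (annihilate p) = create p := rfl

theorem star_create (p : Momentum) : star (create p) = annihilate p := adjoint_create p

theorem inner_create_left (p : Momentum) (x y : Fock) :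
    inner ℂ (create p x) y = inner ℂ x (annihilate p y) := by
  rw [create, ContinuousLinearMap.adjoint_inner_left]

theorem inner_create_right (p : Momentum) (x y : Fock) :
    inner ℂ x (create p y) = inner ℂ (annihilate p x) y := by
  rw [create, ContinuousLinearMap.adjoint_inner_right]

/-! ### Number operators of finite sets of modes -/

noncomputable section

/-- The number operator of the modes in `Q`. -/
def modeNumber (Q : Finset Momentum) : Fock →L[ℂ] Fock :=
  ∑ p ∈ Q, create p * annihilate p

theorem create_mul_annihilate_apply (p : Momentum) (ψ : Fock) (S : Finset Momentum) :
    create p (annihilate p ψ) S = if p ∈ S then ψ S else 0 := by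
  rw [create_apply]
  by_cases h : p ∈ S
  · simp [h, annihilate_apply, ← mul_assoc, fermiSign_mul_self]
  · simp [h]

theorem Fock.sum_apply {ι : Type*} (s : Finset ι) (f : ι → Fock) (S : Finset Momentum) :
    (∑ i ∈ s, f i) S = ∑ i ∈ s, f i S := by
  classical
  induction s using Finset.induction_on with
  | empty => simp
  | insert a s ha ih => rw [Finset.sum_insert ha, Finset.sum_insert ha, lp.coeFn_add, Pi.add_apply, ih]

theorem modeNumber_apply (Q : Finset Momentum) (ψ : Fock) (S : Finset Momentum) :
    modeNumber Q ψ S = ((Q ∩ S).card : ℂ) * ψ S := by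
  have h : ∀ p ∈ Q, (create p * annihilate p) ψ S = if p ∈ S then ψ S else 0 :=
    fun p _ => create_mul_annihilate_apply p ψ S
  rw [modeNumber, sum_apply, Fock.sum_apply, Finset.sum_congr rfl h, ← Finset.sum_filter, Finset.sum_const, Finset.filter_mem_eq_inter, nsmul_eq_mul]

theorem star_modeNumber (Q : Finset Momentum) : star (modeNumber Q) = modeNumber Q := by
  simp [modeNumber, star_sum, star_create, star_annihilate]

theorem modeNumber_mul_annihilate (Q : Finset Momentum) (p : Momentum) :
    modeNumber Q * annihilate p
      = annihilate p * modeNumber Q - (if p ∈ Q then 1 else 0 : ℂ) • annihilate p := by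
  ext ψ S
  change modeNumber Q (annihilate p ψ) S
    = annihilate p (modeNumber Q ψ) S - (if p ∈ Q then 1 else 0 : ℂ) * annihilate p ψ S
  simp only [modeNumber_apply, annihilate_apply]
  by_cases hp : p ∈ S
  · simp [hp]
  · by_cases hQ : p ∈ Q
    · rw [Finset.inter_insert_of_mem hQ, Finset.card_insert_of_notMem (by simp [hp])]
      simp [hp, hQ]; ring
    · rw [Finset.inter_insert_of_notMem hQ]
      simp [hp, hQ]; ring

theorem re_inner_modeNumber (Q : Finset Momentum) (x : Fock) :
    (inner ℂ x (modeNumber Q x)).re = ∑ p ∈ Q, ‖annihilate p x‖ ^ 2 := by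
  rw [modeNumber, sum_apply, inner_sum, Complex.re_sum]
  refine Finset.sum_congr rfl fun p _ => ?_
  change (inner ℂ x (create p (annihilate p x))).re = _
  rw [inner_create_right, re_inner_self]

theorem inner_modeNumber_left (Q : Finset Momentum) (x y : Fock) :
    inner ℂ (modeNumber Q x) y = inner ℂ x (modeNumber Q y) := by
  have := ContinuousLinearMap.adjoint_inner_left (modeNumber Q) y x
  rw [← ContinuousLinearMap.star_eq_adjoint, star_modeNumber] at this
  exact this

/-- `∑_{p, q ∈ Q} ‖a_q a_p x‖² + ∑_{p ∈ Q} ‖a_p x‖² = ‖N_Q x‖²`. -/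
theorem sum_norm_annihilate_annihilate (Q : Finset Momentum) (x : Fock) :
    ∑ p ∈ Q, ∑ q ∈ Q, ‖annihilate q (annihilate p x)‖ ^ 2 + ∑ p ∈ Q, ‖annihilate p x‖ ^ 2
      = ‖modeNumber Q x‖ ^ 2 := by
  rw [← Finset.sum_add_distrib]
  have h : ∀ p ∈ Q, ∑ q ∈ Q, ‖annihilate q (annihilate p x)‖ ^ 2 + ‖annihilate p x‖ ^ 2
      = (inner ℂ x (create p (annihilate p (modeNumber Q x)))).re := by
    intro p hp
    have h1 := DFunLike.congr_fun (modeNumber_mul_annihilate Q p) x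
    rw [if_pos hp, one_smul] at h1
    change modeNumber Q (annihilate p x) = annihilate p (modeNumber Q x) - annihilate p x at h1
    rw [← re_inner_modeNumber, h1, inner_sub_right, Complex.sub_re, inner_create_right,
      re_inner_self]
    ring
  rw [Finset.sum_congr rfl h, ← Complex.re_sum, ← inner_sum]
  have h2 : ∑ p ∈ Q, create p (annihilate p (modeNumber Q x)) = modeNumber Q (modeNumber Q x) := by
    conv_rhs => rw [modeNumber, sum_apply]
    rfl
  rw [h2, ← inner_modeNumber_left, re_inner_self]

/-- A sum of hopping operators along a partial permutation of the modes in `Ω` is bounded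
by the number operator of `Ω`. -/
theorem norm_hop_le (Ω Q : Finset Momentum) (f : Momentum → Momentum)
    (hQ : Q ⊆ Ω) (hf : ∀ p ∈ Q, f p ∈ Ω) (hinj : Set.InjOn f Q) (x : Fock) :
    ‖(∑ p ∈ Q, create p * annihilate (f p)) x‖ ≤ ‖modeNumber Ω x‖ := by
  classical
  refine le_of_sq_le_sq ?_ (norm_nonneg _) 
  set y := (∑ p ∈ Q, create p * annihilate (f p)) x with hy
  have hy' : y = ∑ p ∈ Q, create p (annihilate (f p) x) := by
    rw [hy, sum_apply]; rfl
  -- Anticommuting leaves a contraction at `p = q` and a quartic term, split by 2ab ≤ a² + b².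
  -- Summed up, these are at most the two sums that make up ‖N_Ω x‖² in
  -- `sum_norm_annihilate_annihilate`.
  have hinner : ∀ p ∈ Q, ∀ q ∈ Q, (inner ℂ (create p (annihilate (f p) x))
      (create q (annihilate (f q) x))).re ≤ (if p = q then ‖annihilate (f p) x‖ ^ 2 else 0)
      + (‖annihilate q (annihilate (f p) x)‖ ^ 2 + ‖annihilate p (annihilate (f q) x)‖ ^ 2) / 2 := by
    intro p _ q _
    rw [inner_create_left, annihilate_create, inner_sub_right, Complex.sub_re, inner_create_right]
    have h2 : -(inner ℂ (annihilate q (annihilate (f p) x)) (annihilate p (annihilate (f q) x))).re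
        ≤ (‖annihilate q (annihilate (f p) x)‖ ^ 2
          + ‖annihilate p (annihilate (f q) x)‖ ^ 2) / 2 := by
      have h3 := Complex.abs_re_le_norm
        (inner ℂ (annihilate q (annihilate (f p) x)) (annihilate p (annihilate (f q) x)))
      have h4 := norm_inner_le_norm (𝕜 := ℂ) (annihilate q (annihilate (f p) x))
        (annihilate p (annihilate (f q) x))
      have h5 := neg_abs_le
        (inner ℂ (annihilate q (annihilate (f p) x)) (annihilate p (annihilate (f q) x))).re
      nlinarith [sq_nonneg (‖annihilate q (annihilate (f p) x)‖
        - ‖annihilate p (annihilate (f q) x)‖)]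
    by_cases hpq : p = q
    · subst hpq
      rw [if_pos rfl, if_pos rfl, re_inner_self]; linarith
    · rw [if_neg hpq, if_neg hpq, inner_zero_right, Complex.zero_re]
      linarith
  have h1 : ‖y‖ ^ 2 = ∑ p ∈ Q, ∑ q ∈ Q, (inner ℂ (create p (annihilate (f p) x))
      (create q (annihilate (f q) x))).re := by
    rw [← re_inner_self, hy', sum_inner, Complex.re_sum]
    refine Finset.sum_congr rfl fun p _ => ?_
    rw [inner_sum, Complex.re_sum]
  have hsub : Q.image f ⊆ Ω := by
    intro r hr; obtain ⟨p, hp, rfl⟩ := Finset.mem_image.1 hr; exact hf p hp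
  have h2 : ∑ p ∈ Q, ‖annihilate (f p) x‖ ^ 2 ≤ ∑ p ∈ Ω, ‖annihilate p x‖ ^ 2 := by
    rw [← Finset.sum_image (f := fun p => ‖annihilate p x‖ ^ 2) hinj]
    exact Finset.sum_le_sum_of_subset_of_nonneg hsub fun _ _ _ => sq_nonneg _
  have h3 : ∑ p ∈ Q, ∑ q ∈ Q, ‖annihilate q (annihilate (f p) x)‖ ^ 2
      ≤ ∑ p ∈ Ω, ∑ q ∈ Ω, ‖annihilate q (annihilate p x)‖ ^ 2 := by
    calc ∑ p ∈ Q, ∑ q ∈ Q, ‖annihilate q (annihilate (f p) x)‖ ^ 2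
        ≤ ∑ p ∈ Q, ∑ q ∈ Ω, ‖annihilate q (annihilate (f p) x)‖ ^ 2 :=
          Finset.sum_le_sum fun p _ =>
            Finset.sum_le_sum_of_subset_of_nonneg hQ fun _ _ _ => sq_nonneg _
      _ = ∑ p ∈ Q.image f, ∑ q ∈ Ω, ‖annihilate q (annihilate p x)‖ ^ 2 := by
          rw [Finset.sum_image hinj]
      _ ≤ _ := Finset.sum_le_sum_of_subset_of_nonneg hsub fun _ _ _ =>
          Finset.sum_nonneg fun _ _ => sq_nonneg _
  have h4 := Finset.sum_comm (s := Q) (t := Q)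
    (f := fun p q => ‖annihilate p (annihilate (f q) x)‖ ^ 2)
  rw [h1, ← sum_norm_annihilate_annihilate]
  refine (Finset.sum_le_sum fun p hp => Finset.sum_le_sum fun q hq => hinner p hp q hq).trans ?_
  simp only [Finset.sum_add_distrib, ← Finset.sum_div, h4]
  have h5 : ∑ p ∈ Q, ∑ q ∈ Q, (if p = q then ‖annihilate (f p) x‖ ^ 2 else 0)
      = ∑ p ∈ Q, ‖annihilate (f p) x‖ ^ 2 :=
    Finset.sum_congr rfl fun p hp => by rw [Finset.sum_ite_eq, if_pos hp]
  rw [h5]; linarith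

end

noncomputable section

/-! ### Pair operators -/

theorem norm_annihilate_le (p : Momentum) (x : Fock) : ‖annihilate p x‖ ≤ ‖x‖ := by
  refine ((annihilate p).le_of_opNorm_le (LinearMap.mkContinuous_norm_le _ zero_le_one _) x).trans ?_
  rw [one_mul]

/-- Here `a`, `b` stand for the hole and particle annihilators, `c`, `d` for the particle and hole
creators, and `e₁`, `e₂` for the contractions. Only particle with particle and hole with hole
contract, and the contractions are scalars 0 or 1. -/
theorem pair_commutator_of_ring {A : Type*} [Ring A] {a b c d e₁ e₂ : A} (hbc : b * c = e₁ - c * b)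
    (hbd : b * d = -(d * b)) (hac : a * c = -(c * a)) (had : a * d = e₂ - d * a)
    (h₁ : Commute a e₁) (h₂ : Commute c e₂) :
    a * b * (c * d) - c * d * (a * b) = e₁ * e₂ - e₁ * (d * a) - e₂ * (c * b) := by
  have h : a * b * (c * d) = e₁ * e₂ - e₁ * (d * a) - e₂ * (c * b) + c * d * (a * b) := by
    calc a * b * (c * d) = a * (b * c) * d := by noncomm_ring
      _ = a * e₁ * d - a * c * (b * d) := by rw [hbc]; noncomm_ring
      _ = e₁ * (a * d) - c * (a * d) * b := by rw [h₁.eq, hac, hbd]; noncomm_ring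
      _ = e₁ * e₂ - e₁ * (d * a) - c * e₂ * b + c * d * (a * b) := by rw [had]; noncomm_ring
      _ = _ := by rw [h₂.eq]; noncomm_ring
  rw [h]; abel

/-- The commutator of a pair annihilation with a pair creation operator. -/
theorem pair_commutator {p h p' h' : Momentum} (h1 : p ≠ h') (h2 : p' ≠ h) :
    annihilate h' * annihilate p' * (create p * create h)
        - create p * create h * (annihilate h' * annihilate p')
      = (if p' = p then 1 else 0) * (if h' = h then 1 else 0)
        - (if p' = p then 1 else 0) * (create h * annihilate h')
        - (if h' = h then 1 else 0) * (create p * annihilate p') := by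
  refine pair_commutator_of_ring (annihilate_mul_create p' p) ?_ ?_ (annihilate_mul_create h' h) ?_ ?_
  · rw [annihilate_mul_create, if_neg h2, zero_sub]
  · rw [annihilate_mul_create, if_neg h1.symm, zero_sub]
  · split_ifs
    · exact Commute.one_right _
    · exact Commute.zero_right _
  · split_ifs
    · exact Commute.one_right _
    · exact Commute.zero_right _

/-- Weighted sum `∑_{p ∈ A} w_p a_{p-k} a_p`. -/
def pairAnn (A : Finset Momentum) (k : Momentum) (w : Momentum → ℂ) : Fock →L[ℂ] Fock :=
  ∑ p ∈ A, w p • (annihilate (p - k) * annihilate p)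

theorem star_pairAnn_one (A : Finset Momentum) (k : Momentum) :
    star (pairAnn A k 1) = ∑ p ∈ A, create p * create (p - k) := by
  simp [pairAnn, star_sum, star_annihilate]

theorem pairAnn_apply (A : Finset Momentum) (k : Momentum) (w : Momentum → ℂ) (x : Fock) :
    pairAnn A k w x = ∑ p ∈ A, w p • annihilate (p - k) (annihilate p x) := by
  rw [pairAnn, sum_apply]; rfl

/-- A pair lowers the number of particles in `Q` by 0, 1 or 2, depending on the pair. This is why
`pairAnn` carries weights. -/
theorem modeNumber_mul_pairAnn (Q A : Finset Momentum) (k : Momentum) (w : Momentum → ℂ) :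
    modeNumber Q * pairAnn A k w = pairAnn A k w * modeNumber Q
      - pairAnn A k fun p => w p * ((if p ∈ Q then 1 else 0) + (if p - k ∈ Q then 1 else 0)) := by
  simp only [pairAnn, Finset.mul_sum, Finset.sum_mul]
  rw [← Finset.sum_sub_distrib]
  refine Finset.sum_congr rfl fun p _ => ?_
  rw [mul_smul_comm, ← mul_assoc, modeNumber_mul_annihilate, sub_mul, mul_assoc,
    modeNumber_mul_annihilate, mul_sub, smul_mul_assoc, smul_mul_assoc, mul_smul_comm, mul_assoc,
    smul_sub, smul_sub, mul_add, add_smul, smul_smul, smul_smul]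
  abel

theorem norm_pairAnn_sq_le (A : Finset Momentum) (k : Momentum) (w : Momentum → ℂ) {b : ℝ}
    (hw : ∀ p ∈ A, ‖w p‖ ≤ b) (x : Fock) :
    ‖pairAnn A k w x‖ ^ 2 ≤ A.card * (b ^ 2 * ∑ p ∈ A, ‖annihilate (p - k) (annihilate p x)‖ ^ 2) := by
  have h1 : ‖pairAnn A k w x‖ ≤ ∑ p ∈ A, b * ‖annihilate (p - k) (annihilate p x)‖ := by
    rw [pairAnn_apply]
    refine (norm_sum_le _ _).trans (Finset.sum_le_sum fun p hp => ?_)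
    rw [norm_smul]
    exact mul_le_mul_of_nonneg_right (hw p hp) (norm_nonneg _)
  calc ‖pairAnn A k w x‖ ^ 2 ≤ (∑ p ∈ A, b * ‖annihilate (p - k) (annihilate p x)‖) ^ 2 := by
        gcongr
    _ ≤ A.card * ∑ p ∈ A, (b * ‖annihilate (p - k) (annihilate p x)‖) ^ 2 :=
        sq_sum_le_card_mul_sum_sq
    _ = _ := by simp only [mul_pow, Finset.mul_sum]

/-- A family of normalized pair operators with disjoint sets of modes, where each pair has a mode
in `G`, is bounded by the number operator of `G`. -/
theorem sum_norm_pairAnn_sq_le {ι : Type*} [Fintype ι] (A : ι → Finset Momentum)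
    (k : ι → Momentum) (w : ι → Momentum → ℂ) {b : ℝ}
    (hw : ∀ i, ∀ p ∈ A i, ‖w i p‖ ≤ b) (G : Finset Momentum)
    (hG : ∀ i, ∀ p ∈ A i, p ∈ G ∨ p - k i ∈ G)
    (hpp : ∀ i, ∀ p ∈ A i, ∀ j, ∀ q ∈ A j, p = q → i = j)
    (hhh : ∀ i, ∀ p ∈ A i, ∀ j, ∀ q ∈ A j, p - k i = q - k j → i = j)
    (hph : ∀ i, ∀ p ∈ A i, ∀ j, ∀ q ∈ A j, p ≠ q - k j) (x : Fock) :
    ∑ i, ‖((Real.sqrt (A i).card : ℂ)⁻¹) • pairAnn (A i) (k i) (w i) x‖ ^ 2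
      ≤ b ^ 2 * ∑ p ∈ G, ‖annihilate p x‖ ^ 2 := by
  classical
  have h1 : ∀ i, ‖((Real.sqrt (A i).card : ℂ)⁻¹) • pairAnn (A i) (k i) (w i) x‖ ^ 2
      ≤ b ^ 2 * ∑ p ∈ A i, ‖annihilate (p - k i) (annihilate p x)‖ ^ 2 := by
    intro i
    have h2 := norm_pairAnn_sq_le (A i) (k i) (w i) (hw i) x
    rw [norm_smul, mul_pow, norm_inv, inv_pow, Complex.norm_real, Real.norm_eq_abs, sq_abs,
      Real.sq_sqrt (Nat.cast_nonneg _)]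
    -- An empty set of pairs is harmless: the normalization `0⁻¹` is 0.
    rcases Nat.eq_zero_or_pos (A i).card with h0 | h0
    · rw [h0, Nat.cast_zero, inv_zero, zero_mul]; positivity
    · have h3 : (0 : ℝ) < (A i).card := by exact_mod_cast h0
      rw [inv_mul_le_iff₀ h3]; exact h2
  refine (Finset.sum_le_sum fun i _ => h1 i).trans ?_
  rw [← Finset.mul_sum]
  refine mul_le_mul_of_nonneg_left ?_ (sq_nonneg b)
  rw [Finset.sum_sigma' Finset.univ A
    (fun i p => ‖annihilate (p - k i) (annihilate p x)‖ ^ 2)]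
  set T := Finset.univ.sigma A
  -- From each pair select a mode in `G` and drop the other annihilator, whose norm is at most 1.
  -- Disjointness of the families makes the selection injective, so each mode of `G` is used at most
  -- once.
  let g : (Σ _ : ι, Momentum) → Momentum := fun y => if y.2 ∈ G then y.2 else y.2 - k y.1
  have hT : ∀ y ∈ T, y.2 ∈ A y.1 := fun y hy => (Finset.mem_sigma.1 hy).2
  have hg : ∀ y ∈ T, ‖annihilate (y.2 - k y.1) (annihilate y.2 x)‖ ^ 2 ≤ ‖annihilate (g y) x‖ ^ 2 := by
    intro y _
    by_cases hy : y.2 ∈ G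
    · simp only [g, if_pos hy]
      gcongr
      exact norm_annihilate_le _ _
    · simp only [g, if_neg hy]
      rw [annihilate_annihilate, norm_neg]
      gcongr
      exact norm_annihilate_le _ _
  have hinj : Set.InjOn g T := by
    intro y hy z hz hyz
    have hy' := hT y hy
    have hz' := hT z hz
    have key : y.1 = z.1 → y.2 = z.2 → y = z := fun h1 h2 => Sigma.ext h1 (heq_of_eq h2)
    by_cases h1 : y.2 ∈ G <;> by_cases h2 : z.2 ∈ G <;>
      simp only [g, h1, h2, if_true, if_false] at hyz
    · exact key (hpp _ _ hy' _ _ hz' hyz) hyz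
    · exact absurd hyz (hph _ _ hy' _ _ hz')
    · exact absurd hyz.symm (hph _ _ hz' _ _ hy')
    · have h3 := hhh _ _ hy' _ _ hz' hyz
      rw [h3] at hyz
      exact key h3 (sub_left_injective hyz)
  refine (Finset.sum_le_sum hg).trans ?_
  rw [← Finset.sum_image (f := fun p => ‖annihilate p x‖ ^ 2) hinj]
  refine Finset.sum_le_sum_of_subset_of_nonneg ?_ fun _ _ _ => sq_nonneg _
  intro p hp
  obtain ⟨y, hy, rfl⟩ := Finset.mem_image.1 hp
  by_cases h1 : y.2 ∈ G
  · simpa only [g, if_pos h1] using h1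
  · simpa only [g, if_neg h1] using (hG _ _ (hT y hy)).resolve_left h1

theorem annihilate_pair_commute (p h p' h' : Momentum) :
    Commute (annihilate h * annihilate p) (annihilate h' * annihilate p') := by
  have e : ∀ a b : Momentum, annihilate a * annihilate b = -(annihilate b * annihilate a) :=
    annihilate_mul_annihilate
  change annihilate h * annihilate p * (annihilate h' * annihilate p')
    = annihilate h' * annihilate p' * (annihilate h * annihilate p)
  calc annihilate h * annihilate p * (annihilate h' * annihilate p')
      = annihilate h * (annihilate p * annihilate h') * annihilate p' := by noncomm_ring
    _ = -((annihilate h * annihilate h') * (annihilate p * annihilate p')) := by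
        rw [e p h']; noncomm_ring
    _ = -((annihilate h' * annihilate h) * (annihilate p' * annihilate p)) := by
        rw [e h h', e p p']; noncomm_ring
    _ = -(annihilate h' * (annihilate h * annihilate p') * annihilate p) := by noncomm_ring
    _ = _ := by rw [e h p']; noncomm_ring

theorem pairAnn_commute (A A' : Finset Momentum) (k k' : Momentum) (w w' : Momentum → ℂ) :
    Commute (pairAnn A k w) (pairAnn A' k' w') := by
  refine Commute.sum_left _ _ _ fun p _ => Commute.sum_right _ _ _ fun q _ => ?_
  exact ((annihilate_pair_commute _ _ _ _).smul_left _).smul_right _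

/-- The commutator of a sum of pair annihilation operators with a sum of pair creation operators is,
up to a multiple of the identity, bounded by the number operator. -/
theorem pairAnn_commutator (Ω A A' : Finset Momentum) (k k' : Momentum)
    (hA : ∀ p ∈ A, p ∈ Ω ∧ p - k ∈ Ω) (hA' : ∀ p ∈ A', p ∈ Ω ∧ p - k' ∈ Ω)
    (h : ∀ p ∈ A, ∀ q ∈ A', p ≠ q - k' ∧ q ≠ p - k) :
    ∃ E : Fock →L[ℂ] Fock,
      pairAnn A' k' 1 * star (pairAnn A k 1) - star (pairAnn A k 1) * pairAnn A' k' 1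
        = (if k = k' then ((A' ∩ A).card : ℂ) else 0) • 1 + E ∧
      ((∀ p ∈ A, ∀ q ∈ A', p ≠ q ∧ p - k ≠ q - k') → E = 0) ∧
      ∀ x, ‖E x‖ ≤ 2 * ‖modeNumber Ω x‖ := by
  classical
  have hc : pairAnn A' k' 1 * star (pairAnn A k 1) - star (pairAnn A k 1) * pairAnn A' k' 1
      = ∑ q ∈ A', ∑ p ∈ A, ((if q = p then 1 else 0) * (if q - k' = p - k then 1 else 0)
        - (if q = p then 1 else 0) * (create (p - k) * annihilate (q - k'))
        - (if q - k' = p - k then 1 else 0) * (create p * annihilate q)) := by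
    have e : pairAnn A' k' 1 = ∑ q ∈ A', annihilate (q - k') * annihilate q := by
      simp [pairAnn]
    rw [star_pairAnn_one, e, Finset.sum_mul_sum, Finset.sum_mul_sum, Finset.sum_comm (s := A),
      ← Finset.sum_sub_distrib]
    refine Finset.sum_congr rfl fun q hq => ?_
    rw [← Finset.sum_sub_distrib]
    refine Finset.sum_congr rfl fun p hp => ?_
    exact pair_commutator (h p hp q hq).1 (h p hp q hq).2
  have h1 : ∑ q ∈ A', ∑ p ∈ A, ((if q = p then (1 : Fock →L[ℂ] Fock) else 0)
      * (if q - k' = p - k then 1 else 0)) = (if k = k' then ((A' ∩ A).card : ℂ) else 0) • 1 := by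
    have e : ∀ q ∈ A', ∑ p ∈ A, ((if q = p then (1 : Fock →L[ℂ] Fock) else 0)
        * (if q - k' = p - k then 1 else 0)) = if q ∈ A then (if k = k' then 1 else 0) else 0 := by
      intro q _
      simp only [ite_mul, one_mul, zero_mul, Finset.sum_ite_eq, sub_right_inj, eq_comm (a := k')]
    rw [Finset.sum_congr rfl e, ← Finset.sum_filter, Finset.sum_const, Finset.filter_mem_eq_inter]
    split_ifs
    · simp [← Nat.cast_smul_eq_nsmul ℂ]
    · simp
  set H₁ : Fock →L[ℂ] Fock := ∑ q ∈ A', ∑ p ∈ A, (if q = p then 1 else 0)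
    * (create (p - k) * annihilate (q - k')) with hH₁
  set H₂ : Fock →L[ℂ] Fock := ∑ q ∈ A', ∑ p ∈ A, (if q - k' = p - k then 1 else 0)
    * (create p * annihilate q) with hH₂
  refine ⟨-H₁ - H₂, ?_, ?_, ?_⟩
  · rw [hc, ← h1]
    simp only [Finset.sum_sub_distrib]
    rw [← hH₁, ← hH₂]; abel
  · intro hd
    have e1 : H₁ = 0 := Finset.sum_eq_zero fun q hq => Finset.sum_eq_zero fun p hp => by
      rw [if_neg (hd p hp q hq).1.symm, zero_mul]
    have e2 : H₂ = 0 := Finset.sum_eq_zero fun q hq => Finset.sum_eq_zero fun p hp => by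
      rw [if_neg (hd p hp q hq).2.symm, zero_mul]
    rw [e1, e2]; simp
  · intro x
    -- A contraction fixes one of the two pairs in terms of the other, so each double sum collapses
    -- to hoppings along a translation by ±(k - k'). Translations are injective, as `norm_hop_le`
    -- requires.
    have e1 : H₁ = ∑ r ∈ (A' ∩ A).image (· - k), create r * annihilate (r + (k - k')) := by
      rw [Finset.sum_image (fun a _ b _ hab => sub_left_injective hab), hH₁]
      rw [← Finset.filter_mem_eq_inter, Finset.sum_filter]
      refine Finset.sum_congr rfl fun q _ => ?_
      simp only [ite_mul, one_mul, zero_mul, Finset.sum_ite_eq, sub_add_sub_cancel]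
    have e2 : H₂ = ∑ p ∈ A.filter (fun p => p + (k' - k) ∈ A'),
        create p * annihilate (p + (k' - k)) := by
      rw [hH₂, Finset.sum_comm, Finset.sum_filter]
      refine Finset.sum_congr rfl fun p _ => ?_
      have e3 : ∀ q, (q - k' = p - k) = (q = p + (k' - k)) := by
        intro q
        rw [sub_eq_iff_eq_add]
        congr 1; abel_nf
      simp only [e3, ite_mul, one_mul, zero_mul, Finset.sum_ite_eq']
    have b1 : ‖H₁ x‖ ≤ ‖modeNumber Ω x‖ := by
      rw [e1]
      refine norm_hop_le Ω _ (fun r => r + (k - k')) ?_ ?_ (fun a _ b _ hab => add_left_injective _ hab) x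
      · intro r hr
        obtain ⟨q, hq, rfl⟩ := Finset.mem_image.1 hr
        exact (hA q (Finset.mem_inter.1 hq).2).2
      · intro r hr
        obtain ⟨q, hq, rfl⟩ := Finset.mem_image.1 hr
        simpa only [sub_add_sub_cancel] using (hA' q (Finset.mem_inter.1 hq).1).2
    have b2 : ‖H₂ x‖ ≤ ‖modeNumber Ω x‖ := by
      rw [e2]
      refine norm_hop_le Ω _ (fun r => r + (k' - k)) ?_ ?_ (fun a _ b _ hab => add_left_injective _ hab) x
      · intro r hr
        exact (hA r (Finset.mem_filter.1 hr).1).1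
      · intro r hr
        exact (hA' _ (Finset.mem_filter.1 hr).2).1
    calc ‖(-H₁ - H₂) x‖ = ‖-(H₁ x) - H₂ x‖ := rfl
      _ ≤ ‖-(H₁ x)‖ + ‖H₂ x‖ := norm_sub_le _ _
      _ ≤ _ := by rw [norm_neg]; linarith

end

noncomputable section

/-! ### Hilbert-Schmidt norm -/

/-- The Hilbert-Schmidt norm of a matrix. -/
def hsNorm {ι : Type*} [Fintype ι] (L : Matrix ι ι ℂ) : ℝ :=
  Real.sqrt (∑ α, ∑ β, ‖L α β‖ ^ 2)

theorem hsNorm_nonneg {ι : Type*} [Fintype ι] (L : Matrix ι ι ℂ) : 0 ≤ hsNorm L :=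
  Real.sqrt_nonneg _

theorem hsNorm_sq {ι : Type*} [Fintype ι] (L : Matrix ι ι ℂ) :
    hsNorm L ^ 2 = ∑ α, ∑ β, ‖L α β‖ ^ 2 :=
  Real.sq_sqrt (Finset.sum_nonneg fun _ _ => Finset.sum_nonneg fun _ _ => sq_nonneg _)

theorem sum_mul_mul_le_hsNorm {ι : Type*} [Fintype ι] (L : Matrix ι ι ℂ) (u v : ι → ℝ) :
    ∑ α, ∑ β, ‖L α β‖ * (u α * v β)
      ≤ hsNorm L * (Real.sqrt (∑ α, u α ^ 2) * Real.sqrt (∑ β, v β ^ 2)) := by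
  have h := Real.sum_mul_le_sqrt_mul_sqrt (Finset.univ : Finset (ι × ι))
    (fun y => ‖L y.1 y.2‖) (fun y => u y.1 * v y.2)
  rw [Fintype.sum_prod_type, Fintype.sum_prod_type, Fintype.sum_prod_type] at h
  refine h.trans_eq ?_
  have e : ∑ α, ∑ β, (u α * v β) ^ 2 = (∑ α, u α ^ 2) * ∑ β, v β ^ 2 := by
    rw [Finset.sum_mul_sum]; simp only [mul_pow]
  simp only [e]
  rw [Real.sqrt_mul (Finset.sum_nonneg fun _ _ => sq_nonneg _), hsNorm]

theorem unitary_sum_norm_sq {ι : Type*} [Fintype ι] [DecidableEq ι] {u : Matrix ι ι ℂ}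
    (hu : star u * u = 1) (g : ι → Fock) :
    ∑ γ, ‖∑ α, u γ α • g α‖ ^ 2 = ∑ α, ‖g α‖ ^ 2 := by
  have h : ∑ γ, inner ℂ (∑ α, u γ α • g α) (∑ β, u γ β • g β) = ∑ α, inner ℂ (g α) (g α) := by
    have e0 : ∀ γ, inner ℂ (∑ α, u γ α • g α) (∑ β, u γ β • g β)
        = ∑ α, ∑ β, (starRingEnd ℂ) (u γ α) * (u γ β * inner ℂ (g α) (g β)) := by
      intro γ
      rw [sum_inner]
      refine Finset.sum_congr rfl fun α _ => ?_
      rw [inner_sum]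
      refine Finset.sum_congr rfl fun β _ => ?_
      rw [inner_smul_left, inner_smul_right]
    rw [Finset.sum_congr rfl fun γ _ => e0 γ, Finset.sum_comm]
    refine Finset.sum_congr rfl fun α _ => ?_
    rw [Finset.sum_comm]
    have e : ∀ β, ∑ γ, (starRingEnd ℂ) (u γ α) * (u γ β * inner ℂ (g α) (g β))
        = if α = β then inner ℂ (g α) (g β) else 0 := by
      intro β
      have h1 := congrFun (congrFun hu α) β
      rw [Matrix.mul_apply, Matrix.one_apply] at h1
      simp only [← mul_assoc]
      rw [← Finset.sum_mul]
      change (∑ γ, star u α γ * u γ β) * _ = _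
      rw [h1]; split_ifs <;> simp
    rw [Finset.sum_congr rfl fun β _ => e β]
    simp
  have h1 := congrArg Complex.re h
  simpa only [Complex.re_sum, re_inner_self] using h1

/-! ### Grönwall -/

/-- For `s ≥ 0` the function exp(-Cs) f(s) is antitone. Negative times follow by reflection. -/
theorem gronwall_of_abs_deriv_le {f f' : ℝ → ℝ} {C : ℝ} (hf : ∀ s, HasDerivAt f (f' s) s)
    (h : ∀ s, |f' s| ≤ C * f s) (s : ℝ) : f s ≤ Real.exp (C * |s|) * f 0 := by
  have key : ∀ {f f' : ℝ → ℝ}, (∀ s, HasDerivAt f (f' s) s) → (∀ s, |f' s| ≤ C * f s) →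
      ∀ s, 0 ≤ s → f s ≤ Real.exp (C * s) * f 0 := by
    intro f f' hf h s hs
    have hd : ∀ x, HasDerivAt (fun x => Real.exp (-(C * x)) * f x)
        (Real.exp (-(C * x)) * (f' x - C * f x)) x := by
      intro x
      have h1 : HasDerivAt (fun x => Real.exp (-(C * x))) (Real.exp (-(C * x)) * (-(C * 1))) x :=
        (((hasDerivAt_id x).const_mul C).neg).exp
      exact (h1.mul (hf x)).congr_deriv (by ring)
    have hanti : Antitone fun x => Real.exp (-(C * x)) * f x := by
      refine antitone_of_hasDerivAt_nonpos hd fun x => ?_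
      have h2 := (le_abs_self _).trans (h x)
      exact mul_nonpos_of_nonneg_of_nonpos (Real.exp_pos _).le (by linarith)
    have h3 := hanti hs
    simp only [mul_zero, neg_zero, Real.exp_zero, one_mul] at h3
    calc f s = Real.exp (C * s) * (Real.exp (-(C * s)) * f s) := by
          rw [← mul_assoc, ← Real.exp_add]; simp
      _ ≤ _ := mul_le_mul_of_nonneg_left h3 (Real.exp_pos _).le
  rcases le_total 0 s with hs | hs
  · rw [abs_of_nonneg hs]; exact key hf h s hs
  · rw [abs_of_nonpos hs]
    have h1 : ∀ x, HasDerivAt (fun x => f (-x)) (-(f' (-x))) x := by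
      intro x
      exact ((hf (-x)).scomp x (hasDerivAt_neg x)).congr_deriv (by simp)
    have h2 := key h1 (fun x => by rw [abs_neg]; exact h (-x)) (-s) (by linarith)
    simpa using h2

/-! ### Evolution generated by a quadratic expression in pair operators -/

section Flow

variable {H : Type*} [NormedAddCommGroup H] [InnerProductSpace ℂ H] [CompleteSpace H]
  {B : H →L[ℂ] H}

theorem hasDerivAt_flow (B : H →L[ℂ] H) (z : ℂ) :
    HasDerivAt (fun z : ℂ => NormedSpace.exp (z • B)) (B * NormedSpace.exp (z • B)) z :=
  hasDerivAt_exp_smul_const' B z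

theorem hasDerivAt_flow_apply (B : H →L[ℂ] H) (x : H) (z : ℂ) :
    HasDerivAt (fun z : ℂ => NormedSpace.exp (z • B) x) (B (NormedSpace.exp (z • B) x)) z :=
  ((ContinuousLinearMap.apply ℂ H x).hasFDerivAt.comp_hasDerivAt z (hasDerivAt_flow B z))


theorem star_flow (hB : star B = -B) (s : ℝ) :
    star (NormedSpace.exp ((s : ℂ) • B)) = NormedSpace.exp ((-s : ℂ) • B) := by
  rw [NormedSpace.star_exp, star_smul, hB]; simp


theorem exp_mem_unitary_of_star_eq_neg {A : Type*} [NormedRing A] [NormedAlgebra ℂ A] [StarRing A]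
    [ContinuousStar A] [CompleteSpace A] {x : A} (h : star x = -x) :
    NormedSpace.exp x ∈ unitary A := by
  let +nondep : NormedAlgebra ℚ A := .restrictScalars ℚ ℂ A
  exact NormedSpace.exp_mem_unitary_of_mem_skewAdjoint (skewAdjoint.mem_iff.2 h)

theorem commute_exp_smul {A : Type*} [NormedRing A] [NormedAlgebra ℂ A] [CompleteSpace A] {x y : A}
    (h : Commute x y) (z : ℂ) : Commute x (NormedSpace.exp (z • y)) := by
  let +nondep : NormedAlgebra ℚ A := .restrictScalars ℚ ℂ A
  exact SemiconjBy.exp_right (h.smul_right z)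

theorem flow_mem_unitary (hB : star B = -B) (s : ℝ) :
    NormedSpace.exp ((s : ℂ) • B) ∈ unitary (H →L[ℂ] H) := by
  have h : star ((s : ℂ) • B) = -((s : ℂ) • B) := by
    rw [star_smul, hB]; simp
  exact exp_mem_unitary_of_star_eq_neg h

theorem norm_flow_apply (hB : star B = -B) (s : ℝ) (x : H) :
    ‖NormedSpace.exp ((s : ℂ) • B) x‖ = ‖x‖ :=
  ContinuousLinearMap.norm_map_of_mem_unitary (flow_mem_unitary hB s) x

theorem flow_comm {B N : H →L[ℂ] H} (h : Commute N B) (z : ℂ) (x : H) :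
    N (NormedSpace.exp (z • B) x) = NormedSpace.exp (z • B) (N x) :=
  DFunLike.congr_fun (commute_exp_smul h z) x

end Flow

section Evolution

variable {κ : Type*} (Γ : Finset κ) {I : κ → Type*} [∀ k, Fintype (I k)]
  (c : ∀ k, I k → (Fock →L[ℂ] Fock)) (L : ∀ k, Matrix (I k) (I k) ℂ)

/-- The operator `∑_k ∑_{α,β} L(k)_{α,β} c_α^*(k) c_β(k)`. -/
def quadGen : Fock →L[ℂ] Fock :=
  ∑ k ∈ Γ, ∑ α, ∑ β, L k α β • (star (c k α) * c k β)

theorem star_quadGen (hL : ∀ k ∈ Γ, star (L k) = -L k) : star (quadGen Γ c L) = -quadGen Γ c L := by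
  rw [quadGen, star_sum, ← Finset.sum_neg_distrib]
  refine Finset.sum_congr rfl fun k hk => ?_
  rw [star_sum, ← Finset.sum_neg_distrib]
  simp only [star_sum]
  rw [Finset.sum_comm]
  refine Finset.sum_congr rfl fun β _ => ?_
  rw [← Finset.sum_neg_distrib]
  refine Finset.sum_congr rfl fun α _ => ?_
  have h := congrFun (congrFun (hL k hk) β) α
  have h1 : star (L k α β) = -L k β α := h
  rw [star_smul, star_mul, star_star, h1, neg_smul]



/-- The quadratic generator commutes with an operator that shifts all pair operators equally. -/
theorem commute_quadGen {N : Fock →L[ℂ] Fock} (hN : star N = N) {μ : ℝ}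
    (h : ∀ k ∈ Γ, ∀ α, N * c k α = c k α * N - (μ : ℂ) • c k α) : Commute N (quadGen Γ c L) := by
  refine Commute.sum_right _ _ _ fun k hk => Commute.sum_right _ _ _ fun α _ =>
    Commute.sum_right _ _ _ fun β _ => Commute.smul_right ?_ _
  have h1 : star (c k α) * N = N * star (c k α) - (μ : ℂ) • star (c k α) := by
    have := congrArg star (h k hk α)
    rw [star_mul, star_sub, star_mul, hN, star_smul] at this
    rw [this]; simp
  have h2 : N * star (c k α) = star (c k α) * N + (μ : ℂ) • star (c k α) := by
    rw [h1]; abel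
  change N * (star (c k α) * c k β) = star (c k α) * c k β * N
  rw [← mul_assoc, h2, add_mul, mul_assoc, h k hk β, mul_sub, mul_assoc, smul_mul_assoc,
    mul_smul_comm]
  abel

/-- Only the ℓ² norms of the two families enter, so the Hilbert-Schmidt norm of the kernel suffices
and no factor of the number of patches is lost. -/
theorem norm_sum_smul_inner_le {ι : Type*} [Fintype ι] (L : Matrix ι ι ℂ) (c d : ι → (Fock →L[ℂ] Fock))
    (x : Fock) : ‖inner ℂ x (∑ α, ∑ β, L α β • (star (c α) * d β) x)‖
      ≤ hsNorm L * (Real.sqrt (∑ α, ‖c α x‖ ^ 2) * Real.sqrt (∑ β, ‖d β x‖ ^ 2)) := by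
  refine le_trans ?_ (sum_mul_mul_le_hsNorm L (fun α => ‖c α x‖) fun β => ‖d β x‖)
  rw [inner_sum]
  refine (norm_sum_le _ _).trans (Finset.sum_le_sum fun α _ => ?_)
  rw [inner_sum]
  refine (norm_sum_le _ _).trans (Finset.sum_le_sum fun β _ => ?_)
  rw [inner_smul_right, norm_mul]
  refine mul_le_mul_of_nonneg_left ?_ (norm_nonneg _)
  have h : inner ℂ x ((star (c α) * d β) x) = inner ℂ (c α x) (d β x) :=
    ContinuousLinearMap.adjoint_inner_right (c α) x (d β x)
  rw [h]
  exact norm_inner_le_norm _ _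

/-- Propagation of the number operator of the modes in `G`, if it bounds the pair operators and
their commutators with it. -/
theorem sum_norm_annihilate_flow_le (G : Finset Momentum) (hL : ∀ k ∈ Γ, star (L k) = -L k)
    (ct : ∀ k, I k → (Fock →L[ℂ] Fock))
    (hct : ∀ k ∈ Γ, ∀ α, modeNumber G * c k α = c k α * modeNumber G - ct k α)
    (hc : ∀ k ∈ Γ, ∀ x, ∑ α, ‖c k α x‖ ^ 2 ≤ ∑ p ∈ G, ‖annihilate p x‖ ^ 2)
    (hc' : ∀ k ∈ Γ, ∀ x, ∑ α, ‖ct k α x‖ ^ 2 ≤ 2 ^ 2 * ∑ p ∈ G, ‖annihilate p x‖ ^ 2)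
    (x : Fock) (s : ℝ) :
    ∑ p ∈ G, ‖annihilate p (NormedSpace.exp ((s : ℂ) • quadGen Γ c L) x)‖ ^ 2
      ≤ Real.exp (4 * (∑ k ∈ Γ, hsNorm (L k)) * |s|) * ∑ p ∈ G, ‖annihilate p x‖ ^ 2 := by
  set B := quadGen Γ c L with hBdef
  have hB : star B = -B := star_quadGen Γ c L hL
  set N := modeNumber G with hN
  have hcomm : N * B - B * N = ∑ k ∈ Γ, ∑ α, ∑ β, L k α β • (star (ct k α) * c k β)
      - ∑ k ∈ Γ, ∑ α, ∑ β, L k α β • (star (c k α) * ct k β) := by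
    rw [hBdef, quadGen]
    simp only [Finset.mul_sum, Finset.sum_mul, ← Finset.sum_sub_distrib]
    refine Finset.sum_congr rfl fun k hk => Finset.sum_congr rfl fun α _ =>
      Finset.sum_congr rfl fun β _ => ?_
    have h1 : N * star (c k α) = star (c k α) * N + star (ct k α) := by
      have h2 := congrArg star (hct k hk α)
      rw [star_mul, star_sub, star_mul, star_modeNumber] at h2
      rw [h2]; abel
    rw [mul_smul_comm, smul_mul_assoc, ← smul_sub, ← smul_sub, ← mul_assoc, h1, add_mul, mul_assoc,
      hct k hk β, mul_sub, mul_assoc]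
    congr 1; abel
  -- Each of the two commutator terms costs 2‖L(k)‖, where 2 is the square root of the constant `2 ^
  -- 2` in `hc'`. Together they give the 4.
  have hbound : ∀ y : Fock, ‖inner ℂ y ((N * B - B * N) y)‖
      ≤ 4 * (∑ k ∈ Γ, hsNorm (L k)) * ∑ p ∈ G, ‖annihilate p y‖ ^ 2 := by
    intro y
    set Y := ∑ p ∈ G, ‖annihilate p y‖ ^ 2 with hY
    have hY0 : 0 ≤ Y := Finset.sum_nonneg fun _ _ => sq_nonneg _
    have e1 : (N * B - B * N) y = ∑ k ∈ Γ, ∑ α, ∑ β, L k α β • (star (ct k α) * c k β) y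
        - ∑ k ∈ Γ, ∑ α, ∑ β, L k α β • (star (c k α) * ct k β) y := by
      rw [hcomm, sub_apply]
      simp only [sum_apply]; rfl
    have hs1 : ∀ k ∈ Γ, Real.sqrt (∑ α, ‖c k α y‖ ^ 2) ≤ Real.sqrt Y :=
      fun k hk => Real.sqrt_le_sqrt (hc k hk y)
    have hs2 : ∀ k ∈ Γ, Real.sqrt (∑ α, ‖ct k α y‖ ^ 2) ≤ 2 * Real.sqrt Y := by
      intro k hk
      refine (Real.sqrt_le_sqrt (hc' k hk y)).trans_eq ?_
      rw [Real.sqrt_mul (by norm_num), Real.sqrt_sq (by norm_num)]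
    have hYY : Real.sqrt Y * Real.sqrt Y = Y := Real.mul_self_sqrt hY0
    have t1 : ‖inner ℂ y (∑ k ∈ Γ, ∑ α, ∑ β, L k α β • (star (ct k α) * c k β) y)‖
        ≤ ∑ k ∈ Γ, hsNorm (L k) * (2 * Y) := by
      rw [inner_sum]
      refine (norm_sum_le _ _).trans (Finset.sum_le_sum fun k hk => ?_)
      refine (norm_sum_smul_inner_le (L k) (ct k) (c k) y).trans ?_
      refine mul_le_mul_of_nonneg_left ?_ (hsNorm_nonneg _)
      calc _ ≤ 2 * Real.sqrt Y * Real.sqrt Y :=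
            mul_le_mul (hs2 k hk) (hs1 k hk) (Real.sqrt_nonneg _) (by positivity)
        _ = _ := by rw [mul_assoc, hYY]
    have t2 : ‖inner ℂ y (∑ k ∈ Γ, ∑ α, ∑ β, L k α β • (star (c k α) * ct k β) y)‖
        ≤ ∑ k ∈ Γ, hsNorm (L k) * (2 * Y) := by
      rw [inner_sum]
      refine (norm_sum_le _ _).trans (Finset.sum_le_sum fun k hk => ?_)
      refine (norm_sum_smul_inner_le (L k) (c k) (ct k) y).trans ?_
      refine mul_le_mul_of_nonneg_left ?_ (hsNorm_nonneg _)
      calc _ ≤ Real.sqrt Y * (2 * Real.sqrt Y) :=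
            mul_le_mul (hs1 k hk) (hs2 k hk) (Real.sqrt_nonneg _) (by positivity)
        _ = _ := by rw [mul_left_comm, hYY]
    rw [e1, inner_sub_right]
    refine (norm_sub_le _ _).trans ((add_le_add t1 t2).trans_eq ?_)
    rw [← Finset.sum_mul]; ring
  -- The expectation of `N` along the flow. As `B` is skew-adjoint, its derivative is the
  -- expectation of the commutator of `N` with `B`.
  let f : ℝ → ℝ := fun s => ∑ p ∈ G, ‖annihilate p (NormedSpace.exp ((s : ℂ) • B) x)‖ ^ 2
  let f' : ℝ → ℝ := fun s => (inner ℂ (NormedSpace.exp ((s : ℂ) • B) x)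
    ((N * B - B * N) (NormedSpace.exp ((s : ℂ) • B) x))).re
  have hf : ∀ s, HasDerivAt f (f' s) s := by
    intro s
    have h1 : HasDerivAt (fun s : ℝ => NormedSpace.exp ((s : ℂ) • B) x)
        (B (NormedSpace.exp ((s : ℂ) • B) x)) s := by
      have := (hasDerivAt_flow_apply B x (s : ℂ)).scomp s Complex.ofRealCLM.hasDerivAt
      exact this.congr_deriv (by simp)
    have h2 : HasDerivAt (fun s : ℝ => N (NormedSpace.exp ((s : ℂ) • B) x))
        (N (B (NormedSpace.exp ((s : ℂ) • B) x))) s :=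
      (N.restrictScalars ℝ).hasFDerivAt.comp_hasDerivAt s h1
    have h3 := Complex.reCLM.hasFDerivAt.comp_hasDerivAt s (h1.inner ℂ h2)
    have e : f = fun s : ℝ => (inner ℂ (NormedSpace.exp ((s : ℂ) • B) x)
        (N (NormedSpace.exp ((s : ℂ) • B) x))).re := by
      funext s; rw [re_inner_modeNumber]
    rw [e]
    refine h3.congr_deriv ?_
    change (inner ℂ (NormedSpace.exp ((s : ℂ) • B) x) (N (B (NormedSpace.exp ((s : ℂ) • B) x)))
      + inner ℂ (B (NormedSpace.exp ((s : ℂ) • B) x)) (N (NormedSpace.exp ((s : ℂ) • B) x))).re = f' s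
    have e2 : ∀ u v : Fock, inner ℂ (B u) v = -inner ℂ u (B v) := by
      intro u v
      have h4 := ContinuousLinearMap.adjoint_inner_right B u v
      rw [← ContinuousLinearMap.star_eq_adjoint, hB] at h4
      rw [← h4, ← inner_neg_right]; rfl
    rw [e2]
    simp only [f']
    rw [sub_apply, inner_sub_right, sub_eq_add_neg]; rfl
  have h := gronwall_of_abs_deriv_le (C := 4 * ∑ k ∈ Γ, hsNorm (L k)) hf
    (fun s => (Complex.abs_re_le_norm _).trans (hbound _)) s
  have h0 : f 0 = ∑ p ∈ G, ‖annihilate p x‖ ^ 2 := by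
    simp only [f, Complex.ofReal_zero, zero_smul, NormedSpace.exp_zero]; rfl
  rw [h0] at h
  exact h

end Evolution

end

/-! ### The commutator of a pair operator with the generator. -/

noncomputable section

section OneParticle

variable {κ : Type*} (Γ : Finset κ) {I : κ → Type*} [∀ k, Fintype (I k)]
  (c : ∀ k, I k → (Fock →L[ℂ] Fock)) (L : ∀ k, Matrix (I k) (I k) ℂ)
  {ℓ : κ} (E : ∀ k, I ℓ → I k → (Fock →L[ℂ] Fock))

/-- The error term in the commutator of a pair operator with the quadratic generator. -/
def commError (γ : I ℓ) : Fock →L[ℂ] Fock :=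
  ∑ k ∈ Γ, ∑ α, E k γ α * ∑ β, L k α β • c k β

/-- Pair annihilators commute among themselves, so only the commutators with `star (c k α)`
contribute. Their scalar parts produce row `γ` of `L ℓ`; the rest is collected in `commError`. -/
theorem commutator_quadGen [DecidableEq (I ℓ)] (hℓ : ℓ ∈ Γ) (e : ∀ k, I ℓ → I k → ℂ)
    (he : ∀ γ α, e ℓ γ α = if γ = α then 1 else 0) (he' : ∀ k ∈ Γ, k ≠ ℓ → ∀ γ α, e k γ α = 0)
    (hcomm : ∀ k ∈ Γ, ∀ γ α, c ℓ γ * star (c k α) - star (c k α) * c ℓ γ = e k γ α • 1 + E k γ α)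
    (hcc : ∀ k ∈ Γ, ∀ γ β, Commute (c k β) (c ℓ γ)) (γ : I ℓ) :
    c ℓ γ * quadGen Γ c L - quadGen Γ c L * c ℓ γ
      = ∑ β, L ℓ γ β • c ℓ β + commError Γ c L E γ := by
  classical
  have h1 : c ℓ γ * quadGen Γ c L - quadGen Γ c L * c ℓ γ
      = ∑ k ∈ Γ, ∑ α, (e k γ α • 1 + E k γ α) * ∑ β, L k α β • c k β := by
    rw [quadGen]
    simp only [Finset.mul_sum, Finset.sum_mul, ← Finset.sum_sub_distrib]
    refine Finset.sum_congr rfl fun k hk => Finset.sum_congr rfl fun α _ =>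
      Finset.sum_congr rfl fun β _ => ?_
    rw [← hcomm k hk γ α, mul_smul_comm, smul_mul_assoc, mul_smul_comm, ← smul_sub, sub_mul,
      mul_assoc (star (c k α)) (c k β), (hcc k hk γ β).eq]
    simp only [mul_assoc]
  rw [h1]
  simp only [add_mul, Finset.sum_add_distrib]
  rw [commError]
  congr 1
  rw [Finset.sum_eq_single_of_mem ℓ hℓ]
  · simp only [he, ite_smul, one_smul, zero_smul, ite_mul, one_mul, zero_mul, Finset.sum_ite_eq,
      Finset.mem_univ, if_true]
  · intro k hk hkℓ
    refine Finset.sum_eq_zero fun α _ => ?_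
    rw [he' k hk hkℓ, zero_smul, zero_mul]

/-- Since a_p N = (N+1) a_p for `p ∈ Ω`, the claim compares ‖(N-1)z‖ with ‖(N+1)z‖ for z = a_p x,
and N is nonnegative. -/
theorem norm_sub_two_smul_le (Ω G : Finset Momentum) (hG : G ⊆ Ω) (x : Fock) :
    ∑ p ∈ G, ‖annihilate p (modeNumber Ω x - (2 : ℂ) • x)‖ ^ 2
      ≤ ∑ p ∈ G, ‖annihilate p (modeNumber Ω x)‖ ^ 2 := by
  refine Finset.sum_le_sum fun p hp => ?_
  set z := annihilate p x with hz
  have h1 : annihilate p (modeNumber Ω x) = modeNumber Ω z + z := by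
    have h := DFunLike.congr_fun (modeNumber_mul_annihilate Ω p) x
    rw [if_pos (hG hp), one_smul] at h
    change modeNumber Ω z = annihilate p (modeNumber Ω x) - z at h
    rw [h]; abel
  have h2 : annihilate p (modeNumber Ω x - (2 : ℂ) • x) = modeNumber Ω z - z := by
    rw [map_sub, map_smul, h1, ← hz, two_smul]; abel
  rw [h1, h2, @norm_sub_sq ℂ, @norm_add_sq ℂ]
  have h3 : 0 ≤ RCLike.re (inner ℂ (modeNumber Ω z) z) := by
    rw [inner_modeNumber_left]
    change 0 ≤ (inner ℂ z (modeNumber Ω z)).re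
    rw [re_inner_modeNumber]
    exact Finset.sum_nonneg fun _ _ => sq_nonneg _
  linarith

/-- The bound on `E` places the number operator in front of the vectors y = ∑_β L_{αβ} c_β x. Moved
through c_β it becomes N-2 acting on x, and the modes in `G` control the remaining pair annihilator.
The labels `π` identify patches belonging to different momenta. The weights `t` are kept so that the
estimate can be applied by duality. -/
theorem sum_mul_norm_commError_le {ι : Type*} (π : ∀ k, I k → ι) (hπ : ∀ k, Function.Injective (π k))
    (Ω G : Finset Momentum) (hG : G ⊆ Ω) {ε : ℝ} (hε : 0 ≤ ε)
    (hNc : ∀ k ∈ Γ, ∀ α, modeNumber Ω * c k α = c k α * modeNumber Ω - (2 : ℂ) • c k α)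
    (hc : ∀ k ∈ Γ, ∀ x, ∑ α, ‖c k α x‖ ^ 2 ≤ ∑ p ∈ G, ‖annihilate p x‖ ^ 2)
    (hE0 : ∀ k ∈ Γ, ∀ γ α, π k α ≠ π ℓ γ → E k γ α = 0)
    (hE : ∀ k ∈ Γ, ∀ γ α x, ‖E k γ α x‖ ≤ ε * ‖modeNumber Ω x‖) (t : I ℓ → ℝ) (x : Fock) :
    ∑ γ, t γ * ‖commError Γ c L E γ x‖
      ≤ Real.sqrt (∑ γ, t γ ^ 2) * (ε * (∑ k ∈ Γ, hsNorm (L k))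
        * Real.sqrt (∑ p ∈ G, ‖annihilate p (modeNumber Ω x)‖ ^ 2)) := by
  classical
  set Y := ∑ p ∈ G, ‖annihilate p (modeNumber Ω x)‖ ^ 2 with hY
  let y : ∀ k, I k → Fock := fun k α => ∑ β, L k α β • c k β x
  have hy : ∀ k ∈ Γ, ∑ α, ‖modeNumber Ω (y k α)‖ ^ 2 ≤ hsNorm (L k) ^ 2 * Y := by
    intro k hk
    set x' := modeNumber Ω x - (2 : ℂ) • x with hx'
    have e1 : ∀ α, modeNumber Ω (y k α) = ∑ β, L k α β • c k β x' := by
      intro α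
      simp only [y, map_sum, map_smul]
      refine Finset.sum_congr rfl fun β _ => ?_
      have h := DFunLike.congr_fun (hNc k hk β) x
      change modeNumber Ω (c k β x) = c k β (modeNumber Ω x) - (2 : ℂ) • c k β x at h
      rw [h, hx', map_sub, map_smul]
    have e2 : ∑ β, ‖c k β x'‖ ^ 2 ≤ Y := (hc k hk x').trans (norm_sub_two_smul_le Ω G hG x)
    rw [hsNorm_sq, Finset.sum_mul]
    refine Finset.sum_le_sum fun α _ => ?_
    rw [e1]
    calc ‖∑ β, L k α β • c k β x'‖ ^ 2 ≤ (∑ β, ‖L k α β‖ * ‖c k β x'‖) ^ 2 := by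
          gcongr
          refine (norm_sum_le _ _).trans_eq ?_
          simp only [norm_smul]
      _ ≤ (∑ β, ‖L k α β‖ ^ 2) * ∑ β, ‖c k β x'‖ ^ 2 := Finset.sum_mul_sq_le_sq_mul_sq _ _ _
      _ ≤ _ := mul_le_mul_of_nonneg_left e2 (Finset.sum_nonneg fun _ _ => sq_nonneg _)
  -- For fixed `k` and `γ` at most one `α` carries the same patch, and conversely. Hence the sum
  -- over `α` costs no factor in the ℓ² norm over `γ`.
  have hv : ∀ k ∈ Γ, ∑ γ, ‖∑ α, E k γ α (y k α)‖ ^ 2 ≤ (ε * hsNorm (L k)) ^ 2 * Y := by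
    intro k hk
    have e1 : ∀ γ, ‖∑ α, E k γ α (y k α)‖ ^ 2
        ≤ ∑ α, if π k α = π ℓ γ then ε ^ 2 * ‖modeNumber Ω (y k α)‖ ^ 2 else 0 := by
      intro γ
      by_cases h : ∃ α₀, π k α₀ = π ℓ γ
      · obtain ⟨α₀, hα₀⟩ := h
        have hne : ∀ α, α ≠ α₀ → π k α ≠ π ℓ γ := fun α hα h => hα (hπ k (h.trans hα₀.symm))
        rw [Finset.sum_eq_single α₀ (fun α _ hα => by rw [hE0 k hk γ α (hne α hα)]; rfl)
          (fun h => absurd (Finset.mem_univ _) h),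
          Finset.sum_eq_single α₀ (fun α _ hα => if_neg (hne α hα))
          (fun h => absurd (Finset.mem_univ _) h), if_pos hα₀, ← mul_pow]
        gcongr
        exact hE k hk γ α₀ _
      · push Not at h
        rw [Finset.sum_eq_zero fun α _ => by rw [hE0 k hk γ α (h α)]; rfl, norm_zero]
        refine le_of_eq_of_le (by norm_num) (Finset.sum_nonneg fun α _ => ?_)
        split_ifs <;> positivity
    refine (Finset.sum_le_sum fun γ _ => e1 γ).trans ?_
    rw [Finset.sum_comm]
    have e2 : ∀ α, (∑ γ, if π k α = π ℓ γ then ε ^ 2 * ‖modeNumber Ω (y k α)‖ ^ 2 else 0)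
        ≤ ε ^ 2 * ‖modeNumber Ω (y k α)‖ ^ 2 := by
      intro α
      rw [← Finset.sum_filter, Finset.sum_const, nsmul_eq_mul]
      refine mul_le_of_le_one_left (by positivity) ?_
      have : (Finset.univ.filter fun γ => π k α = π ℓ γ).card ≤ 1 := by
        refine Finset.card_le_one.2 fun a ha b hb => hπ ℓ ?_
        rw [← (Finset.mem_filter.1 ha).2, (Finset.mem_filter.1 hb).2]
      exact_mod_cast this
    refine (Finset.sum_le_sum fun α _ => e2 α).trans ?_
    rw [← Finset.mul_sum, mul_pow, mul_assoc]
    exact mul_le_mul_of_nonneg_left (hy k hk) (sq_nonneg _)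
  have e0 : ∀ γ, ‖commError Γ c L E γ x‖ ≤ ∑ k ∈ Γ, ‖∑ α, E k γ α (y k α)‖ := by
    intro γ
    have e : commError Γ c L E γ x = ∑ k ∈ Γ, ∑ α, E k γ α (y k α) := by
      rw [commError, sum_apply]
      refine Finset.sum_congr rfl fun k _ => ?_
      rw [sum_apply]
      refine Finset.sum_congr rfl fun α _ => ?_
      change E k γ α ((∑ β, L k α β • c k β) x) = _
      rw [sum_apply]; rfl
    rw [e]
    exact norm_sum_le _ _
  have habs : ∑ γ, t γ * ‖commError Γ c L E γ x‖ ≤ ∑ γ, |t γ| * ∑ k ∈ Γ, ‖∑ α, E k γ α (y k α)‖ :=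
    Finset.sum_le_sum fun γ _ => mul_le_mul (le_abs_self _) (e0 γ) (norm_nonneg _) (abs_nonneg _)
  refine habs.trans ?_
  simp only [Finset.mul_sum]
  rw [Finset.sum_comm, Finset.sum_mul, Finset.mul_sum]
  refine Finset.sum_le_sum fun k hk => ?_
  refine (Real.sum_mul_le_sqrt_mul_sqrt _ _ _).trans ?_
  simp only [sq_abs]
  refine mul_le_mul_of_nonneg_left ?_ (Real.sqrt_nonneg _)
  refine (Real.sqrt_le_sqrt (hv k hk)).trans_eq ?_
  rw [Real.sqrt_mul (sq_nonneg _), Real.sqrt_sq (mul_nonneg hε (hsNorm_nonneg _))]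

end OneParticle

end

/-! ### Duhamel's formula and the approximate one-particle evolution. -/

noncomputable section

section Duhamel

theorem hasDerivAt_matrix_exp_entry {ι : Type*} [Fintype ι] [DecidableEq ι] (A : Matrix ι ι ℂ)
    (s z : ℂ) (α β : ι) :
    HasDerivAt (fun z : ℂ => NormedSpace.exp ((s - z) • A) α β)
      (-(NormedSpace.exp ((s - z) • A) * A) α β) z := by
  have h1 : HasDerivAt (fun z : ℂ => s - z) (-1) z := (hasDerivAt_id z).const_sub s
  have h2 := (hasDerivAt_exp_smul_const A (s - z)).scomp z h1
  have h3 := (LinearMap.toContinuousLinearMap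
    (Matrix.entryLinearMap ℂ ℂ α β)).hasFDerivAt.comp_hasDerivAt z h2
  refine h3.congr_deriv ?_
  simp

variable {H : Type*} [NormedAddCommGroup H] [InnerProductSpace ℂ H] [CompleteSpace H]

theorem hasDerivAt_conj_flow (B A : H →L[ℂ] H) (x : H) (z : ℂ) :
    HasDerivAt (fun z : ℂ => NormedSpace.exp (z • -B) (A (NormedSpace.exp (z • B) x)))
      (NormedSpace.exp (z • -B) ((A * B - B * A) (NormedSpace.exp (z • B) x))) z := by
  have h1 : HasDerivAt (fun z : ℂ => NormedSpace.exp (z • -B))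
      (NormedSpace.exp (z • -B) * -B) z := hasDerivAt_exp_smul_const (-B) z
  have h2 : HasDerivAt (fun z : ℂ => A (NormedSpace.exp (z • B) x))
      (A (B (NormedSpace.exp (z • B) x))) z :=
    A.hasFDerivAt.comp_hasDerivAt z (hasDerivAt_flow_apply B x z)
  refine (h1.clm_apply h2).congr_deriv ?_
  change NormedSpace.exp (z • -B) (-(B (A (NormedSpace.exp (z • B) x))))
    + NormedSpace.exp (z • -B) (A (B (NormedSpace.exp (z • B) x)))
    = NormedSpace.exp (z • -B) (A (B (NormedSpace.exp (z • B) x))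
      - B (A (NormedSpace.exp (z • B) x)))
  rw [map_neg, map_sub]; abel

/-- Duhamel's formula, as the derivative of the interpolation between the exact and the approximate
evolution. -/
theorem hasDerivAt_interpolation {ι : Type*} [Fintype ι] [DecidableEq ι] (B : H →L[ℂ] H)
    (A G : ι → (H →L[ℂ] H)) (L : Matrix ι ι ℂ)
    (h : ∀ γ, A γ * B - B * A γ = ∑ β, L γ β • A β + G γ) (x : H) (s z : ℂ) (γ : ι) :
    HasDerivAt (fun z : ℂ => ∑ β, NormedSpace.exp ((s - z) • L) γ β •
        NormedSpace.exp (z • -B) (A β (NormedSpace.exp (z • B) x)))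
      (∑ β, NormedSpace.exp ((s - z) • L) γ β •
        NormedSpace.exp (z • -B) (G β (NormedSpace.exp (z • B) x))) z := by
  have h1 : ∀ β ∈ (Finset.univ : Finset ι), HasDerivAt (fun z : ℂ =>
      NormedSpace.exp ((s - z) • L) γ β • NormedSpace.exp (z • -B) (A β (NormedSpace.exp (z • B) x)))
      _ z := fun β _ => (hasDerivAt_matrix_exp_entry L s z γ β).smul (hasDerivAt_conj_flow B (A β) x z)
  refine (HasDerivAt.fun_sum h1).congr_deriv ?_
  set U := NormedSpace.exp ((s - z) • L)
  set y := NormedSpace.exp (z • B) x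
  set V := NormedSpace.exp (z • -B)
  have e1 : ∀ β, V ((A β * B - B * A β) y) = ∑ α, L β α • V (A α y) + V (G β y) := by
    intro β
    rw [h β, add_apply, map_add, sum_apply, map_sum]
    congr 1
    refine Finset.sum_congr rfl fun α _ => ?_
    change V (L β α • A α y) = _
    rw [map_smul]
  simp only [e1, smul_add, Finset.sum_add_distrib]
  -- The linear part of the commutator is cancelled by the derivative of the matrix exponential.
  -- Only `G` remains.
  have e2 : ∑ β, U γ β • ∑ α, L β α • V (A α y) = ∑ α, (U * L) γ α • V (A α y) := by
    simp only [Finset.smul_sum, smul_smul]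
    rw [Finset.sum_comm]
    refine Finset.sum_congr rfl fun α _ => ?_
    rw [Matrix.mul_apply, Finset.sum_smul]
  rw [e2]
  simp only [neg_smul, Finset.sum_neg_distrib]
  abel

end Duhamel

section OneParticle

variable {κ : Type*} (Γ : Finset κ) {I : κ → Type*} [∀ k, Fintype (I k)]
  (c : ∀ k, I k → (Fock →L[ℂ] Fock)) (L : ∀ k, Matrix (I k) (I k) ℂ)
  {ℓ : κ} (E : ∀ k, I ℓ → I k → (Fock →L[ℂ] Fock))

/-- The evolution of almost bosonic pair operators is approximated by the one-particle evolution. -/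
theorem sum_norm_evolution_sub_le [DecidableEq (I ℓ)] {ι : Type*} (π : ∀ k, I k → ι)
    (hπ : ∀ k, Function.Injective (π k)) (Ω G : Finset Momentum) (hG : G ⊆ Ω) {ε : ℝ} (hε : 0 ≤ ε)
    (hL : ∀ k ∈ Γ, star (L k) = -L k) (hℓ : ℓ ∈ Γ) (e : ∀ k, I ℓ → I k → ℂ)
    (he : ∀ γ α, e ℓ γ α = if γ = α then 1 else 0) (he' : ∀ k ∈ Γ, k ≠ ℓ → ∀ γ α, e k γ α = 0)
    (hcomm : ∀ k ∈ Γ, ∀ γ α, c ℓ γ * star (c k α) - star (c k α) * c ℓ γ = e k γ α • 1 + E k γ α)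
    (hcc : ∀ k ∈ Γ, ∀ γ β, Commute (c k β) (c ℓ γ))
    (hNc : ∀ k ∈ Γ, ∀ α, modeNumber Ω * c k α = c k α * modeNumber Ω - (2 : ℂ) • c k α)
    (hE0 : ∀ k ∈ Γ, ∀ γ α, π k α ≠ π ℓ γ → E k γ α = 0)
    (hE : ∀ k ∈ Γ, ∀ γ α x, ‖E k γ α x‖ ≤ ε * ‖modeNumber Ω x‖)
    (ct : ∀ k, I k → (Fock →L[ℂ] Fock))
    (hct : ∀ k ∈ Γ, ∀ α, modeNumber G * c k α = c k α * modeNumber G - ct k α)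
    (hc : ∀ k ∈ Γ, ∀ x, ∑ α, ‖c k α x‖ ^ 2 ≤ ∑ p ∈ G, ‖annihilate p x‖ ^ 2)
    (hc' : ∀ k ∈ Γ, ∀ x, ∑ α, ‖ct k α x‖ ^ 2 ≤ 2 ^ 2 * ∑ p ∈ G, ‖annihilate p x‖ ^ 2)
    {s : ℝ} (hs : s ∈ Set.Icc (-1 : ℝ) 1) (ψ : Fock) :
    ∑ γ, ‖(star (NormedSpace.exp ((s : ℂ) • quadGen Γ c L)) * c ℓ γ
        * NormedSpace.exp ((s : ℂ) • quadGen Γ c L)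
        - ∑ β, NormedSpace.exp ((s : ℂ) • L ℓ) γ β • c ℓ β) ψ‖
      ≤ Real.sqrt (Fintype.card (I ℓ)) * (ε * (∑ k ∈ Γ, hsNorm (L k))
        * (Real.exp (2 * ∑ k ∈ Γ, hsNorm (L k))
        * Real.sqrt (∑ p ∈ G, ‖annihilate p (modeNumber Ω ψ)‖ ^ 2))) := by
  set B := quadGen Γ c L with hBdef
  set Λ := ∑ k ∈ Γ, hsNorm (L k) with hΛ
  have hΛ0 : 0 ≤ Λ := Finset.sum_nonneg fun _ _ => hsNorm_nonneg _
  have hB : star B = -B := star_quadGen Γ c L hL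
  have hnB : star (-B) = -(-B) := by rw [star_neg, hB]
  set Y := ∑ p ∈ G, ‖annihilate p (modeNumber Ω ψ)‖ ^ 2 with hY
  let F : I ℓ → Fock := fun γ => (star (NormedSpace.exp ((s : ℂ) • B)) * c ℓ γ
        * NormedSpace.exp ((s : ℂ) • B) - ∑ β, NormedSpace.exp ((s : ℂ) • L ℓ) γ β • c ℓ β) ψ
  -- At τ = s this is the exact evolution, at τ = 0 the one-particle evolution, so the error `F` is
  -- its increment.
  let w : I ℓ → ℝ → Fock := fun γ τ => ∑ β, NormedSpace.exp (((s : ℂ) - τ) • L ℓ) γ β •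
        NormedSpace.exp ((τ : ℂ) • -B) (c ℓ β (NormedSpace.exp ((τ : ℂ) • B) ψ))
  let w' : I ℓ → ℝ → Fock := fun γ τ => ∑ β, NormedSpace.exp (((s : ℂ) - τ) • L ℓ) γ β •
        NormedSpace.exp ((τ : ℂ) • -B) (commError Γ c L E β (NormedSpace.exp ((τ : ℂ) • B) ψ))
  have hw : ∀ γ τ, HasDerivAt (w γ) (w' γ τ) τ := by
    intro γ τ
    have h := (hasDerivAt_interpolation B (c ℓ) (commError Γ c L E) (L ℓ)
      (commutator_quadGen Γ c L E hℓ e he he' hcomm hcc) ψ s τ γ).scomp τ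
      Complex.ofRealCLM.hasDerivAt
    exact h.congr_deriv (by simp [w'])
  have hF : ∀ γ, F γ = w γ s - w γ 0 := by
    intro γ
    have e1 : w γ s = NormedSpace.exp ((s : ℂ) • -B) (c ℓ γ (NormedSpace.exp ((s : ℂ) • B) ψ)) := by
      simp only [w, sub_self, zero_smul, NormedSpace.exp_zero, Matrix.one_apply, ite_smul, one_smul,
        Finset.sum_ite_eq, Finset.mem_univ, if_true]
    have e2 : w γ 0 = ∑ β, NormedSpace.exp ((s : ℂ) • L ℓ) γ β • c ℓ β ψ := by
      simp only [w, Complex.ofReal_zero, sub_zero, zero_smul, NormedSpace.exp_zero]; rfl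
    have e3 : star (NormedSpace.exp ((s : ℂ) • B)) = NormedSpace.exp ((s : ℂ) • -B) := by
      rw [star_flow hB, smul_neg, neg_smul]
    simp only [F]
    rw [e1, e2, sub_apply, sum_apply, e3]; rfl
  -- The flow conserves the number operator of `Ω`, so only the number operator of `G` has to be
  -- propagated. The square root halves the exponent 4Λ.
  have hgron : ∀ τ : ℝ, |τ| ≤ 1 →
      Real.sqrt (∑ p ∈ G, ‖annihilate p (modeNumber Ω (NormedSpace.exp ((τ : ℂ) • B) ψ))‖ ^ 2)
        ≤ Real.exp (2 * Λ) * Real.sqrt Y := by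
    intro τ hτ
    have hcN : Commute (modeNumber Ω) B :=
      commute_quadGen Γ c L (μ := 2) (star_modeNumber Ω) (by simpa using hNc)
    rw [flow_comm hcN]
    have h := sum_norm_annihilate_flow_le Γ c L G hL ct hct hc hc' (modeNumber Ω ψ) τ
    refine (Real.sqrt_le_sqrt (h.trans (mul_le_mul_of_nonneg_right (Real.exp_le_exp.2
      (mul_le_of_le_one_right (by positivity) hτ)) (Finset.sum_nonneg fun _ _ => sq_nonneg _)))).trans_eq ?_
    rw [Real.sqrt_mul (Real.exp_pos _).le, show 4 * Λ = 2 * Λ + 2 * Λ by ring, Real.exp_add,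
      Real.sqrt_mul_self (Real.exp_pos _).le]
  set D := ε * Λ * (Real.exp (2 * Λ) * Real.sqrt Y) with hD
  have hD0 : 0 ≤ D := by positivity
  set S := Real.sqrt (∑ γ, ‖F γ‖ ^ 2) with hS
  have hS2 : S ^ 2 = ∑ γ, ‖F γ‖ ^ 2 := Real.sq_sqrt (Finset.sum_nonneg fun _ _ => sq_nonneg _)
  -- The matrix exponential is moved to the side of `F`, where it is unitary and preserves the ℓ²
  -- norm. The rotated norms of `F` then serve as weights in `sum_mul_norm_commError_le`.
  have hderiv : ∀ τ : ℝ, |τ| ≤ 1 → ‖(∑ γ, inner ℂ (F γ) (w' γ τ))‖ ≤ S * D := by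
    intro τ hτ
    set U := NormedSpace.exp (((s : ℂ) - τ) • L ℓ) with hU
    have hUu : U ∈ unitary (Matrix (I ℓ) (I ℓ) ℂ) := by
      refine exp_mem_unitary_of_star_eq_neg ?_
      rw [star_smul, hL ℓ hℓ]; simp
    set y := NormedSpace.exp ((τ : ℂ) • B) ψ with hy
    have e1 : ∑ γ, inner ℂ (F γ) (w' γ τ)
        = ∑ β, inner ℂ (∑ γ, star U β γ • F γ) (NormedSpace.exp ((τ : ℂ) • -B) (commError Γ c L E β y)) := by
      simp only [w', inner_sum, sum_inner]
      rw [Finset.sum_comm]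
      refine Finset.sum_congr rfl fun β _ => Finset.sum_congr rfl fun γ _ => ?_
      rw [inner_smul_right, inner_smul_left, Matrix.star_apply, RCLike.star_def, Complex.conj_conj]
    have e2 : ∑ β, ‖∑ γ, star U β γ • F γ‖ ^ 2 = ∑ γ, ‖F γ‖ ^ 2 := by
      refine unitary_sum_norm_sq ?_ F
      rw [star_star]; exact (Unitary.mem_iff.1 hUu).2
    rw [e1]
    refine (norm_sum_le _ _).trans ?_
    have e3 : ∀ β, ‖inner ℂ (∑ γ, star U β γ • F γ)
        (NormedSpace.exp ((τ : ℂ) • -B) (commError Γ c L E β y))‖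
        ≤ ‖∑ γ, star U β γ • F γ‖ * ‖commError Γ c L E β y‖ := by
      intro β
      refine (norm_inner_le_norm _ _).trans_eq ?_
      rw [norm_flow_apply hnB]
    refine (Finset.sum_le_sum fun β _ => e3 β).trans ?_
    refine (sum_mul_norm_commError_le Γ c L E π hπ Ω G hG hε hNc hc hE0 hE _ y).trans ?_
    rw [e2]
    refine mul_le_mul_of_nonneg_left ?_ (Real.sqrt_nonneg _)
    exact mul_le_mul_of_nonneg_left (hgron τ hτ) (by positivity)
  -- The function τ ↦ ∑ ⟨F_γ, w_γ(τ)⟩ has increment S² between 0 and s, so the mean value inequality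
  -- yields S² ≤ S D.
  have hint : S ^ 2 ≤ S * D := by
    let h : ℝ → ℂ := fun τ => ∑ γ, inner ℂ (F γ) (w γ τ)
    have hh : ∀ τ, HasDerivAt h (∑ γ, inner ℂ (F γ) (w' γ τ)) τ := by
      intro τ
      refine HasDerivAt.fun_sum fun γ _ => ?_
      have h1 := (hasDerivAt_const τ (F γ)).inner ℂ (hw γ τ)
      exact h1.congr_deriv (by simp)
    have h1 : h s - h 0 = (S ^ 2 : ℝ) := by
      simp only [h]
      rw [← Finset.sum_sub_distrib, hS2]
      push_cast
      refine Finset.sum_congr rfl fun γ _ => ?_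
      rw [← inner_sub_right, ← hF, inner_self_eq_norm_sq_to_K]; rfl
    have h2 : ‖h s - h 0‖ ≤ S * D * ‖s - 0‖ := by
      refine Convex.norm_image_sub_le_of_norm_hasDerivWithin_le (s := Set.Icc (-1 : ℝ) 1)
        (fun τ _ => (hh τ).hasDerivWithinAt) (fun τ hτ => hderiv τ (abs_le.2 hτ))
        (convex_Icc _ _) (by simp) hs
    rw [h1, Complex.norm_real, Real.norm_of_nonneg (sq_nonneg _)] at h2
    refine h2.trans (mul_le_of_le_one_right (mul_nonneg (Real.sqrt_nonneg _) hD0) ?_)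
    rw [sub_zero]; exact abs_le.2 hs
  have hSD : S ≤ D := by
    rcases (Real.sqrt_nonneg (∑ γ, ‖F γ‖ ^ 2)).eq_or_lt with h0 | h0
    · rw [hS, ← h0]; exact hD0
    · rw [pow_two] at hint
      exact le_of_mul_le_mul_left hint h0
  -- Cauchy-Schwarz from ℓ¹ to ℓ²: the only place where the number of patches is lost, as a square
  -- root.
  have hfin : ∑ γ, ‖F γ‖ ≤ Real.sqrt (Fintype.card (I ℓ)) * S := by
    have h1 := Real.sum_mul_le_sqrt_mul_sqrt Finset.univ (fun _ : I ℓ => (1 : ℝ)) (fun γ => ‖F γ‖)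
    simpa using h1
  exact hfin.trans (mul_le_mul_of_nonneg_left hSD (Real.sqrt_nonneg _))

end OneParticle

end

/-! ### Powers of positive matrices and the polar decomposition. -/

noncomputable section

open scoped Matrix

section SymPow

variable {ι : Type} [Fintype ι] [DecidableEq ι]

theorem continuousOn_spectrum_matrix (A : Matrix ι ι ℝ) (f : ℝ → ℝ) : ContinuousOn f (spectrum ℝ A) :=
  A.finite_real_spectrum.continuousOn f

theorem spectrum_pos_of_posDef {A : Matrix ι ι ℝ} (hA : A.PosDef) {x : ℝ} (hx : x ∈ spectrum ℝ A) :
    0 < x := by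
  rw [hA.1.spectrum_real_eq_range_eigenvalues] at hx
  obtain ⟨i, rfl⟩ := hx
  exact hA.eigenvalues_pos i

theorem symPow_mul {A : Matrix ι ι ℝ} (hA : A.PosDef) (s t : ℝ) :
    symPow A s * symPow A t = symPow A (s + t) := by
  rw [symPow, symPow, symPow, ← cfc_mul _ _ _ (continuousOn_spectrum_matrix _ _)
    (continuousOn_spectrum_matrix _ _)]
  exact cfc_congr fun x hx => (Real.rpow_add (spectrum_pos_of_posDef hA hx) s t).symm

theorem symPow_zero (A : Matrix ι ι ℝ) (hA : A.PosDef) : symPow A 0 = 1 := by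
  rw [symPow]
  simp only [Real.rpow_zero]
  exact cfc_const_one ℝ A (ha := hA.1)

theorem symPow_one (A : Matrix ι ι ℝ) (hA : A.PosDef) : symPow A 1 = A := by
  rw [symPow]
  simp only [Real.rpow_one]
  exact cfc_id' ℝ A (ha := hA.1)

theorem symPow_neg {A : Matrix ι ι ℝ} (hA : A.PosDef) (s : ℝ) : symPow A (-s) = (symPow A s)⁻¹ := by
  refine (Matrix.inv_eq_left_inv ?_).symm
  rw [symPow_mul hA, neg_add_cancel, symPow_zero A hA]

theorem symPow_half_mul_self {A : Matrix ι ι ℝ} (hA : A.PosDef) :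
    symPow A (1 / 2) * symPow A (1 / 2) = A := by
  rw [symPow_mul hA, add_halves, symPow_one A hA]

open scoped MatrixOrder in
theorem symPow_posDef {A : Matrix ι ι ℝ} (hA : A.PosDef) (s : ℝ) : (symPow A s).PosDef := by
  have h1 : (symPow A s).PosSemidef := by
    rw [← Matrix.nonneg_iff_posSemidef, symPow]
    exact cfc_nonneg fun x hx => Real.rpow_nonneg (spectrum_pos_of_posDef hA hx).le s
  rw [h1.posDef_iff_isUnit]
  refine ⟨⟨symPow A s, symPow A (-s), ?_, ?_⟩, rfl⟩
  · rw [symPow_mul hA, add_neg_cancel, symPow_zero A hA]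
  · rw [symPow_mul hA, neg_add_cancel, symPow_zero A hA]

theorem symPow_mul_self {B : Matrix ι ι ℝ} (hB : B.PosDef) (s : ℝ) :
    symPow (B * B) s = symPow B (2 * s) := by
  have hsa : IsSelfAdjoint B := hB.1
  have h1 : B * B = cfc (fun x : ℝ => x * x) B := by
    rw [cfc_mul _ _ _ (continuousOn_spectrum_matrix _ _) (continuousOn_spectrum_matrix _ _),
      cfc_id' ℝ B hsa]
  have h2 := cfc_comp' (fun x : ℝ => x ^ s) (fun x : ℝ => x * x) B
    ((B.finite_real_spectrum.image _).continuousOn _) (continuousOn_spectrum_matrix _ _) hsa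
  rw [symPow, h1, ← h2]
  refine cfc_congr fun x hx => ?_
  have hx := spectrum_pos_of_posDef hB hx
  rw [two_mul, Real.rpow_add hx, Real.mul_rpow hx.le hx.le]

theorem symPow_half_of_mul_self {B : Matrix ι ι ℝ} (hB : B.PosDef) :
    symPow (B * B) (1 / 2) = B := by
  rw [symPow_mul_self hB, show (2 : ℝ) * (1 / 2) = 1 by norm_num, symPow_one B hB]

theorem symPow_neg_half_of_mul_self {B : Matrix ι ι ℝ} (hB : B.PosDef) :
    symPow (B * B) (-(1 / 2)) = B⁻¹ := by
  rw [symPow_mul_self hB, show (2 : ℝ) * (-(1 / 2)) = -1 by norm_num, symPow_neg hB, symPow_one B hB]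

theorem transpose_of_posDef {ι : Type} {A : Matrix ι ι ℝ} (hA : A.PosDef) : Aᵀ = A := by
  have := hA.1.eq
  rwa [Matrix.conjTranspose_eq_transpose_of_trivial] at this

theorem posDef_transpose_mul_self {X : Matrix ι ι ℝ} (hX : IsUnit X) : (Xᵀ * X).PosDef := by
  have := Matrix.PosDef.conjTranspose_mul_self X (Matrix.mulVec_injective_of_isUnit hX)
  rwa [Matrix.conjTranspose_eq_transpose_of_trivial] at this

/-- Uniqueness of the polar decomposition. -/
theorem polarFactor_eq {X Q R : Matrix ι ι ℝ} (hX : X = Q * R) (hQ : Qᵀ * Q = 1) (hR : R.PosDef) :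
    polarFactor X = Q := by
  have h1 : Xᵀ * X = R * R := by
    rw [hX, Matrix.transpose_mul, transpose_of_posDef hR, Matrix.mul_assoc, ← Matrix.mul_assoc Qᵀ,
      hQ, Matrix.one_mul]
  rw [polarFactor, h1, symPow_neg_half_of_mul_self hR, hX, Matrix.mul_assoc,
    Matrix.mul_nonsing_inv _ ((Matrix.isUnit_iff_isUnit_det _).1 hR.isUnit), Matrix.mul_one]

/-- Existence of the polar decomposition. -/
theorem exists_polar {X : Matrix ι ι ℝ} (hX : IsUnit X) :
    ∃ R : Matrix ι ι ℝ, R.PosDef ∧ X = polarFactor X * R ∧ (polarFactor X)ᵀ * polarFactor X = 1 := by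
  have hXX := posDef_transpose_mul_self hX
  have h2 : symPow (Xᵀ * X) (-(1 / 2)) * symPow (Xᵀ * X) (1 / 2) = 1 := by
    rw [symPow_mul hXX, neg_add_cancel, symPow_zero _ hXX]
  refine ⟨symPow (Xᵀ * X) (1 / 2), symPow_posDef hXX _, ?_, ?_⟩
  · rw [polarFactor, Matrix.mul_assoc, h2, Matrix.mul_one]
  · rw [polarFactor, Matrix.transpose_mul, transpose_of_posDef (symPow_posDef hXX _),
      Matrix.mul_assoc, ← Matrix.mul_assoc Xᵀ]
    nth_rewrite 2 [← symPow_half_mul_self hXX]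
    rw [← Matrix.mul_assoc, ← Matrix.mul_assoc, h2, Matrix.one_mul, symPow_mul hXX, add_neg_cancel,
      symPow_zero _ hXX]

end SymPow

/-! ### Frobenius norm and polar decomposition -/

section Frobenius

variable {ι : Type} [Fintype ι]

/-- The square of the Hilbert-Schmidt norm of a real matrix. -/
def frobSq (X : Matrix ι ι ℝ) : ℝ := ∑ α, ∑ β, X α β ^ 2

theorem frobSq_eq_trace (X : Matrix ι ι ℝ) : frobSq X = (Xᵀ * X).trace := by
  rw [frobSq, Finset.sum_comm, Matrix.trace]
  refine Finset.sum_congr rfl fun β _ => ?_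
  rw [Matrix.diag_apply, Matrix.mul_apply]
  exact Finset.sum_congr rfl fun α _ => by rw [Matrix.transpose_apply, pow_two]

theorem frobSq_nonneg (X : Matrix ι ι ℝ) : 0 ≤ frobSq X :=
  Finset.sum_nonneg fun _ _ => Finset.sum_nonneg fun _ _ => sq_nonneg _

theorem frobSq_transpose (X : Matrix ι ι ℝ) : frobSq Xᵀ = frobSq X := by
  rw [frobSq, Finset.sum_comm]; rfl

theorem frobSq_add_le (X Y : Matrix ι ι ℝ) : frobSq (X + Y) ≤ 2 * frobSq X + 2 * frobSq Y := by
  simp only [frobSq, Finset.mul_sum, ← Finset.sum_add_distrib]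
  refine Finset.sum_le_sum fun α _ => Finset.sum_le_sum fun β _ => ?_
  rw [Matrix.add_apply]
  nlinarith [sq_nonneg (X α β - Y α β)]

variable [DecidableEq ι]

theorem frobSq_mul_left {Q : Matrix ι ι ℝ} (hQ : Qᵀ * Q = 1) (X : Matrix ι ι ℝ) :
    frobSq (Q * X) = frobSq X := by
  rw [frobSq_eq_trace, frobSq_eq_trace, Matrix.transpose_mul, Matrix.mul_assoc,
    ← Matrix.mul_assoc Qᵀ, hQ, Matrix.one_mul]

theorem frobSq_mul_right {Q : Matrix ι ι ℝ} (hQ : Q * Qᵀ = 1) (X : Matrix ι ι ℝ) :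
    frobSq (X * Q) = frobSq X := by
  rw [← frobSq_transpose, Matrix.transpose_mul, frobSq_mul_left (by rwa [Matrix.transpose_transpose]),
    frobSq_transpose]

/-- A positive matrix is closer to the identity than to any other orthogonal matrix. -/
theorem frobSq_sub_one_le {R Q : Matrix ι ι ℝ} (hR : R.PosDef) (hQ : Qᵀ * Q = 1) :
    frobSq (R - 1) ≤ frobSq (R - Q) := by
  set b := symPow R (1 / 2)
  have hb : b.PosDef := symPow_posDef hR _
  have hbb : b * b = R := symPow_half_mul_self hR
  have h0 : 0 ≤ frobSq (b - Q * b) := frobSq_nonneg _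
  -- With b = R^{1/2}, expanding 0 ≤ ‖b - Qb‖² gives tr(RQ) ≤ tr R.
  have h1 : (Rᵀ * Q).trace ≤ R.trace := by
    have e : frobSq (b - Q * b) = 2 * R.trace - 2 * (Rᵀ * Q).trace := by
      have e1 : (b * (Q * b)).trace = (Rᵀ * Q).trace := by
        rw [← Matrix.mul_assoc, Matrix.trace_mul_cycle, hbb, transpose_of_posDef hR]
      have e2 : (b * Qᵀ * b).trace = (Rᵀ * Q).trace := by
        rw [← Matrix.trace_transpose, Matrix.transpose_mul, Matrix.transpose_mul,
          Matrix.transpose_transpose, transpose_of_posDef hb, e1]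
      have e3 : (b * Qᵀ * (Q * b)).trace = R.trace := by
        rw [Matrix.mul_assoc, ← Matrix.mul_assoc Qᵀ, hQ, Matrix.one_mul, hbb]
      rw [frobSq_eq_trace, Matrix.transpose_sub, Matrix.transpose_mul, transpose_of_posDef hb,
        Matrix.sub_mul, Matrix.mul_sub, Matrix.mul_sub, hbb, Matrix.trace_sub, Matrix.trace_sub,
        Matrix.trace_sub, e1, e2, e3]
      ring
    linarith
  have expand : ∀ Q : Matrix ι ι ℝ, Qᵀ * Q = 1 → frobSq (R - Q)
      = (R * R).trace - 2 * (Rᵀ * Q).trace + (1 : Matrix ι ι ℝ).trace := by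
    intro Q hQ
    have e2 : (Qᵀ * R).trace = (Rᵀ * Q).trace := by
      rw [← Matrix.trace_transpose, Matrix.transpose_mul, Matrix.transpose_transpose]
    rw [frobSq_eq_trace, Matrix.transpose_sub, Matrix.sub_mul, Matrix.mul_sub, Matrix.mul_sub, hQ,
      Matrix.trace_sub, Matrix.trace_sub, Matrix.trace_sub, e2, transpose_of_posDef hR]
    ring
  rw [expand Q hQ, expand 1 (by simp), Matrix.mul_one, transpose_of_posDef hR]
  rw [transpose_of_posDef hR] at h1
  linarith

/-- The polar factor of the inverse of a matrix close to the identity is close to the identity. -/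
theorem frobSq_polarFactor_sub_one_le {S T : Matrix ι ι ℝ} (hTS : T * S = 1) :
    frobSq (polarFactor T - 1) ≤ 4 * frobSq (S - 1) := by
  have hST : S * T = 1 := mul_eq_one_comm.1 hTS
  obtain ⟨R, hR, hT, hO⟩ := exists_polar (X := T) ⟨⟨T, S, hTS, hST⟩, rfl⟩
  set O := polarFactor T
  have hO' : O * Oᵀ = 1 := mul_eq_one_comm.1 hO
  have hRu : IsUnit R.det := (Matrix.isUnit_iff_isUnit_det _).1 hR.isUnit
  -- From T = OR follows S = R⁻¹Oᵀ, so ‖R⁻¹ - O‖ = ‖S - 1‖. By positivity R⁻¹ is at least as close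
  -- to 1 as to O, and the triangle inequality for O - 1 through R⁻¹ gives the factor 4 for squares.
  have hS : S = R⁻¹ * Oᵀ := by
    refine (left_inv_eq_right_inv ?_ hTS).symm
    rw [hT, Matrix.mul_assoc, ← Matrix.mul_assoc Oᵀ, hO, Matrix.one_mul, Matrix.nonsing_inv_mul _ hRu]
  have h1 : frobSq (R⁻¹ - O) = frobSq (S - 1) := by
    have : S - 1 = (R⁻¹ - O) * Oᵀ := by rw [Matrix.sub_mul, hO', hS]
    rw [this, frobSq_mul_right (by rwa [Matrix.transpose_transpose])]
  have h2 := frobSq_sub_one_le hR.inv hO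
  have h3 := frobSq_add_le (-(R⁻¹ - O)) (R⁻¹ - 1)
  have h4 : frobSq (-(R⁻¹ - O)) = frobSq (R⁻¹ - O) := by simp only [frobSq, Matrix.neg_apply, neg_sq]
  rw [show -(R⁻¹ - O) + (R⁻¹ - 1) = O - 1 by abel, h4] at h3
  linarith

end Frobenius

end

/-! ### Roots of a diagonal matrix under a rank one perturbation. -/

noncomputable section

open scoped Matrix

section Perturbation

variable {ι : Type} [Fintype ι] [DecidableEq ι]

theorem exists_diagonalization {A : Matrix ι ι ℝ} (hA : A.PosDef) :
    ∃ (W : Matrix ι ι ℝ) (μ : ι → ℝ), (∀ i, 0 < μ i) ∧ Wᵀ * W = 1 ∧ W * A = Matrix.diagonal μ * W := by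
  let V : Matrix ι ι ℝ := hA.1.eigenvectorUnitary
  have hV : star V * V = 1 := Unitary.coe_star_mul_self hA.1.eigenvectorUnitary
  have hV' : V * star V = 1 := mul_eq_one_comm.1 hV
  have hst : star V = Vᵀ := by
    rw [Matrix.star_eq_conjTranspose, Matrix.conjTranspose_eq_transpose_of_trivial]
  have hs : A = V * Matrix.diagonal hA.1.eigenvalues * star V := by
    have := hA.1.spectral_theorem
    rw [Unitary.conjStarAlgAut_apply] at this
    exact this
  refine ⟨star V, hA.1.eigenvalues, hA.eigenvalues_pos, ?_, ?_⟩
  · rw [hst, Matrix.transpose_transpose, ← hst, hV']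
  · nth_rewrite 1 [hs]
    rw [← Matrix.mul_assoc, ← Matrix.mul_assoc, hV, Matrix.one_mul]

/-- Perturbation of the fourth root of a diagonal matrix by a rank one matrix. -/
theorem frobSq_sqrt_perturbation_le {d z : ι → ℝ} (hd : ∀ i, 0 < d i) {E : Matrix ι ι ℝ}
    (hE : E.PosDef) (hEE : E * E = Matrix.diagonal (fun i => d i ^ 2) + Matrix.vecMulVec z z) :
    frobSq (symPow E (1 / 2) * Matrix.diagonal (fun i => (Real.sqrt (d i))⁻¹) - 1)
      ≤ (∑ i, z i ^ 2 / d i ^ 2) ^ 2 := by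
  set e := symPow E (1 / 2)
  have he : e.PosDef := symPow_posDef hE _
  have hee : e * e = E := symPow_half_mul_self hE
  obtain ⟨W, μ, hμ, hWW, hWe⟩ := exists_diagonalization he
  have hWW' : W * Wᵀ = 1 := mul_eq_one_comm.1 hWW
  set f : Matrix ι ι ℝ := Matrix.diagonal (fun i => Real.sqrt (d i)) with hf
  set ω := ∑ i, z i ^ 2 / d i ^ 2 with hω
  have hr : ∀ i, 0 < Real.sqrt (d i) := fun i => Real.sqrt_pos.2 (hd i)
  have hff : f * f = Matrix.diagonal d := by
    rw [hf, Matrix.diagonal_mul_diagonal]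
    congr 1; funext i; exact Real.mul_self_sqrt (hd i).le
  have hdd : (Matrix.diagonal d : Matrix ι ι ℝ) * Matrix.diagonal d
      = Matrix.diagonal (fun i => d i ^ 2) := by
    rw [Matrix.diagonal_mul_diagonal]; congr 1; funext i; rw [pow_two]
  set ζ : ι → ℝ := W *ᵥ z with hζ
  have hWE : W * E = Matrix.diagonal (fun i => μ i ^ 2) * W := by
    rw [← hee, ← Matrix.mul_assoc, hWe, Matrix.mul_assoc, hWe, ← Matrix.mul_assoc,
      Matrix.diagonal_mul_diagonal]
    simp only [pow_two]
  have hWEE : W * (E * E) = Matrix.diagonal (fun i => μ i ^ 4) * W := by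
    rw [← Matrix.mul_assoc, hWE, Matrix.mul_assoc, hWE, ← Matrix.mul_assoc,
      Matrix.diagonal_mul_diagonal]
    congr 2; funext i; ring
  -- With the eigenbasis of `e` on the left and the standard basis on the right, E² - d² = E(E-d) +
  -- (E-d)d and E - d = e(e-f) + (e-f)f become scalar equations for each entry.
  set X := W * (E - Matrix.diagonal d) with hX
  set Y := W * (e - f) with hY
  have hXe : ∀ i β, X i β * (μ i ^ 2 + d β) = ζ i * z β := by
    intro i β
    have h1 : W * (E * E - Matrix.diagonal d * Matrix.diagonal d)
        = Matrix.diagonal (fun i => μ i ^ 2) * X + X * Matrix.diagonal d := by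
      rw [hX, ← Matrix.mul_assoc, ← hWE]; noncomm_ring
    have h2 : E * E - Matrix.diagonal d * Matrix.diagonal d = Matrix.vecMulVec z z := by
      rw [hEE, hdd]; abel
    rw [h2, Matrix.mul_vecMulVec] at h1
    have h3 := congrFun (congrFun h1 i) β
    rw [Matrix.add_apply, Matrix.diagonal_mul, Matrix.mul_diagonal, Matrix.vecMulVec_apply] at h3
    rw [hζ, h3]; ring
  have hYe : ∀ i β, Y i β * (μ i + Real.sqrt (d β)) = X i β := by
    intro i β
    have h1 : X = Matrix.diagonal μ * Y + Y * f := by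
      rw [hX, hY, ← Matrix.mul_assoc, ← hWe, ← hee, ← hff]; noncomm_ring
    have h3 := congrFun (congrFun h1 i) β
    rw [Matrix.add_apply, Matrix.diagonal_mul, hf, Matrix.mul_diagonal] at h3
    rw [h3]; ring
  have hS : W * (e * Matrix.diagonal (fun i => (Real.sqrt (d i))⁻¹) - 1)
      = Y * Matrix.diagonal (fun i => (Real.sqrt (d i))⁻¹) := by
    have h1 : f * Matrix.diagonal (fun i => (Real.sqrt (d i))⁻¹) = 1 := by
      rw [hf, Matrix.diagonal_mul_diagonal, ← Matrix.diagonal_one]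
      congr 1; funext i; exact mul_inv_cancel₀ (hr i).ne'
    rw [hY, Matrix.mul_assoc, Matrix.sub_mul, h1]
  have hent : ∀ i β, (Y * Matrix.diagonal (fun i => (Real.sqrt (d i))⁻¹)) i β ^ 2
      ≤ (ζ i ^ 2 / μ i ^ 4) * (z β ^ 2 / d β ^ 2) := by
    intro i β
    rw [Matrix.mul_diagonal]
    set r := Real.sqrt (d β)
    have hr0 : 0 < r := hr β
    have hdr : d β = r ^ 2 := (Real.sq_sqrt (hd β).le).symm
    have hm := hμ i
    have e1 : Y i β * r⁻¹ = ζ i * z β / ((μ i ^ 2 + r ^ 2) * ((μ i + r) * r)) := by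
      have h1 := hXe i β
      rw [← hYe i β] at h1
      have h2 : Y i β * (μ i + r) * (μ i ^ 2 + r ^ 2) = ζ i * z β := by
        linear_combination h1 - Y i β * (μ i + r) * hdr
      rw [eq_div_iff (by positivity), ← h2]
      field_simp
    rw [e1, hdr, div_pow, div_mul_div_comm, mul_pow]
    refine div_le_div_of_nonneg_left (by positivity) (by positivity) ?_
    -- Dropping one summand from each factor decouples the eigenvalue index from the coordinate
    -- index, so the double sum becomes a product of two single sums.
    have h1 : μ i ^ 2 * r ^ 2 ≤ (μ i ^ 2 + r ^ 2) * ((μ i + r) * r) := by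
      apply mul_le_mul
      · nlinarith [sq_nonneg r]
      · nlinarith [mul_pos hm hr0]
      · positivity
      · positivity
    calc μ i ^ 4 * (r ^ 2) ^ 2 = (μ i ^ 2 * r ^ 2) ^ 2 := by ring
      _ ≤ _ := by gcongr
  set a := ∑ i, ζ i ^ 2 / μ i ^ 4 with ha
  have ha0 : 0 ≤ a := Finset.sum_nonneg fun i _ => by have := hμ i; positivity
  have hω0 : 0 ≤ ω := Finset.sum_nonneg fun i _ => by positivity
  -- Here a = ⟨z, (E²)⁻¹z⟩. With u = (E²)⁻¹z, the equation d²u + a z = z gives a = (1-a)ω, the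
  -- Sherman-Morrison identity, whence a ≤ ω.
  have haω : a ≤ ω := by
    set v : ι → ℝ := fun i => ζ i / μ i ^ 4 with hv
    set u := Wᵀ *ᵥ v with hu
    have h1 : (E * E) *ᵥ u = z := by
      have h2 : W *ᵥ ((E * E) *ᵥ u) = W *ᵥ z := by
        rw [Matrix.mulVec_mulVec, hWEE, hu, Matrix.mulVec_mulVec, Matrix.mul_assoc, hWW',
          Matrix.mul_one]
        funext i
        rw [Matrix.mulVec_diagonal, hv]
        have := hμ i
        change μ i ^ 4 * (ζ i / μ i ^ 4) = ζ i
        field_simp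
      have h3 := congrArg (fun x => Wᵀ *ᵥ x) h2
      simpa only [Matrix.mulVec_mulVec, ← Matrix.mul_assoc, hWW, Matrix.one_mulVec, Matrix.one_mul]
        using h3
    have h2 : z ⬝ᵥ u = a := by
      rw [hu, Matrix.dotProduct_mulVec, Matrix.vecMul_transpose, ← hζ, ha, dotProduct]
      refine Finset.sum_congr rfl fun i _ => ?_
      rw [hv]; ring
    have h3 : ∀ β, u β * z β = (1 - a) * (z β ^ 2 / d β ^ 2) := by
      intro β
      have h4 := congrFun h1 β
      rw [hEE, Matrix.add_mulVec, Pi.add_apply, Matrix.mulVec_diagonal, Matrix.vecMulVec_mulVec,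
        h2] at h4
      have h5 : z β * (1 - a) = d β ^ 2 * u β := by
        have : (MulOpposite.op a • z) β = z β * a := rfl
        rw [this] at h4; linarith
      have := hd β
      field_simp
      linear_combination (-(z β)) * h5
    have h4 : a = (1 - a) * ω := by
      nth_rewrite 1 [← h2]
      rw [hω, Finset.mul_sum, dotProduct]
      exact Finset.sum_congr rfl fun β _ => by rw [← h3, mul_comm]
    nlinarith [mul_nonneg ha0 hω0]
  rw [← frobSq_mul_left hWW, hS, frobSq]
  refine (Finset.sum_le_sum fun i _ => Finset.sum_le_sum fun β _ => hent i β).trans ?_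
  rw [← Finset.sum_mul_sum, ← ha, ← hω, pow_two]
  exact mul_le_mul_of_nonneg_right haω hω0

end Perturbation

/-! ### Even and odd blocks under the reflection of the patches. -/

section Blocks

variable {n : Type} [Fintype n] [DecidableEq n] {I : Type}

/-- The orthogonal matrix with blocks `2^(-1/2) [[1, 1], [1, -1]]`. -/
abbrev blockU (n : Type) [DecidableEq n] : Matrix (n ⊕ n) (n ⊕ n) ℝ :=
  (Real.sqrt 2)⁻¹ • Matrix.fromBlocks 1 1 1 (-1)

/-- The matrix with diagonal blocks `A`, `B` in the basis of even and odd vectors. -/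
def blockConj (t : I → n ⊕ n) (A B : Matrix n n ℝ) : Matrix I I ℝ :=
  (blockU n * Matrix.fromBlocks A 0 0 B * (blockU n)ᵀ).submatrix t t

theorem inv_sqrt_two_mul_self : (Real.sqrt 2)⁻¹ * (Real.sqrt 2)⁻¹ = 1 / 2 := by
  rw [← mul_inv, Real.mul_self_sqrt (by norm_num)]; norm_num

theorem blockConj_eq (t : I → n ⊕ n) (A B : Matrix n n ℝ) :
    blockConj t A B = ((1 / 2 : ℝ) • Matrix.fromBlocks (A + B) (A - B) (A - B) (A + B)).submatrix t t := by
  rw [blockConj]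
  congr 1
  rw [Matrix.transpose_smul, Matrix.smul_mul, Matrix.smul_mul, Matrix.mul_smul, smul_smul,
    inv_sqrt_two_mul_self, Matrix.fromBlocks_transpose, Matrix.fromBlocks_multiply,
    Matrix.fromBlocks_multiply]
  simp [sub_eq_add_neg]

theorem blockConj_self (t : I → n ⊕ n) (A : Matrix n n ℝ) :
    blockConj t A A = (Matrix.fromBlocks A 0 0 A).submatrix t t := by
  rw [blockConj_eq, sub_self, Matrix.fromBlocks_smul, ← two_smul ℝ A, smul_smul, smul_zero]
  norm_num

theorem blockU_transpose_mul_self : (blockU n)ᵀ * blockU n = 1 := by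
  rw [Matrix.transpose_smul, Matrix.smul_mul, Matrix.mul_smul, smul_smul, inv_sqrt_two_mul_self,
    Matrix.fromBlocks_transpose, Matrix.fromBlocks_multiply, ← Matrix.fromBlocks_one,
    Matrix.fromBlocks_smul]
  congr 1 <;> simp <;> (rw [← add_smul]; norm_num)

variable {t : I → n ⊕ n}

theorem blockConj_transpose (A B : Matrix n n ℝ) : (blockConj t A B)ᵀ = blockConj t Aᵀ Bᵀ := by
  simp only [blockConj_eq, Matrix.transpose_submatrix, Matrix.transpose_smul,
    Matrix.fromBlocks_transpose, Matrix.transpose_add, Matrix.transpose_sub]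

theorem blockConj_one [DecidableEq I] (ht : Function.Bijective t) : blockConj t (1 : Matrix n n ℝ) 1 = 1 := by
  rw [blockConj_self, Matrix.fromBlocks_one, Matrix.submatrix_one _ ht.1]

variable [Fintype I]

/-- Together with the rules for the unit and the transpose this makes `blockConj` a homomorphism of
pairs of blocks, so roots and polar factors can be computed blockwise. -/
theorem blockConj_mul (ht : Function.Bijective t) (A B A' B' : Matrix n n ℝ) :
    blockConj t A B * blockConj t A' B' = blockConj t (A * A') (B * B') := by
  have h := Matrix.submatrix_mul_equiv (blockU n * Matrix.fromBlocks A 0 0 B * (blockU n)ᵀ)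
    (blockU n * Matrix.fromBlocks A' 0 0 B' * (blockU n)ᵀ) t (Equiv.ofBijective t ht) t
  refine Eq.trans h ?_
  rw [blockConj]
  congr 1
  calc blockU n * Matrix.fromBlocks A 0 0 B * (blockU n)ᵀ
        * (blockU n * Matrix.fromBlocks A' 0 0 B' * (blockU n)ᵀ)
      = blockU n * Matrix.fromBlocks A 0 0 B * ((blockU n)ᵀ * blockU n)
        * Matrix.fromBlocks A' 0 0 B' * (blockU n)ᵀ := by noncomm_ring
    _ = blockU n * (Matrix.fromBlocks A 0 0 B * Matrix.fromBlocks A' 0 0 B') * (blockU n)ᵀ := by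
        rw [blockU_transpose_mul_self]; noncomm_ring
    _ = _ := by rw [Matrix.fromBlocks_multiply]; simp

variable [DecidableEq I]

theorem blockConj_posDef (ht : Function.Bijective t) {A B : Matrix n n ℝ} (hA : A.PosDef)
    (hB : B.PosDef) : (blockConj t A B).PosDef := by
  set a := symPow A (1 / 2)
  set b := symPow B (1 / 2)
  have ha : a.PosDef := symPow_posDef hA _
  have hb : b.PosDef := symPow_posDef hB _
  have h1 : blockConj t A B = (blockConj t a b)ᵀ * blockConj t a b := by
    rw [blockConj_transpose, blockConj_mul ht, transpose_of_posDef ha, transpose_of_posDef hb,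
      symPow_half_mul_self hA, symPow_half_mul_self hB]
  have h2 : blockConj t a b * blockConj t a⁻¹ b⁻¹ = 1 := by
    rw [blockConj_mul ht, Matrix.mul_nonsing_inv _ ((Matrix.isUnit_iff_isUnit_det _).1 ha.isUnit),
      Matrix.mul_nonsing_inv _ ((Matrix.isUnit_iff_isUnit_det _).1 hb.isUnit), blockConj_one ht]
  rw [h1]
  exact posDef_transpose_mul_self (IsUnit.of_mul_eq_one _ h2)

theorem symPow_blockConj_half (ht : Function.Bijective t) {A B : Matrix n n ℝ} (hA : A.PosDef)
    (hB : B.PosDef) :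
    symPow (blockConj t A B) (1 / 2) = blockConj t (symPow A (1 / 2)) (symPow B (1 / 2)) := by
  have h := symPow_half_of_mul_self
    (blockConj_posDef ht (symPow_posDef hA (1 / 2)) (symPow_posDef hB (1 / 2)))
  rwa [blockConj_mul ht, symPow_half_mul_self hA, symPow_half_mul_self hB] at h

theorem symPow_blockConj_neg_half (ht : Function.Bijective t) {A B : Matrix n n ℝ} (hA : A.PosDef)
    (hB : B.PosDef) :
    symPow (blockConj t A B) (-(1 / 2)) = blockConj t (symPow A (-(1 / 2))) (symPow B (-(1 / 2))) := by
  rw [symPow_neg (blockConj_posDef ht hA hB), symPow_blockConj_half ht hA hB]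
  refine Matrix.inv_eq_left_inv ?_
  rw [blockConj_mul ht, symPow_mul hA, symPow_mul hB, neg_add_cancel, symPow_zero _ hA,
    symPow_zero _ hB, blockConj_one ht]

theorem polarFactor_blockConj (ht : Function.Bijective t) {X Y : Matrix n n ℝ} (hX : IsUnit X)
    (hY : IsUnit Y) : polarFactor (blockConj t X Y) = blockConj t (polarFactor X) (polarFactor Y) := by
  obtain ⟨R, hR, h1, h2⟩ := exists_polar hX
  obtain ⟨R', hR', h1', h2'⟩ := exists_polar hY
  refine polarFactor_eq (R := blockConj t R R') ?_ ?_ (blockConj_posDef ht hR hR')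
  · rw [blockConj_mul ht, ← h1, ← h1']
  · rw [blockConj_transpose, blockConj_mul ht, h2, h2', blockConj_one ht]

/-- Cancellation of the orthogonal factors in the odd block against the even block. -/
theorem polarFactor_mul_polarFactor {d d₂ : Matrix n n ℝ} (hd : d.PosDef) (hd₂ : d₂.PosDef) :
    polarFactor (symPow d₂ (1 / 2)
        * symPow (symPow (symPow d₂ (1 / 2) * d * symPow d₂ (1 / 2)) (1 / 2)) (-(1 / 2)))
      * polarFactor (symPow d₂ (1 / 2) * symPow d (1 / 2))
      = polarFactor (symPow d (1 / 2)
        * symPow (symPow (symPow d (1 / 2) * d₂ * symPow d (1 / 2)) (1 / 2)) (-(1 / 2))) := by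
  set f := symPow d (1 / 2)
  set h := symPow d₂ (1 / 2)
  have hf : f.PosDef := symPow_posDef hd _
  have hh : h.PosDef := symPow_posDef hd₂ _
  have hff : f * f = d := symPow_half_mul_self hd
  have hhh : h * h = d₂ := symPow_half_mul_self hd₂
  have hfT := transpose_of_posDef hf
  have hhT := transpose_of_posDef hh
  have inv1 : ∀ {X : Matrix n n ℝ}, X.PosDef → X * X⁻¹ = 1 := fun hX =>
    Matrix.mul_nonsing_inv _ ((Matrix.isUnit_iff_isUnit_det _).1 hX.isUnit)
  have inv2 : ∀ {X : Matrix n n ℝ}, X.PosDef → X⁻¹ * X = 1 := fun hX =>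
    Matrix.nonsing_inv_mul _ ((Matrix.isUnit_iff_isUnit_det _).1 hX.isUnit)
  have hXX : (h * f)ᵀ * (h * f) = f * d₂ * f := by
    rw [Matrix.transpose_mul, hfT, hhT, ← hhh]; noncomm_ring
  have hXu : IsUnit (h * f) := hh.isUnit.mul hf.isUnit
  obtain ⟨Es, hEs, hX, hA⟩ := exists_polar hXu
  set A := polarFactor (h * f)
  have hA' : A * Aᵀ = 1 := mul_eq_one_comm.1 hA
  have hEs2 : f * d₂ * f = Es * Es := by
    rw [← hXX, hX, Matrix.transpose_mul, transpose_of_posDef hEs, Matrix.mul_assoc,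
      ← Matrix.mul_assoc Aᵀ, hA, Matrix.one_mul]
  have conjPos : ∀ {X : Matrix n n ℝ}, X.PosDef → (A * X * Aᵀ).PosDef := by
    intro X hX
    have := hX.mul_mul_conjTranspose_same (B := A) (Matrix.vecMul_injective_of_isUnit
      (IsUnit.of_mul_eq_one _ hA'))
    rwa [Matrix.conjTranspose_eq_transpose_of_trivial] at this
  have conjMul : ∀ X Y : Matrix n n ℝ, A * X * Aᵀ * (A * Y * Aᵀ) = A * (X * Y) * Aᵀ := by
    intro X Y
    calc A * X * Aᵀ * (A * Y * Aᵀ) = A * X * (Aᵀ * A) * Y * Aᵀ := by noncomm_ring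
      _ = _ := by rw [hA]; noncomm_ring
  -- As hf = A Es, the odd block hdh = (hf)(hf)ᵀ is the square of A Es Aᵀ: the odd block of `E` is
  -- the even one rotated by `A`.
  have hEa2 : h * d * h = A * Es * Aᵀ * (A * Es * Aᵀ) := by
    have h1 : h * d * h = (h * f) * (h * f)ᵀ := by
      rw [Matrix.transpose_mul, hfT, hhT, ← hff]; noncomm_ring
    rw [conjMul, h1, hX, Matrix.transpose_mul, transpose_of_posDef hEs]; noncomm_ring
  rw [hEs2, hEa2, symPow_half_of_mul_self hEs, symPow_half_of_mul_self (conjPos hEs)]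
  set r := symPow Es (1 / 2)
  have hr : r.PosDef := symPow_posDef hEs _
  have hrr : r * r = Es := symPow_half_mul_self hEs
  have e1 : symPow Es (-(1 / 2)) = r⁻¹ := symPow_neg hEs _
  have e2 : symPow (A * Es * Aᵀ) (-(1 / 2)) = A * r⁻¹ * Aᵀ := by
    rw [← hrr, ← conjMul, symPow_neg_half_of_mul_self (conjPos hr)]
    refine Matrix.inv_eq_left_inv ?_
    rw [conjMul, inv2 hr, Matrix.mul_one, hA']
  rw [e1, e2]
  have hTu : IsUnit (f * r⁻¹) := hf.isUnit.mul hr.inv.isUnit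
  obtain ⟨R, hR, hT, hO⟩ := exists_polar hTu
  set O := polarFactor (f * r⁻¹)
  have hO' : O * Oᵀ = 1 := mul_eq_one_comm.1 hO
  -- f⁻¹r is the inverse transpose of f r⁻¹, and passing to the inverse transpose preserves the
  -- orthogonal factor.
  have hTinv : f⁻¹ * r = O * R⁻¹ := by
    have h1 : (f⁻¹ * r)ᵀ * (f * r⁻¹) = 1 := by
      rw [Matrix.transpose_mul, transpose_of_posDef hf.inv, transpose_of_posDef hr]
      calc r * f⁻¹ * (f * r⁻¹) = r * (f⁻¹ * f) * r⁻¹ := by noncomm_ring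
        _ = 1 := by rw [inv2 hf, Matrix.mul_one, inv1 hr]
    have h2 : (O * R⁻¹)ᵀ * (f * r⁻¹) = 1 := by
      rw [hT, Matrix.transpose_mul, transpose_of_posDef hR.inv]
      calc R⁻¹ * Oᵀ * (O * R) = R⁻¹ * (Oᵀ * O) * R := by noncomm_ring
        _ = 1 := by rw [hO, Matrix.mul_one, inv2 hR]
    have h3 := hTu.mul_left_injective (h1.trans h2.symm)
    exact Matrix.transpose_injective h3
  have hhA : h * A = f⁻¹ * Es := by
    have h1 : h * A * Es = f⁻¹ * Es * Es := by
      calc h * A * Es = h * (h * f) := by rw [hX]; noncomm_ring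
        _ = f⁻¹ * f * (h * h) * f := by rw [inv2 hf]; noncomm_ring
        _ = f⁻¹ * (f * d₂ * f) := by rw [hhh]; noncomm_ring
        _ = _ := by rw [hEs2]; noncomm_ring
    exact hEs.isUnit.mul_left_injective h1
  -- The odd block equals f⁻¹ r Aᵀ, so its orthogonal factor is O Aᵀ. The final `A` in the product
  -- removes Aᵀ.
  have key : polarFactor (h * (A * r⁻¹ * Aᵀ)) = O * Aᵀ := by
    refine polarFactor_eq (R := A * R⁻¹ * Aᵀ) ?_ ?_ (conjPos hR.inv)
    · calc h * (A * r⁻¹ * Aᵀ) = h * A * r⁻¹ * Aᵀ := by noncomm_ring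
        _ = f⁻¹ * r * (r * r⁻¹) * Aᵀ := by rw [hhA, ← hrr]; noncomm_ring
        _ = O * R⁻¹ * Aᵀ := by rw [inv1 hr, Matrix.mul_one, hTinv]
        _ = O * (Aᵀ * A) * R⁻¹ * Aᵀ := by rw [hA, Matrix.mul_one]
        _ = _ := by noncomm_ring
    · calc (O * Aᵀ)ᵀ * (O * Aᵀ) = A * (Oᵀ * O) * Aᵀ := by
            rw [Matrix.transpose_mul, Matrix.transpose_transpose]; noncomm_ring
        _ = 1 := by rw [hO, Matrix.mul_one, hA']
  rw [key, Matrix.mul_assoc, hA, Matrix.mul_one]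

/-- The product of the two orthogonal factors acts equally in the even and the odd block. -/
theorem polarFactor_mul_blockConj (ht : Function.Bijective t) {d d₂ : Matrix n n ℝ} (hd : d.PosDef)
    (hd₂ : d₂.PosDef) :
    polarFactor (symPow (blockConj t d d₂) (1 / 2)
        * symPow (symPow (symPow (blockConj t d d₂) (1 / 2) * blockConj t d₂ d
          * symPow (blockConj t d d₂) (1 / 2)) (1 / 2)) (-(1 / 2)))
      * blockConj t 1 (polarFactor (symPow d₂ (1 / 2) * symPow d (1 / 2)))
      = blockConj t (polarFactor (symPow d (1 / 2)
          * symPow (symPow (symPow d (1 / 2) * d₂ * symPow d (1 / 2)) (1 / 2)) (-(1 / 2))))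
        (polarFactor (symPow d (1 / 2)
          * symPow (symPow (symPow d (1 / 2) * d₂ * symPow d (1 / 2)) (1 / 2)) (-(1 / 2)))) := by
  have conjPos : ∀ {X Y : Matrix n n ℝ}, X.PosDef → Y.PosDef → (X * Y * X).PosDef := by
    intro X Y hX hY
    have := hY.conjTranspose_mul_mul_same (B := X) (Matrix.mulVec_injective_of_isUnit hX.isUnit)
    rwa [Matrix.conjTranspose_eq_transpose_of_trivial, transpose_of_posDef hX] at this
  have hf := symPow_posDef hd (1 / 2)
  have hh := symPow_posDef hd₂ (1 / 2)
  have h1 := conjPos hf hd₂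
  have h2 := conjPos hh hd
  rw [symPow_blockConj_half ht hd hd₂, blockConj_mul ht, blockConj_mul ht,
    symPow_blockConj_half ht h1 h2,
    symPow_blockConj_neg_half ht (symPow_posDef h1 _) (symPow_posDef h2 _), blockConj_mul ht,
    polarFactor_blockConj ht (hf.isUnit.mul (symPow_posDef (symPow_posDef h1 _) _).isUnit)
      (hh.isUnit.mul (symPow_posDef (symPow_posDef h2 _) _).isUnit), blockConj_mul ht, Matrix.mul_one,
    polarFactor_mul_polarFactor hd hd₂]

end Blocks

end

/-! ### Distance of the orthogonal factor from the identity for a rank one interaction. -/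

noncomputable section

open scoped Matrix

section RankOne

variable {n : Type} [Fintype n] [DecidableEq n]

/-- With f = d^{1/2} one has E² = f d₂ f = d² + z zᵀ for z = (2g)^{1/2} f v. The inverse of f
E^{-1/2} is E^{1/2} d^{-1/2}, which `frobSq_sqrt_perturbation_le` compares with the identity;
`frobSq_polarFactor_sub_one_le` transfers this to the polar factor. -/
theorem frobSq_polarFactor_rankOne_le {d v : n → ℝ} (hd : ∀ i, 0 < d i) {g : ℝ} (hg : 0 ≤ g)
    {d₂ : Matrix n n ℝ} (hd₂ : d₂ = Matrix.diagonal d + (2 * g) • Matrix.vecMulVec v v) :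
    d₂.PosDef ∧ frobSq (polarFactor (symPow (Matrix.diagonal d) (1 / 2)
        * symPow (symPow (symPow (Matrix.diagonal d) (1 / 2) * d₂ * symPow (Matrix.diagonal d) (1 / 2))
          (1 / 2)) (-(1 / 2))) - 1) ≤ 4 * (∑ i, 2 * g * v i ^ 2 / d i) ^ 2 := by
  have hr : ∀ i, 0 < Real.sqrt (d i) := fun i => Real.sqrt_pos.2 (hd i)
  have hD : (Matrix.diagonal d).PosDef := Matrix.PosDef.diagonal hd
  have hf : (Matrix.diagonal fun i => Real.sqrt (d i)).PosDef := Matrix.PosDef.diagonal hr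
  have hd₂p : d₂.PosDef := by
    rw [hd₂]
    refine hD.add_posSemidef (Matrix.PosSemidef.smul ?_ (by positivity))
    have := Matrix.posSemidef_vecMulVec_self_star v
    simpa using this
  have hDf : symPow (Matrix.diagonal d) (1 / 2) = Matrix.diagonal fun i => Real.sqrt (d i) := by
    rw [← symPow_half_of_mul_self hf, Matrix.diagonal_mul_diagonal]
    congr 2; funext i; exact (Real.mul_self_sqrt (hd i).le).symm
  refine ⟨hd₂p, ?_⟩
  rw [hDf]
  set f : Matrix n n ℝ := Matrix.diagonal fun i => Real.sqrt (d i) with hfdef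
  have hP : (f * d₂ * f).PosDef := by
    have := hd₂p.conjTranspose_mul_mul_same (B := f) (Matrix.mulVec_injective_of_isUnit hf.isUnit)
    rwa [Matrix.conjTranspose_eq_transpose_of_trivial, transpose_of_posDef hf] at this
  set E := symPow (f * d₂ * f) (1 / 2)
  have hE : E.PosDef := symPow_posDef hP _
  set z : n → ℝ := fun i => Real.sqrt (2 * g) * Real.sqrt (d i) * v i with hz
  have hEE : E * E = Matrix.diagonal (fun i => d i ^ 2) + Matrix.vecMulVec z z := by
    rw [symPow_half_mul_self hP, hd₂, Matrix.mul_add, Matrix.add_mul]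
    congr 1
    · rw [hfdef, Matrix.diagonal_mul_diagonal, Matrix.diagonal_mul_diagonal]
      congr 1; funext i
      have := Real.mul_self_sqrt (hd i).le
      calc Real.sqrt (d i) * d i * Real.sqrt (d i) = Real.sqrt (d i) * Real.sqrt (d i) * d i := by ring
        _ = _ := by rw [this, pow_two]
    · ext i j
      rw [hfdef, Matrix.mul_diagonal, Matrix.diagonal_mul, Matrix.smul_apply, Matrix.vecMulVec_apply,
        Matrix.vecMulVec_apply, hz]
      have := Real.mul_self_sqrt (show 0 ≤ 2 * g by positivity)
      simp only [smul_eq_mul]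
      linear_combination (-(Real.sqrt (d i) * v i * v j * Real.sqrt (d j))) * this
  have hTS : f * symPow E (-(1 / 2))
      * (symPow E (1 / 2) * Matrix.diagonal (fun i => (Real.sqrt (d i))⁻¹)) = 1 := by
    calc _ = f * (symPow E (-(1 / 2)) * symPow E (1 / 2))
          * Matrix.diagonal (fun i => (Real.sqrt (d i))⁻¹) := by noncomm_ring
      _ = 1 := by
        rw [symPow_mul hE, neg_add_cancel, symPow_zero _ hE, Matrix.mul_one, hfdef,
          Matrix.diagonal_mul_diagonal, ← Matrix.diagonal_one]
        congr 1; funext i; exact mul_inv_cancel₀ (hr i).ne'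
  refine (frobSq_polarFactor_sub_one_le hTS).trans ?_
  refine mul_le_mul_of_nonneg_left ((frobSq_sqrt_perturbation_le hd hE hEE).trans_eq ?_) (by norm_num)
  congr 1
  refine Finset.sum_congr rfl fun i _ => ?_
  have h1 := Real.sq_sqrt (show 0 ≤ 2 * g by positivity)
  have h2 := Real.sq_sqrt (hd i).le
  have h3 := (hd i).ne'
  rw [hz]
  simp only [mul_pow, h1, h2]
  field_simp

theorem frobSq_blockConj_sub_one {I : Type} [Fintype I] [DecidableEq I] {t : I → n ⊕ n}
    (ht : Function.Bijective t) (Q : Matrix n n ℝ) :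
    frobSq (blockConj t Q Q - 1) = 2 * frobSq (Q - 1) := by
  have h1 : blockConj t Q Q - 1 = (Matrix.fromBlocks (Q - 1) 0 0 (Q - 1)).submatrix t t := by
    have h2 : (1 : Matrix I I ℝ) = (Matrix.fromBlocks (1 : Matrix n n ℝ) 0 0 1).submatrix t t := by
      rw [Matrix.fromBlocks_one, Matrix.submatrix_one _ ht.1]
    rw [blockConj_self, h2]
    ext a b
    simp only [Matrix.sub_apply, Matrix.submatrix_apply]
    rcases t a with i | i <;> rcases t b with j | j <;> simp
  have h3 : ∀ F : n ⊕ n → n ⊕ n → ℝ, ∑ a, ∑ b, F (t a) (t b) = ∑ x, ∑ y, F x y := by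
    intro F
    rw [← (Equiv.ofBijective t ht).sum_comp]
    refine Finset.sum_congr rfl fun a _ => ?_
    rw [← (Equiv.ofBijective t ht).sum_comp]
    rfl
  rw [h1, frobSq, frobSq]
  refine (h3 fun x y => Matrix.fromBlocks (Q - 1) 0 0 (Q - 1) x y ^ 2).trans ?_
  simp only [Fintype.sum_sum_type, Matrix.fromBlocks_apply₁₁, Matrix.fromBlocks_apply₁₂,
    Matrix.fromBlocks_apply₂₁, Matrix.fromBlocks_apply₂₂, Matrix.zero_apply]
  simp only [ne_eq, OfNat.ofNat_ne_zero, not_false_eq_true, zero_pow, Finset.sum_const_zero, add_zero,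
    zero_add]
  ring

end RankOne

/-! ### The logarithm of an orthogonal matrix -/

theorem branchLog_of_norm_eq_one {t : ℝ} {z : ℂ} (hz : ‖z‖ = 1) :
    branchLog t z
      = (toIocMod Real.two_pi_pos (t - 2 * Real.pi) z.arg : ℝ) * Complex.I := by
  rw [branchLog, hz, Real.log_one]; simp

/-- Because 0 < t < 2π the cut avoids 1: for z = exp(iθ) one has |θ/2| ≤ μ < π. As |z - 1| =
2|sin(θ/2)|, concavity of the sine on [0, π] bounds |θ| by a multiple of it. -/
theorem exists_norm_branchLog_le {t : ℝ} (ht_pos : 0 < t) (ht_lt : t < 2 * Real.pi) :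
    ∃ C > 0, ∀ z : ℂ, ‖z‖ = 1 → ‖branchLog t z‖ ≤ C * ‖z - 1‖ := by
  set μ := max (t / 2) (Real.pi - t / 2) with hμ
  have hμ0 : 0 < μ := lt_max_of_lt_left (by linarith)
  have hμπ : μ < Real.pi := max_lt (by linarith) (by linarith)
  have hs : 0 < Real.sin μ := Real.sin_pos_of_pos_of_lt_pi hμ0 hμπ
  refine ⟨μ / Real.sin μ, by positivity, fun z hz => ?_⟩
  rw [branchLog_of_norm_eq_one hz]
  set θ := toIocMod Real.two_pi_pos (t - 2 * Real.pi) z.arg with hθ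
  have hmem := toIocMod_mem_Ioc Real.two_pi_pos (t - 2 * Real.pi) z.arg
  rw [← hθ, sub_add_cancel] at hmem
  have hz' : z = Complex.exp (Complex.I * θ) := by
    have h1 : (z.arg : ℝ) = θ + (toIocDiv Real.two_pi_pos (t - 2 * Real.pi) z.arg) * (2 * Real.pi) := by
      have := toIocMod_add_toIocDiv_zsmul Real.two_pi_pos (t - 2 * Real.pi) z.arg
      rw [zsmul_eq_mul] at this
      exact this.symm
    have h2 := Complex.norm_mul_exp_arg_mul_I z
    rw [hz, Complex.ofReal_one, one_mul, h1] at h2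
    rw [← h2, Complex.exp_eq_exp_iff_exists_int]
    exact ⟨toIocDiv Real.two_pi_pos (t - 2 * Real.pi) z.arg, by push_cast; ring⟩
  have hx : |θ / 2| ≤ μ := by
    rw [abs_le]
    have h1 := le_max_left (t / 2) (Real.pi - t / 2)
    have h2 := le_max_right (t / 2) (Real.pi - t / 2)
    constructor <;> linarith [hmem.1, hmem.2]
  have hsin : |θ / 2| * Real.sin μ ≤ μ * |Real.sin (θ / 2)| := by
    have h1 : |Real.sin (θ / 2)| = Real.sin |θ / 2| := by
      rw [Real.abs_sin_eq_sin_abs_of_abs_le_pi (hx.trans hμπ.le)]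
    rw [h1]
    have hc := strictConcaveOn_sin_Icc.concaveOn.2
      (show (0 : ℝ) ∈ Set.Icc 0 Real.pi from ⟨le_refl _, Real.pi_pos.le⟩)
      (show μ ∈ Set.Icc 0 Real.pi from ⟨hμ0.le, hμπ.le⟩)
      (show 0 ≤ 1 - |θ / 2| / μ by rw [sub_nonneg, div_le_one hμ0]; exact hx)
      (show 0 ≤ |θ / 2| / μ by positivity) (by ring)
    simp only [smul_eq_mul, mul_zero, zero_add, Real.sin_zero] at hc
    rw [div_mul_cancel₀ _ hμ0.ne', div_mul_eq_mul_div, div_le_iff₀ hμ0] at hc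
    linarith
  have hn : ‖z - 1‖ = 2 * |Real.sin (θ / 2)| := by
    rw [hz', Complex.norm_exp_I_mul_ofReal_sub_one]
    rw [Real.norm_eq_abs, abs_mul, abs_two]
  rw [hn, norm_mul, Complex.norm_I, mul_one, Complex.norm_real, Real.norm_eq_abs, div_mul_eq_mul_div,
    le_div_iff₀ hs]
  have : |θ| = 2 * |θ / 2| := by rw [abs_div, abs_two]; ring
  rw [this]; linarith

section LogMatrix

variable {ι : Type} [Fintype ι] [DecidableEq ι]

/-- The cut of the logarithm does no harm to the functional calculus, because the spectrum is
finite. -/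
theorem continuousOn_spectrum_matrix_complex (A : Matrix ι ι ℂ) (f : ℂ → ℂ) :
    ContinuousOn f (spectrum ℂ A) :=
  A.finite_spectrum.continuousOn f

theorem isStarNormal_of_unitary {V : Matrix ι ι ℂ} (hV : V ∈ unitary (Matrix ι ι ℂ)) :
    IsStarNormal V :=
  ⟨by
    change star V * V = V * star V
    rw [(Unitary.mem_iff.1 hV).1, (Unitary.mem_iff.1 hV).2]⟩

theorem norm_eq_one_of_mem_spectrum {V : Matrix ι ι ℂ} (hV : V ∈ unitary (Matrix ι ι ℂ)) {z : ℂ}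
    (hz : z ∈ spectrum ℂ V) : ‖z‖ = 1 := by
  simpa using spectrum.subset_circle_of_unitary hV hz

/-- On the unit circle every branch of the logarithm is purely imaginary. This makes the generator
skew-adjoint and Z_λ unitary. -/
theorem star_cfc_branchLog {V : Matrix ι ι ℂ} (hV : V ∈ unitary (Matrix ι ι ℂ)) (t : ℝ) :
    star (cfc (branchLog t) V) = -cfc (branchLog t) V := by
  rw [← cfc_star, ← cfc_neg]
  refine cfc_congr fun z hz => ?_
  simp only [branchLog_of_norm_eq_one (norm_eq_one_of_mem_spectrum hV hz)]
  simp

theorem hsNorm_mul_le (A X : Matrix ι ι ℂ) : hsNorm (A * X) ≤ ‖A‖ * hsNorm X := by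
  refine le_of_sq_le_sq ?_ (mul_nonneg (norm_nonneg _) (hsNorm_nonneg _))
  rw [mul_pow, hsNorm_sq, hsNorm_sq, Finset.sum_comm, Finset.sum_comm (f := fun α β => ‖X α β‖ ^ 2),
    Finset.mul_sum]
  refine Finset.sum_le_sum fun β _ => ?_
  have h := Matrix.l2_opNorm_mulVec A (WithLp.toLp 2 fun α => X α β)
  have h2 := pow_le_pow_left₀ (norm_nonneg _) h 2
  rw [mul_pow, EuclideanSpace.norm_sq_eq, EuclideanSpace.norm_sq_eq] at h2
  exact h2

/-- Factor log V = g(V)(V - 1) with g(z) = log z/(z - 1). The operator norm of g(V) is bounded by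
the supremum of g on the circle, and the Hilbert-Schmidt norm falls on V - 1. -/
theorem exists_hsNorm_cfc_branchLog_le {t : ℝ} (ht_pos : 0 < t) (ht_lt : t < 2 * Real.pi) :
    ∃ C > 0, ∀ (ι : Type) [Fintype ι] [DecidableEq ι] (V : Matrix ι ι ℂ),
      V ∈ unitary (Matrix ι ι ℂ) → hsNorm (cfc (branchLog t) V) ≤ C * hsNorm (V - 1) := by
  obtain ⟨C, hC, hb⟩ := exists_norm_branchLog_le ht_pos ht_lt
  refine ⟨C, hC, fun ι _ _ V hV => ?_⟩
  have hn := isStarNormal_of_unitary hV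
  have h1 : cfc (branchLog t) V = cfc (fun z => branchLog t z / (z - 1)) V * (V - 1) := by
    have h2 : V - 1 = cfc (fun z : ℂ => z - 1) V := by
      rw [cfc_sub _ _ V (continuousOn_spectrum_matrix_complex _ _)
        (continuousOn_spectrum_matrix_complex _ _), cfc_id' ℂ V, cfc_const_one ℂ V]
    rw [h2, ← cfc_mul _ _ V (continuousOn_spectrum_matrix_complex _ _)
      (continuousOn_spectrum_matrix_complex _ _)]
    refine cfc_congr fun z hz => ?_
    -- At z = 1 the quotient is 0 by convention, which is consistent because the bound on the
    -- logarithm forces log 1 = 0.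
    by_cases hz1 : z = 1
    · have := hb z (norm_eq_one_of_mem_spectrum hV hz)
      rw [hz1, sub_self, norm_zero, mul_zero] at this
      simp only [hz1, sub_self, mul_zero]
      exact norm_le_zero_iff.1 this
    · rw [div_mul_cancel₀ _ (sub_ne_zero.2 hz1)]
  have h3 : ‖cfc (fun z => branchLog t z / (z - 1)) V‖ ≤ C := by
    refine norm_cfc_le hC.le fun z hz => ?_
    rw [norm_div]
    exact div_le_of_le_mul₀ (norm_nonneg _) hC.le (hb z (norm_eq_one_of_mem_spectrum hV hz))
  rw [h1]
  exact (hsNorm_mul_le _ _).trans (mul_le_mul_of_nonneg_right h3 (hsNorm_nonneg _))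

theorem map_ofReal_mem_unitary {Q : Matrix ι ι ℝ} (hQ : Qᵀ * Q = 1) :
    Q.map Complex.ofReal ∈ unitary (Matrix ι ι ℂ) := by
  have h1 : star (Q.map Complex.ofReal) = Qᵀ.map Complex.ofReal := by
    ext i j; simp [Matrix.star_apply]
  have h2 : ∀ A B : Matrix ι ι ℝ, A.map Complex.ofReal * B.map Complex.ofReal
      = (A * B).map Complex.ofReal := fun A B => (Matrix.map_mul (f := Complex.ofRealHom)).symm
  have h3 : (1 : Matrix ι ι ℝ).map Complex.ofReal = 1 := Matrix.map_one _ Complex.ofReal_zero Complex.ofReal_one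
  rw [Unitary.mem_iff, h1, h2, h2, hQ, mul_eq_one_comm.1 hQ, h3]
  exact ⟨rfl, rfl⟩

theorem hsNorm_map_ofReal_sub_one (Q : Matrix ι ι ℝ) :
    hsNorm (Q.map Complex.ofReal - 1) = Real.sqrt (frobSq (Q - 1)) := by
  rw [hsNorm, frobSq]
  congr 1
  refine Finset.sum_congr rfl fun α _ => Finset.sum_congr rfl fun β _ => ?_
  have : (Q.map Complex.ofReal - 1) α β = (((Q - 1) α β : ℝ) : ℂ) := by
    rw [Matrix.sub_apply, Matrix.sub_apply, Matrix.map_apply, Matrix.one_apply, Matrix.one_apply]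
    split_ifs <;> push_cast <;> rfl
  rw [this, Complex.norm_real, Real.norm_eq_abs, sq_abs]

end LogMatrix

end

noncomputable section

/-! ### Lattice points near a piece of the Fermi surface -/

namespace Momentum

theorem toVec_apply (p : Momentum) (i : Fin 3) : p.toVec i = (p i : ℝ) := rfl

theorem toVec_add (p q : Momentum) : toVec (p + q) = toVec p + toVec q := by
  ext i; simp [toVec_apply]

theorem toVec_sub (p q : Momentum) : toVec (p - q) = toVec p - toVec q := by
  ext i; simp [toVec_apply]

theorem toVec_neg (p : Momentum) : toVec (-p) = -toVec p := by
  ext i; simp [toVec_apply]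

theorem toVec_nsmul (n : ℕ) (p : Momentum) : toVec (n • p) = (n : ℝ) • toVec p := by
  ext i; simp [toVec_apply]

end Momentum

theorem norm_sq_eq_succAbove (i : Fin 3) (x : EuclideanSpace ℝ (Fin 3)) :
    ‖x‖ ^ 2 = x i ^ 2 + ∑ j : Fin 2, x (i.succAbove j) ^ 2 := by
  rw [EuclideanSpace.real_norm_sq_eq, Fin.sum_univ_succAbove _ i]

theorem exists_half_le_abs_apply {ω : EuclideanSpace ℝ (Fin 3)} (hω : ‖ω‖ = 1) :
    ∃ i, 1 / 2 ≤ |ω i| := by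
  by_contra! h
  have h1 : ‖ω‖ ^ 2 = ∑ i, ω i ^ 2 := EuclideanSpace.real_norm_sq_eq ω
  have h2 : ∀ i, ω i ^ 2 ≤ 1 / 4 := fun i => by
    rw [← sq_abs]; nlinarith [h i, abs_nonneg (ω i)]
  rw [hω, Fin.sum_univ_three] at h1
  linarith [h2 0, h2 1, h2 2]

theorem card_Icc_ceil_floor_le (y : ℝ) {r : ℝ} (hr : 0 ≤ r) :
    ((Finset.Icc ⌈y - r⌉ ⌊y + r⌋).card : ℝ) ≤ 2 * r + 1 := by
  rw [Int.card_Icc]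
  have h1 := Int.floor_le (y + r)
  have h2 := Int.le_ceil (y - r)
  rcases le_total 0 (⌊y + r⌋ + 1 - ⌈y - r⌉) with h | h
  · have h3 : (((⌊y + r⌋ + 1 - ⌈y - r⌉).toNat : ℤ) : ℝ) = ((⌊y + r⌋ + 1 - ⌈y - r⌉ : ℤ) : ℝ) := by
      rw [Int.toNat_of_nonneg h]
    rw [Int.cast_natCast] at h3
    rw [h3]; push_cast; linarith
  · rw [Int.toNat_of_nonpos h]; push_cast; linarith

theorem le_card_Icc_ceil_floor (y r : ℝ) :
    2 * r - 1 ≤ ((Finset.Icc ⌈y - r⌉ ⌊y + r⌋).card : ℝ) := by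
  rw [Int.card_Icc]
  have h1 := Int.lt_floor_add_one (y + r)
  have h2 := Int.ceil_lt_add_one (y - r)
  have h3 : ((⌊y + r⌋ + 1 - ⌈y - r⌉ : ℤ) : ℝ) ≤ (((⌊y + r⌋ + 1 - ⌈y - r⌉).toNat : ℤ) : ℝ) :=
    Int.cast_le.2 (Int.self_le_toNat _)
  rw [Int.cast_natCast] at h3
  push_cast at h3
  linarith

theorem mem_Icc_ceil_floor {y r : ℝ} {n : ℤ} : n ∈ Finset.Icc ⌈y - r⌉ ⌊y + r⌋ ↔ |(n : ℝ) - y| ≤ r := by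
  rw [Finset.mem_Icc, Int.ceil_le, Int.le_floor, abs_le]
  constructor <;> rintro ⟨h1, h2⟩ <;> constructor <;> linarith

/-- The integer points of a square. -/
def latticeSquare (y : Fin 2 → ℝ) (r : ℝ) : Finset (Fin 2 → ℤ) :=
  Fintype.piFinset fun j => Finset.Icc ⌈y j - r⌉ ⌊y j + r⌋

theorem mem_latticeSquare {y : Fin 2 → ℝ} {r : ℝ} {v : Fin 2 → ℤ} :
    v ∈ latticeSquare y r ↔ ∀ j, |(v j : ℝ) - y j| ≤ r := by
  simp only [latticeSquare, Fintype.mem_piFinset, mem_Icc_ceil_floor]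

theorem card_latticeSquare_le (y : Fin 2 → ℝ) {r : ℝ} (hr : 0 ≤ r) :
    ((latticeSquare y r).card : ℝ) ≤ (2 * r + 1) ^ 2 := by
  rw [latticeSquare, Fintype.card_piFinset, Fin.prod_univ_two, sq]
  push_cast
  exact mul_le_mul (card_Icc_ceil_floor_le _ hr) (card_Icc_ceil_floor_le _ hr) (Nat.cast_nonneg _)
    (by linarith)

theorem le_card_latticeSquare (y : Fin 2 → ℝ) {r : ℝ} (hr : 1 / 2 ≤ r) :
    (2 * r - 1) ^ 2 ≤ ((latticeSquare y r).card : ℝ) := by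
  rw [latticeSquare, Fintype.card_piFinset, Fin.prod_univ_two, sq]
  push_cast
  exact mul_le_mul (le_card_Icc_ceil_floor _ _) (le_card_Icc_ceil_floor _ _) (by linarith)
    (Nat.cast_nonneg _)

/-- The points are sorted into columns parallel to the axis `i`. The feet lie in a lattice square,
and a nonempty column lies in a window of radius `H` about any of its points. -/
theorem card_le_of_columns {A : Finset Momentum} (i : Fin 3) (y : Fin 2 → ℝ) {r H : ℝ} (hr : 0 ≤ r)
    (hH : 0 ≤ H) (hA : ∀ x ∈ A, ∀ j, |(x (i.succAbove j) : ℝ) - y j| ≤ r)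
    (hA' : ∀ x ∈ A, ∀ x' ∈ A, (∀ j, x (i.succAbove j) = x' (i.succAbove j)) →
      |(x i : ℝ) - x' i| ≤ H) :
    (A.card : ℝ) ≤ (2 * H + 1) * (2 * r + 1) ^ 2 := by
  classical
  have h1 : A.card ≤ ⌊2 * H + 1⌋₊ * (latticeSquare y r).card := by
    refine Finset.card_le_mul_card_image_of_maps_to (f := fun x j => x (i.succAbove j))
      (fun x hx => mem_latticeSquare.2 (hA x hx)) _ fun v _ => ?_
    refine Nat.le_floor ?_
    rcases (A.filter fun x => (fun j => x (i.succAbove j)) = v).eq_empty_or_nonempty with h | ⟨x, hx⟩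
    · rw [h, Finset.card_empty]; push_cast; linarith
    · refine le_trans ?_ (card_Icc_ceil_floor_le (x i) hH)
      refine Nat.cast_le.2 (Finset.card_le_card_of_injOn (fun x => x i) (fun x' hx' => ?_) ?_)
      · rw [Finset.mem_coe, Finset.mem_filter] at hx'
        rw [Finset.mem_filter] at hx
        exact Finset.mem_coe.2 (mem_Icc_ceil_floor.2 (hA' x' hx'.1 x hx.1
          fun j => (congrFun hx'.2 j).trans (congrFun hx.2 j).symm))
      · intro a ha b hb hab
        rw [Finset.mem_coe, Finset.mem_filter] at ha hb
        funext k
        rcases Fin.eq_self_or_eq_succAbove i k with rfl | ⟨j, rfl⟩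
        · exact hab
        · exact (congrFun ha.2 j).trans (congrFun hb.2 j).symm
  calc (A.card : ℝ) ≤ (⌊2 * H + 1⌋₊ : ℝ) * (latticeSquare y r).card := by exact_mod_cast h1
    _ ≤ (2 * H + 1) * (2 * r + 1) ^ 2 :=
      mul_le_mul (Nat.floor_le (by linarith)) (card_latticeSquare_le y hr) (Nat.cast_nonneg _)
        (by linarith)

theorem le_inner_of_norm_sub_le {x κ ω : EuclideanSpace ℝ (Fin 3)} {c r : ℝ} {R : ℝ} (hκ : ‖κ‖ ≤ R)
    (hx : ‖x - c • ω‖ ≤ r) : c * inner ℝ κ ω - r * R ≤ inner ℝ x κ := by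
  have h1 : inner ℝ x κ = inner ℝ (x - c • ω) κ + c * inner ℝ κ ω := by
    rw [inner_sub_left, inner_smul_left, real_inner_comm κ ω]; simp
  have h2 := abs_real_inner_le_norm (x - c • ω) κ
  have h3 : ‖x - c • ω‖ * ‖κ‖ ≤ r * R :=
    mul_le_mul hx hκ (norm_nonneg _) ((norm_nonneg _).trans hx)
  linarith [neg_abs_le (inner ℝ (x - c • ω) κ)]

theorem inner_le_of_norm_sub_le {x κ ω : EuclideanSpace ℝ (Fin 3)} {c r : ℝ} {R : ℝ} (hκ : ‖κ‖ ≤ R)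
    (hx : ‖x - c • ω‖ ≤ r) : inner ℝ x κ ≤ c * inner ℝ κ ω + r * R := by
  have h1 : inner ℝ x κ = inner ℝ (x - c • ω) κ + c * inner ℝ κ ω := by
    rw [inner_sub_left, inner_smul_left, real_inner_comm κ ω]; simp
  have h2 := abs_real_inner_le_norm (x - c • ω) κ
  have h3 : ‖x - c • ω‖ * ‖κ‖ ≤ r * R :=
    mul_le_mul hx hκ (norm_nonneg _) ((norm_nonneg _).trans hx)
  linarith [le_abs_self (inner ℝ (x - c • ω) κ)]

/-- The scales of the pair counting: `ρ` is the angular size of a patch, `s` the slope of a momentum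
transfer of length at most `R`, and `kF` the Fermi momentum. -/
structure PairScales (kF R ρ s : ℝ) : Prop where
  one_le : 1 ≤ R
  slope_pos : 0 < s
  angle_pos : 0 < ρ
  angle_le : 1000 * ρ ≤ 1
  angle_le_slope : 1000 * (R * ρ) ≤ s
  transfer_le_slope : 1000 * R ≤ kF * ρ * s
  transfer_le : 1000 * R ≤ kF * ρ
  sq_le_slope : 1000 * R ^ 2 ≤ kF * s ^ 2

/-! ### Upper bound on the number of particle-hole pairs. -/

section Count

variable {kF R ρ s : ℝ} {κ : Momentum} {ω : EuclideanSpace ℝ (Fin 3)} {A : Finset Momentum}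

theorem PairScales.le_fermi (h : PairScales kF R ρ s) : 1000000 * R ≤ kF := by
  have h1 := h.transfer_le
  have h2 := h.angle_le
  have h3 := h.angle_pos
  have h4 := h.one_le
  have h5 : 0 < kF := by
    by_contra hk
    push Not at hk
    nlinarith
  nlinarith

theorem slope_le_of_norm_le (hω : ‖ω‖ = 1) (hκ : ‖κ.toVec‖ ≤ R) : inner ℝ κ.toVec ω ≤ R := by
  have h := real_inner_le_norm κ.toVec ω
  rw [hω, mul_one] at h
  exact h.trans hκ

/-- Two points of a column satisfy ‖x‖² - ‖x'‖² = (x_i - x'_i)(x_i + x'_i). The axis is chosen with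
|ω_i| ≥ 1/2, so the second factor is at least k_F/2 in modulus, and a column has height at most 6H.
-/
theorem card_slab_le (hω : ‖ω‖ = 1) {r H : ℝ} (hkF : 0 < kF) (hr : 0 ≤ r) (hrk : 4 * r ≤ kF)
    (hH : 0 ≤ H) (hHk : H ≤ kF) (h1 : ∀ x ∈ A, kF ≤ ‖x.toVec‖) (h2 : ∀ x ∈ A, ‖x.toVec‖ ≤ kF + H)
    (h3 : ∀ x ∈ A, ‖x.toVec - kF • ω‖ ≤ r) :
    (A.card : ℝ) ≤ (2 * (6 * H) + 1) * (2 * r + 1) ^ 2 := by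
  obtain ⟨i, hi⟩ := exists_half_le_abs_apply hω
  have hcoord : ∀ x ∈ A, ∀ j, |(x j : ℝ) - kF * ω j| ≤ r := fun x hx j => by
    have e2 := PiLp.norm_apply_le (x.toVec - kF • ω) j
    rw [Real.norm_eq_abs] at e2
    exact e2.trans (h3 x hx)
  refine card_le_of_columns i (fun j => kF * ω (i.succAbove j)) hr (by linarith)
    (fun x hx j => hcoord x hx _) fun x hx x' hx' hxx => ?_
  have f1 := norm_sq_eq_succAbove i x.toVec
  have f2 := norm_sq_eq_succAbove i x'.toVec
  have f3 : ∑ j : Fin 2, x.toVec (i.succAbove j) ^ 2 = ∑ j : Fin 2, x'.toVec (i.succAbove j) ^ 2 :=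
    Finset.sum_congr rfl fun j _ => by
      rw [Momentum.toVec_apply, Momentum.toVec_apply, hxx j]
  have f4 := hcoord x hx i
  have f5 := hcoord x' hx' i
  have f6 : kF / 2 ≤ |(x i : ℝ) + x' i| := by
    have g1 : 2 * kF * ω i = ((x i : ℝ) + x' i) - ((x i : ℝ) - kF * ω i) - ((x' i : ℝ) - kF * ω i) := by
      ring
    have g2 : |2 * kF * ω i| = 2 * kF * |ω i| := by
      rw [abs_mul, abs_of_pos (by linarith)]
    have g3 : |2 * kF * ω i| ≤ |(x i : ℝ) + x' i| + r + r := by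
      rw [g1]
      exact (abs_sub _ _).trans (add_le_add ((abs_sub _ _).trans (add_le_add le_rfl f4)) f5)
    have g4 : kF ≤ 2 * kF * |ω i| := by nlinarith
    linarith
  have f7 : |(x i : ℝ) - x' i| * |(x i : ℝ) + x' i| ≤ 3 * H * kF := by
    rw [← abs_mul]
    have g1 : ((x i : ℝ) - x' i) * (x i + x' i) = ‖x.toVec‖ ^ 2 - ‖x'.toVec‖ ^ 2 := by
      rw [f1, f2, f3, Momentum.toVec_apply, Momentum.toVec_apply]; ring
    rw [g1, abs_le]
    have a1 := pow_le_pow_left₀ (norm_nonneg _) (h2 x hx) 2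
    have a2 := pow_le_pow_left₀ (norm_nonneg _) (h2 x' hx') 2
    have a3 := pow_le_pow_left₀ hkF.le (h1 x hx) 2
    have a4 := pow_le_pow_left₀ hkF.le (h1 x' hx') 2
    have a5 : (kF + H) ^ 2 - kF ^ 2 ≤ 3 * H * kF := by nlinarith
    constructor <;> linarith
  have f8 : |(x i : ℝ) - x' i| * (kF / 2) ≤ 3 * H * kF :=
    (mul_le_mul_of_nonneg_left f6 (abs_nonneg _)).trans f7
  have f10 : |(x i : ℝ) - x' i| * kF ≤ (6 * H) * kF := by linarith
  exact le_of_mul_le_mul_right f10 hkF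

theorem inner_toVec_pos_of_pair {p : Momentum} (h1 : kF < ‖p.toVec‖) (h2 : ‖(p - κ).toVec‖ ≤ kF) :
    0 < inner ℝ p.toVec κ.toVec := by
  have e3 : ‖(p - κ).toVec‖ ^ 2 = ‖p.toVec‖ ^ 2 - 2 * inner ℝ p.toVec κ.toVec + ‖κ.toVec‖ ^ 2 := by
    rw [Momentum.toVec_sub, norm_sub_sq_real]
  nlinarith [norm_nonneg (p - κ).toVec]

theorem norm_add_smul_sq (x y : EuclideanSpace ℝ (Fin 3)) (t : ℝ) :
    ‖x + t • y‖ ^ 2 = ‖x‖ ^ 2 + 2 * t * inner ℝ x y + t ^ 2 * ‖y‖ ^ 2 := by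
  rw [norm_add_sq_real, inner_smul_right, norm_smul, mul_pow, Real.norm_eq_abs, sq_abs]; ring

/-- The norm grows by about `s` per step along κ, so js ≤ 1 keeps the growth bounded. The starting
norm is at most k_F + 4s because `p - κ` lies in the Fermi ball, and the sideways drift j‖κ‖ stays
below the patch size. -/
theorem pair_shift_bounds (h : PairScales kF R ρ s) (hω : ‖ω‖ = 1) (hκ : ‖κ.toVec‖ ≤ R)
    (hs : inner ℝ κ.toVec ω = s) {p : Momentum} (h1 : kF < ‖p.toVec‖) (h2 : ‖(p - κ).toVec‖ ≤ kF)
    (h3 : ‖p.toVec - ‖p.toVec‖ • ω‖ ≤ ρ * ‖p.toVec‖) {j : ℝ} (ej : 0 ≤ j) (e4 : j * s ≤ 1) :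
    kF ≤ ‖p.toVec + j • κ.toVec‖ ∧ ‖p.toVec + j • κ.toVec‖ ≤ kF + (4 * s + 3) ∧
      ‖p.toVec + j • κ.toVec - kF • ω‖ ≤ 4 * (kF * ρ) := by
  have hkF := h.le_fermi
  have hR := h.one_le
  have hs0 := h.slope_pos
  have hρ := h.angle_pos
  have hsR : s ≤ R := hs ▸ slope_le_of_norm_le hω hκ
  have hκ0 := norm_nonneg κ.toVec
  have e1 := norm_add_smul_sq p.toVec κ.toVec j
  have e2 := inner_toVec_pos_of_pair h1 h2
  have e3 : inner ℝ p.toVec κ.toVec ≤ 2 * ‖p.toVec‖ * s := by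
    have := inner_le_of_norm_sub_le hκ h3
    rw [hs] at this
    have g := mul_le_mul_of_nonneg_left h.angle_le_slope (norm_nonneg p.toVec)
    linarith [mul_nonneg (norm_nonneg p.toVec) hs0.le]
  have e5 : ‖p.toVec‖ ≤ kF + 4 * s := by
    have e3' : ‖(p - κ).toVec‖ ^ 2 = ‖p.toVec‖ ^ 2 - 2 * inner ℝ p.toVec κ.toVec + ‖κ.toVec‖ ^ 2 := by
      rw [Momentum.toVec_sub, norm_sub_sq_real]
    have e4 : ‖(p - κ).toVec‖ ^ 2 ≤ kF ^ 2 := pow_le_pow_left₀ (norm_nonneg _) h2 2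
    by_contra hc
    push Not at hc
    nlinarith [sq_nonneg ‖κ.toVec‖]
  have e7 : (0 : ℝ) ≤ 2 * j * inner ℝ p.toVec κ.toVec := by positivity
  have e8 : j ^ 2 * ‖κ.toVec‖ ^ 2 ≤ kF := by
    have g3 : R ^ 2 ≤ s ^ 2 * kF := by linarith [h.sq_le_slope, sq_nonneg R]
    have g4 : (j * s) ^ 2 ≤ 1 := pow_le_one₀ (by positivity) e4
    calc j ^ 2 * ‖κ.toVec‖ ^ 2 ≤ j ^ 2 * R ^ 2 :=
          mul_le_mul_of_nonneg_left (pow_le_pow_left₀ hκ0 hκ 2) (sq_nonneg _)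
      _ ≤ j ^ 2 * (s ^ 2 * kF) := mul_le_mul_of_nonneg_left g3 (sq_nonneg _)
      _ = (j * s) ^ 2 * kF := by ring
      _ ≤ 1 * kF := mul_le_mul_of_nonneg_right g4 (by linarith)
      _ = kF := one_mul _
  have e9 : 2 * j * inner ℝ p.toVec κ.toVec ≤ 4 * ‖p.toVec‖ := by
    calc 2 * j * inner ℝ p.toVec κ.toVec ≤ 2 * j * (2 * ‖p.toVec‖ * s) :=
          mul_le_mul_of_nonneg_left e3 (by positivity)
      _ = 4 * ‖p.toVec‖ * (j * s) := by ring
      _ ≤ 4 * ‖p.toVec‖ * 1 := mul_le_mul_of_nonneg_left e4 (by positivity)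
      _ = _ := by ring
  have e10 : (0 : ℝ) ≤ j ^ 2 * ‖κ.toVec‖ ^ 2 := by positivity
  refine ⟨?_, ?_, ?_⟩
  · refine h1.le.trans (le_of_sq_le_sq ?_ (norm_nonneg _))
    linarith
  · have : ‖p.toVec + j • κ.toVec‖ ≤ ‖p.toVec‖ + 3 := by
      refine le_of_sq_le_sq ?_ (by positivity)
      have : (‖p.toVec‖ + 3) ^ 2 = ‖p.toVec‖ ^ 2 + 6 * ‖p.toVec‖ + 9 := by ring
      linarith
    linarith
  · have g1 : p.toVec + j • κ.toVec - kF • ω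
        = (p.toVec - ‖p.toVec‖ • ω) + (‖p.toVec‖ - kF) • ω + j • κ.toVec := by
      rw [sub_smul]; abel
    have g2 := norm_add₃_le (a := p.toVec - ‖p.toVec‖ • ω) (b := (‖p.toVec‖ - kF) • ω)
      (c := j • κ.toVec)
    rw [← g1, norm_smul, norm_smul, hω, Real.norm_eq_abs, Real.norm_eq_abs,
      abs_of_pos (sub_pos.2 h1), abs_of_nonneg ej] at g2
    have q4 : 0 ≤ kF * ρ := by linarith [h.transfer_le]
    have g4 : j * ‖κ.toVec‖ ≤ kF * ρ := by
      have q2 : R ≤ kF * ρ * s := by linarith [h.transfer_le_slope]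
      calc j * ‖κ.toVec‖ ≤ j * (kF * ρ * s) := mul_le_mul_of_nonneg_left (hκ.trans q2) ej
        _ = (kF * ρ) * (j * s) := by ring
        _ ≤ kF * ρ := mul_le_of_le_one_right q4 e4
    have g5 : ρ * ‖p.toVec‖ ≤ ρ * (kF + 4 * s) := mul_le_mul_of_nonneg_left e5 hρ.le
    have g6 := h.transfer_le
    have g8 := mul_le_mul_of_nonneg_right h.angle_le hs0.le
    linarith

/-- For small `s` the pairs occupy a shell thinner than the lattice spacing, and counting columns
directly would lose the factor `s`. Instead each `p` is replaced by its translates p + jκ with j < J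
= ⌈1/s⌉. They are all distinct and lie in a slab of thickness 4s + 3, so J times the number of pairs
is bounded by the count for the slab. -/
theorem card_pairs_le (h : PairScales kF R ρ s) (hω : ‖ω‖ = 1) (hκ : ‖κ.toVec‖ ≤ R)
    (hs : inner ℝ κ.toVec ω = s) (h1 : ∀ p ∈ A, kF < ‖p.toVec‖) (h2 : ∀ p ∈ A, ‖(p - κ).toVec‖ ≤ kF)
    (h3 : ∀ p ∈ A, ‖p.toVec - ‖p.toVec‖ • ω‖ ≤ ρ * ‖p.toVec‖) :
    (A.card : ℝ) ≤ 14000 * ((kF * ρ) ^ 2 * s) := by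
  classical
  have hkF := h.le_fermi
  have hR := h.one_le
  have hs0 := h.slope_pos
  have hρ := h.angle_pos
  have hsR : s ≤ R := hs ▸ slope_le_of_norm_le hω hκ
  have hκ0 := norm_nonneg κ.toVec
  have hpos : ∀ p ∈ A, 0 < inner ℝ p.toVec κ.toVec := fun p hp =>
    inner_toVec_pos_of_pair (h1 p hp) (h2 p hp)
  set J := ⌈1 / s⌉₊ with hJ
  have hJs : 1 ≤ J * s := by
    have := Nat.le_ceil (1 / s)
    rwa [div_le_iff₀ hs0] at this
  have hJ1 : (1 : ℝ) ≤ J := by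
    have : 0 < J := Nat.ceil_pos.2 (by positivity)
    exact_mod_cast this
  have hjs : ∀ j ∈ Finset.range J, (j : ℝ) * s ≤ 1 := fun j hj => by
    have := Nat.lt_ceil.1 (Finset.mem_range.1 hj)
    rw [lt_div_iff₀ hs0] at this
    exact this.le
  set f : Momentum × ℕ → Momentum := fun x => x.1 + x.2 • κ with hf
  have hftoVec : ∀ p j, (f (p, j)).toVec = p.toVec + (j : ℝ) • κ.toVec := fun p j => by
    rw [hf]; simp only [Momentum.toVec_add, Momentum.toVec_nsmul]
  -- A line in direction κ enters the exterior of the ball only once: p' + nκ is outside for every n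
  -- ≥ 0, whereas p - κ is inside.
  have hstep : ∀ p ∈ A, ∀ p' ∈ A, ∀ n : ℕ, p ≠ p' + (n + 1) • κ := by
    intro p hp p' hp' n hpn
    have e1 := h2 p hp
    have e2 : p - κ = p' + n • κ := by rw [hpn, add_smul, one_smul]; abel
    rw [e2, Momentum.toVec_add, Momentum.toVec_nsmul] at e1
    have e3 := norm_add_smul_sq p'.toVec κ.toVec n
    have e4 := hpos p' hp'
    have e5 := h1 p' hp'
    have e6 : (0 : ℝ) ≤ 2 * n * inner ℝ p'.toVec κ.toVec + (n : ℝ) ^ 2 * ‖κ.toVec‖ ^ 2 := by positivity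
    have e7 := pow_le_pow_left₀ (norm_nonneg _) e1 2
    nlinarith
  have hinj : Set.InjOn f (A ×ˢ Finset.range J : Finset (Momentum × ℕ)) := by
    rintro ⟨p, j⟩ hx ⟨p', j'⟩ hx' hxx
    rw [Finset.mem_coe, Finset.mem_product] at hx hx'
    simp only [hf] at hxx
    rcases lt_trichotomy j j' with hj | rfl | hj
    · obtain ⟨n, rfl⟩ := Nat.exists_eq_add_of_lt hj
      refine (hstep p hx.1 p' hx'.1 n ?_).elim
      have : p = p' + (j + n + 1) • κ - j • κ := by rw [← hxx]; abel
      rw [this, add_assoc j n 1, add_smul j]; abel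
    · rw [add_right_cancel hxx]
    · obtain ⟨n, rfl⟩ := Nat.exists_eq_add_of_lt hj
      refine (hstep p' hx'.1 p hx.1 n ?_).elim
      have : p' = p + (j' + n + 1) • κ - j' • κ := by rw [hxx]; abel
      rw [this, add_assoc j' n 1, add_smul j']; abel
  have hcard : ((A ×ˢ Finset.range J).image f).card = A.card * J := by
    rw [Finset.card_image_of_injOn hinj, Finset.card_product, Finset.card_range]
  have himg : ∀ x ∈ (A ×ˢ Finset.range J).image f, kF ≤ ‖x.toVec‖ ∧ ‖x.toVec‖ ≤ kF + (4 * s + 3) ∧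
      ‖x.toVec - kF • ω‖ ≤ 4 * (kF * ρ) := by
    intro x hx
    obtain ⟨⟨p, j⟩, hpj, rfl⟩ := Finset.mem_image.1 hx
    rw [Finset.mem_product] at hpj
    obtain ⟨hp, hj⟩ := hpj
    simp only at hp hj
    rw [hftoVec]
    exact pair_shift_bounds h hω hκ hs (h1 p hp) (h2 p hp) (h3 p hp) (Nat.cast_nonneg j) (hjs j hj)
  have hρk : 1000 ≤ kF * ρ := by linarith [h.transfer_le]
  have hρk' : 4 * (4 * (kF * ρ)) ≤ kF := by nlinarith [h.angle_le]
  have hcol := card_slab_le hω (by linarith) (by linarith) hρk' (by linarith) (by linarith)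
    (fun x hx => (himg x hx).1) (fun x hx => (himg x hx).2.1) (fun x hx => (himg x hx).2.2)
  rw [hcard] at hcol
  push_cast at hcol
  have hfin : (2 * (6 * (4 * s + 3)) + 1) * (2 * (4 * (kF * ρ)) + 1) ^ 2
      ≤ (13 * (4 * s + 3)) * (66 * (kF * ρ) ^ 2) := by
    refine mul_le_mul (by linarith) ?_ (by positivity) (by positivity)
    nlinarith
  have hcol' := hcol.trans hfin
  have hA0 : (0 : ℝ) ≤ A.card := Nat.cast_nonneg _
  have hX : (0 : ℝ) ≤ (kF * ρ) ^ 2 := sq_nonneg _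
  -- For s ≤ 1 the gain comes from Js ≥ 1, for s ≥ 1 from 4s + 3 ≤ 7s.
  rcases le_total s 1 with h1s | h1s
  · have e1 : (A.card : ℝ) ≤ A.card * J * s := by
      calc (A.card : ℝ) = A.card * 1 := (mul_one _).symm
        _ ≤ A.card * (J * s) := mul_le_mul_of_nonneg_left hJs hA0
        _ = _ := by ring
    have e2 : 13 * (4 * s + 3) * (66 * (kF * ρ) ^ 2) ≤ 13 * 7 * (66 * (kF * ρ) ^ 2) :=
      mul_le_mul_of_nonneg_right (by linarith) (by positivity)
    have e3 := mul_le_mul_of_nonneg_right (hcol'.trans e2) hs0.le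
    have : 0 ≤ (kF * ρ) ^ 2 * s := by positivity
    linarith
  · have e1 : (A.card : ℝ) ≤ A.card * J := le_mul_of_one_le_right hA0 hJ1
    have e2 : 13 * (4 * s + 3) * (66 * (kF * ρ) ^ 2) ≤ 13 * (7 * s) * (66 * (kF * ρ) ^ 2) :=
      mul_le_mul_of_nonneg_right (by linarith) (by positivity)
    have : 0 ≤ (kF * ρ) ^ 2 * s := by positivity
    linarith

end Count

end

/-! ### Lower bound on the number of particle-hole pairs. -/

noncomputable section

section CountLower

variable {kF R ρ s : ℝ} {κ : Momentum} {ω : EuclideanSpace ℝ (Fin 3)} {A : Finset Momentum}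

theorem half_le_card_Ioc_floor (z : ℝ) {h : ℝ} (hh : 1 ≤ h) :
    h / 2 ≤ ((Finset.Ioc ⌊z⌋ ⌊z + h⌋).card : ℝ) := by
  rw [Int.card_Ioc]
  have h1 := Int.lt_floor_add_one (z + h)
  have h2 := Int.floor_le z
  have h3 : ((⌊z + h⌋ - ⌊z⌋ : ℤ) : ℝ) ≤ (((⌊z + h⌋ - ⌊z⌋).toNat : ℤ) : ℝ) :=
    Int.cast_le.2 (Int.self_le_toNat _)
  have h4 : 1 ≤ ⌊z + h⌋ - ⌊z⌋ := by
    have : ⌊z⌋ + 1 ≤ ⌊z + h⌋ := by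
      rw [Int.le_floor]; push_cast; linarith
    omega
  have h5 : (1 : ℝ) ≤ ((⌊z + h⌋ - ⌊z⌋ : ℤ) : ℝ) := by exact_mod_cast h4
  rw [Int.cast_natCast] at h3
  push_cast at h3 h5
  linarith

/-- Walking from `x` in steps of -κ, the last point before the first entry into the Fermi ball is
the particle of a pair. -/
theorem exists_mem_of_crossing (hA : ∀ p : Momentum, kF < ‖p.toVec‖ → ‖(p - κ).toVec‖ ≤ kF →
      ‖p.toVec - kF • ω‖ ≤ ρ → ‖(p - κ).toVec - kF • ω‖ ≤ ρ → p ∈ A)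
    {x : Momentum} {J : ℕ} (h1 : kF < ‖x.toVec‖) (h2 : ‖(x - J • κ).toVec‖ ≤ kF)
    (h3 : ∀ j ≤ J, ‖(x - j • κ).toVec - kF • ω‖ ≤ ρ) : ∃ p ∈ A, ∃ j < J, p + j • κ = x := by
  classical
  have hex : ∃ n, ‖(x - n • κ).toVec‖ ≤ kF := ⟨J, h2⟩
  have hn := Nat.find_spec hex
  have hnJ : Nat.find hex ≤ J := Nat.find_min' hex h2
  have hn0 : Nat.find hex ≠ 0 := fun h => by
    rw [h] at hn; simp only [zero_smul, sub_zero] at hn; linarith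
  obtain ⟨j, hj⟩ := Nat.exists_eq_succ_of_ne_zero hn0
  have hmin : ¬ ‖(x - j • κ).toVec‖ ≤ kF := Nat.find_min hex (by omega)
  have hstep : x - j • κ - κ = x - (j + 1) • κ := by rw [add_smul, one_smul]; abel
  refine ⟨x - j • κ, hA _ (not_le.1 hmin) ?_ (h3 j (by omega)) ?_, j, by omega, by abel⟩
  · rw [hstep]; rw [hj] at hn; exact hn
  · rw [hstep]; exact h3 (j + 1) (by omega)

/-- The transverse coordinates are within ε of those of k_F ω, and the norm then fixes x_i²
approximately. The sign condition selects the sheet of the sphere near k_F ω, so x_i + k_F ω_i is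
large and x_i - k_F ω_i is small. -/
theorem column_point_bound (hω : ‖ω‖ = 1) {i : Fin 3} (hi : 1 / 2 ≤ |ω i|) {x : Momentum} {ε D : ℝ}
    (hkF : 0 < kF) (hε : ε ≤ kF / 8)
    (hx : ∀ j, |(x (i.succAbove j) : ℝ) - kF * ω (i.succAbove j)| ≤ ε)
    (hsign : 0 ≤ (x i : ℝ) * ω i) (h1 : kF ^ 2 ≤ ‖x.toVec‖ ^ 2) (h2 : ‖x.toVec‖ ^ 2 ≤ kF ^ 2 + D) :
    ‖x.toVec - kF • ω‖ * kF ≤ 2 * D + 11 * (ε * kF) := by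
  have hω2 := norm_sq_eq_succAbove i ω
  have hx2 := norm_sq_eq_succAbove i x.toVec
  rw [hω] at hω2
  simp only [Momentum.toVec_apply, Fin.sum_univ_two] at hω2 hx2
  have hx0 := hx 0
  have hx1 := hx 1
  have hωj : ∀ j, |ω j| ≤ 1 := fun j => by
    have := PiLp.norm_apply_le ω j
    rwa [hω, Real.norm_eq_abs] at this
  have key : ∀ j, |(x (i.succAbove j) : ℝ) ^ 2 - (kF * ω (i.succAbove j)) ^ 2| ≤ ε * (17 / 8 * kF) := by
    intro j
    have e1 : (x (i.succAbove j) : ℝ) ^ 2 - (kF * ω (i.succAbove j)) ^ 2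
        = ((x (i.succAbove j) : ℝ) - kF * ω (i.succAbove j))
          * (((x (i.succAbove j) : ℝ) - kF * ω (i.succAbove j)) + 2 * (kF * ω (i.succAbove j))) := by
      ring
    rw [e1, abs_mul]
    have e2 : |kF * ω (i.succAbove j)| ≤ kF := by
      rw [abs_mul, abs_of_pos hkF]; exact mul_le_of_le_one_right hkF.le (hωj _)
    refine mul_le_mul (hx j) ?_ (abs_nonneg _) ((abs_nonneg _).trans (hx j))
    refine (abs_add_le _ _).trans ?_
    rw [abs_mul 2, abs_two]
    linarith [hx j]
  have hi2 : |(x i : ℝ) ^ 2 - (kF * ω i) ^ 2| ≤ D + 17 / 4 * (ε * kF) := by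
    have k0 := abs_le.1 (key 0)
    have k1 := abs_le.1 (key 1)
    have hsplit : kF ^ 2 = (kF * ω i) ^ 2 + ((kF * ω (i.succAbove 0)) ^ 2
        + (kF * ω (i.succAbove 1)) ^ 2) := by
      simp only [mul_pow, ← mul_add, ← hω2]; ring
    rw [abs_le]
    constructor <;> linarith [k0.1, k0.2, k1.1, k1.2]
  have hsum : kF / 2 ≤ |(x i : ℝ) + kF * ω i| := by
    have e1 : |(x i : ℝ) + kF * ω i| = |(x i : ℝ)| + |kF * ω i| := by
      rw [abs_add_eq_add_abs_iff]
      rcases le_total 0 (ω i) with h | h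
      · have hp : 0 < ω i := by rw [abs_of_nonneg h] at hi; linarith
        exact Or.inl ⟨nonneg_of_mul_nonneg_left hsign hp, by positivity⟩
      · have hp : ω i < 0 := by rw [abs_of_nonpos h] at hi; linarith
        exact Or.inr ⟨by nlinarith, by nlinarith⟩
    rw [e1, abs_mul, abs_of_pos hkF]
    nlinarith [abs_nonneg (x i : ℝ)]
  have hdi : |(x i : ℝ) - kF * ω i| * (kF / 2) ≤ D + 17 / 4 * (ε * kF) := by
    refine (mul_le_mul_of_nonneg_left hsum (abs_nonneg _)).trans ?_
    rw [← abs_mul]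
    refine le_trans (le_of_eq ?_) hi2
    congr 1; ring
  have hnorm : ‖x.toVec - kF • ω‖ ≤ |(x i : ℝ) - kF * ω i| + (ε + ε) := by
    have e0 := norm_sq_eq_succAbove i (x.toVec - kF • ω)
    rw [Fin.sum_univ_two] at e0
    have e1 : ∀ j, (x.toVec - kF • ω) j = (x j : ℝ) - kF * ω j := fun j => rfl
    simp only [e1] at e0
    have hε0 : 0 ≤ ε := (abs_nonneg _).trans hx0
    refine le_of_sq_le_sq ?_ (by positivity)
    rw [e0, ← sq_abs ((x i : ℝ) - kF * ω i), ← sq_abs ((x (i.succAbove 0) : ℝ) - _),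
      ← sq_abs ((x (i.succAbove 1) : ℝ) - _)]
    have a0 := pow_le_pow_left₀ (abs_nonneg _) hx0 2
    have a1 := pow_le_pow_left₀ (abs_nonneg _) hx1 2
    have : 0 ≤ |(x i : ℝ) - kF * ω i| * ε := by positivity
    nlinarith
  have := mul_le_mul_of_nonneg_right hnorm hkF.le
  linarith [mul_nonneg ((abs_nonneg _).trans hx0) hkF.le]

/-- `J` steps lower ‖x‖² by about 2J k_F s = 8 k_F t. This beats the excess 2k_F t + t² and the
quadratic term J²‖κ‖² ≤ k_F t. -/
theorem crossing_of_column_point (h : PairScales kF R ρ s) (hω : ‖ω‖ = 1) (hκ : ‖κ.toVec‖ ≤ R)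
    (hs : inner ℝ κ.toVec ω = s) {J t : ℝ} (hJ1 : 1 ≤ J) (hJ : J * s = 4 * t) (ht : 1 ≤ t)
    (ht' : 4 * t ≤ 4 + s) {x : EuclideanSpace ℝ (Fin 3)} (hx : ‖x‖ ^ 2 ≤ kF ^ 2 + (2 * kF * t + t ^ 2))
    (hx' : ‖x - kF • ω‖ ≤ ρ * kF / 8) : ‖x - J • κ.toVec‖ ≤ kF := by
  have hkF := h.le_fermi
  have hR := h.one_le
  have hs0 := h.slope_pos
  have hsR : s ≤ R := hs ▸ slope_le_of_norm_le hω hκ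
  have e1 := norm_add_smul_sq x κ.toVec (-J)
  rw [neg_smul, ← sub_eq_add_neg] at e1
  have e2 := le_inner_of_norm_sub_le hκ hx'
  rw [hs] at e2
  have e3 : 9 / 10 * (kF * s) ≤ inner ℝ x κ.toVec := by
    have := mul_le_mul_of_nonneg_left h.angle_le_slope (show 0 ≤ kF by linarith)
    have : 0 ≤ kF * s := mul_nonneg (by linarith) hs0.le
    linarith
  have e4 : 36 / 5 * (kF * t) ≤ 2 * J * inner ℝ x κ.toVec := by
    calc 36 / 5 * (kF * t) = 2 * J * (9 / 10 * (kF * s)) := by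
          linear_combination (-(9 / 5) * kF) * hJ
      _ ≤ _ := mul_le_mul_of_nonneg_left e3 (by linarith)
  have e5 : J ^ 2 * ‖κ.toVec‖ ^ 2 ≤ kF * t := by
    have g1 : J ^ 2 * ‖κ.toVec‖ ^ 2 ≤ J ^ 2 * (kF * s ^ 2 / 1000) :=
      mul_le_mul_of_nonneg_left ((pow_le_pow_left₀ (norm_nonneg _) hκ 2).trans
        (by linarith [h.sq_le_slope])) (sq_nonneg _)
    have g2 : J ^ 2 * (kF * s ^ 2 / 1000) = kF * (16 * t ^ 2) / 1000 := by
      have : (J * s) ^ 2 = 16 * t ^ 2 := by rw [hJ]; ring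
      linear_combination (kF / 1000) * this
    by_cases h1s : s ≤ 1
    · have : t ≤ 5 / 4 := by linarith
      have : t ^ 2 ≤ 5 / 4 * t := by rw [sq]; exact mul_le_mul_of_nonneg_right this (by linarith)
      have : kF * t ^ 2 ≤ kF * (5 / 4 * t) := mul_le_mul_of_nonneg_left this (by linarith)
      have : 0 ≤ kF * t := mul_nonneg (by linarith) (by linarith)
      linarith
    · have hJ5 : J ≤ 5 := by
        by_contra hc
        push Not at h1s hc
        linarith [mul_lt_mul_of_pos_right hc hs0]
      have g3 : J ^ 2 * ‖κ.toVec‖ ^ 2 ≤ 25 * R ^ 2 :=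
        mul_le_mul (by nlinarith only [hJ5, hJ1]) (pow_le_pow_left₀ (norm_nonneg _) hκ 2)
          (sq_nonneg _) (by norm_num)
      have q1 : R * R ≤ (kF * ρ / 1000) * R :=
        mul_le_mul_of_nonneg_right (by linarith [h.transfer_le]) (by linarith)
      have q2 : kF * (1000 * (R * ρ)) ≤ kF * s :=
        mul_le_mul_of_nonneg_left h.angle_le_slope (by linarith)
      have q3 : kF * s ≤ kF * (4 * t) :=
        mul_le_mul_of_nonneg_left (hJ ▸ le_mul_of_one_le_left hs0.le hJ1) (by linarith)
      have : 0 ≤ kF * t := mul_nonneg (by linarith) (by linarith)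
      linarith
  have e6 : t ^ 2 ≤ kF * t := by
    rw [sq]; exact mul_le_mul_of_nonneg_right (by linarith) (by linarith)
  refine le_of_sq_le_sq ?_ (by linarith)
  rw [e1]
  have : 0 ≤ kF * t := mul_nonneg (by linarith) (by linarith)
  linarith

/-- Over a small lattice square, erect columns of height `t` on the sphere near k_F ω; each contains
at least t/2 lattice points. From each such point fewer than `J` steps back along κ reach the
particle of a pair, and a pair is reached from at most `J` points. Hence the number of column points
is at most `J` times the number of pairs, with Js = 4t. -/
theorem le_card_pairs (h : PairScales kF R ρ s) (hω : ‖ω‖ = 1) (hκ : ‖κ.toVec‖ ≤ R)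
    (hs : inner ℝ κ.toVec ω = s)
    (hA : ∀ p : Momentum, kF < ‖p.toVec‖ → ‖(p - κ).toVec‖ ≤ kF →
      ‖p.toVec - kF • ω‖ ≤ ρ * kF / 4 → ‖(p - κ).toVec - kF • ω‖ ≤ ρ * kF / 4 → p ∈ A) :
    (kF * ρ) ^ 2 * s ≤ 320000 * A.card := by
  classical
  have hkF := h.le_fermi
  have hR := h.one_le
  have hs0 := h.slope_pos
  have hρ := h.angle_pos
  have hsR : s ≤ R := hs ▸ slope_le_of_norm_le hω hκ
  have htr := h.transfer_le
  have htr' := h.transfer_le_slope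
  obtain ⟨i, hi⟩ := exists_half_le_abs_apply hω
  -- With J = ⌈4/s⌉ the column height t = Js/4 is at least 1, so that no column is empty, while Js ≤
  -- 4 + s keeps it small.
  obtain ⟨J, hJ1, hJ2, hJ3⟩ : ∃ J : ℕ, (1 : ℝ) ≤ J ∧ 4 ≤ J * s ∧ J * s ≤ 4 + s := by
    refine ⟨⌈4 / s⌉₊, ?_, ?_, ?_⟩
    · have : 0 < ⌈4 / s⌉₊ := Nat.ceil_pos.2 (by positivity)
      exact_mod_cast this
    · have := Nat.le_ceil (4 / s)
      rwa [div_le_iff₀ hs0] at this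
    · have := (Nat.ceil_lt_add_one (show 0 ≤ 4 / s by positivity)).le
      calc (⌈4 / s⌉₊ : ℝ) * s ≤ (4 / s + 1) * s := mul_le_mul_of_nonneg_right this hs0.le
        _ = 4 + s := by field_simp
  obtain ⟨t, ht⟩ : ∃ t, J * s = 4 * t := ⟨J * s / 4, by ring⟩
  have ht1 : 1 ≤ t := by linarith
  have ht2 : 4 * t ≤ 4 + s := by linarith
  -- A small fraction of the patch size leaves room for the height of the columns and for the drift
  -- over `J` steps.
  set ε := kF * ρ / 200 with hε
  have hεk : ε ≤ kF / 8 := by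
    have := mul_le_mul_of_nonneg_left h.angle_le (show 0 ≤ kF by linarith)
    linarith
  have hJR : J * R ≤ kF * ρ / 200 := by
    have h1 : J * R ≤ J * (kF * ρ * s / 1000) := mul_le_mul_of_nonneg_left (by linarith) (by linarith)
    have h2 : J * (kF * ρ * s / 1000) = kF * ρ / 1000 * (J * s) := by ring
    have h4 : 0 ≤ kF * ρ / 1000 := by linarith
    rcases le_total s 1 with h3 | h3
    · have := mul_le_mul_of_nonneg_left (hJ3.trans (by linarith : 4 + s ≤ 5)) h4
      linarith
    · have hJ5 : (J : ℝ) ≤ 5 := by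
        by_contra hc
        push Not at hc
        linarith [mul_lt_mul_of_pos_right hc hs0]
      have := mul_le_mul_of_nonneg_right hJ5 (show 0 ≤ R by linarith)
      linarith
  -- The sign σ of ω_i decides on which sheet of the sphere the columns stand.
  obtain ⟨σ, hσ, hσω⟩ : ∃ σ : ℤ, (σ : ℝ) ^ 2 = 1 ∧ 0 ≤ (σ : ℝ) * ω i := by
    rcases le_total 0 (ω i) with h | h
    · exact ⟨1, by simp, by simpa using h⟩
    · exact ⟨-1, by simp, by simpa using h⟩
  set Y := latticeSquare (fun j => kF * ω (i.succAbove j)) ε with hY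
  set z₀ : (Fin 2 → ℤ) → ℝ := fun y => Real.sqrt (kF ^ 2 - ∑ j, (y j : ℝ) ^ 2) with hz₀
  set S : Finset (Σ _ : Fin 2 → ℤ, ℤ) := Y.sigma fun y => Finset.Ioc ⌊z₀ y⌋ ⌊z₀ y + t⌋ with hS
  set g : (Σ _ : Fin 2 → ℤ, ℤ) → Momentum := fun v => i.insertNth (σ * v.2) v.1 with hg
  have hcardS : (kF * ρ / 200) ^ 2 * (t / 2) ≤ (S.card : ℝ) := by
    rw [hS, Finset.card_sigma]
    push_cast
    refine le_trans ?_ (Finset.sum_le_sum fun y _ => half_le_card_Ioc_floor (z₀ y) ht1)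
    rw [Finset.sum_const, nsmul_eq_mul]
    refine mul_le_mul_of_nonneg_right ?_ (by linarith)
    refine le_trans ?_ (le_card_latticeSquare _ (by linarith))
    refine pow_le_pow_left₀ (by linarith) (by linarith) 2
  have hmaps : ∀ v ∈ S, g v ∈ (A ×ˢ Finset.range J).image fun x => x.1 + x.2 • κ := by
    rintro ⟨y, z⟩ hv
    rw [hS, Finset.mem_sigma] at hv
    obtain ⟨hy, hz⟩ := hv
    simp only [Finset.mem_Ioc, Int.floor_lt, Int.le_floor] at hy hz
    rw [hY, mem_latticeSquare] at hy
    set x := g ⟨y, z⟩ with hx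
    have hxi : x i = σ * z := by rw [hx, hg]; simp
    have hxj : ∀ j, x (i.succAbove j) = y j := fun j => by rw [hx, hg]; simp
    have hz0 : 0 ≤ z₀ y := Real.sqrt_nonneg _
    have hzpos : (0 : ℝ) < z := lt_of_le_of_lt hz0 hz.1
    have hxn : ‖x.toVec‖ ^ 2 = (z : ℝ) ^ 2 + ∑ j, (y j : ℝ) ^ 2 := by
      rw [norm_sq_eq_succAbove i]
      simp only [Momentum.toVec_apply, hxi, hxj]
      push_cast
      rw [mul_pow, hσ, one_mul]
    have hsq : kF ^ 2 - ∑ j, (y j : ℝ) ^ 2 ≤ z₀ y ^ 2 := by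
      rcases le_total 0 (kF ^ 2 - ∑ j, (y j : ℝ) ^ 2) with h0 | h0
      · rw [hz₀, Real.sq_sqrt h0]
      · exact h0.trans (sq_nonneg _)
    have hlow : kF ^ 2 < ‖x.toVec‖ ^ 2 := by
      rw [hxn]
      have := pow_lt_pow_left₀ hz.1 hz0 two_ne_zero
      linarith
    have hysum : ∑ j, (y j : ℝ) ^ 2 ≤ kF ^ 2 := by
      have hω2 := norm_sq_eq_succAbove i ω
      rw [hω, Fin.sum_univ_two] at hω2
      rw [Fin.sum_univ_two]
      have hq : 1 / 4 ≤ ω i ^ 2 := by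
        rw [← sq_abs]
        linarith [pow_le_pow_left₀ (by norm_num) hi 2]
      have hb : ∀ j, (y j : ℝ) ^ 2 ≤ 5 / 4 * (kF * ω (i.succAbove j)) ^ 2 + 5 * ε ^ 2 := fun j => by
        have b1 := pow_le_pow_left₀ (abs_nonneg _) (hy j) 2
        rw [sq_abs] at b1
        nlinarith only [b1, sq_nonneg (4 * ((y j : ℝ) - kF * ω (i.succAbove j))
          - kF * ω (i.succAbove j))]
      have hε2 : ε ^ 2 ≤ (kF / 1000) ^ 2 := by
        refine pow_le_pow_left₀ (by linarith) ?_ 2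
        have := mul_le_mul_of_nonneg_left h.angle_le (show 0 ≤ kF by linarith)
        linarith
      have hk2 : (kF / 1000) ^ 2 = kF ^ 2 / 1000000 := by ring
      have hw : kF ^ 2 * (ω (i.succAbove 0) ^ 2 + ω (i.succAbove 1) ^ 2) ≤ kF ^ 2 * (3 / 4) :=
        mul_le_mul_of_nonneg_left (by linarith) (sq_nonneg _)
      have h0 := hb 0
      have h1 := hb 1
      rw [mul_pow] at h0 h1
      linarith [sq_nonneg kF]
    have hz0sq : z₀ y ^ 2 = kF ^ 2 - ∑ j, (y j : ℝ) ^ 2 := by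
      rw [hz₀]; exact Real.sq_sqrt (by linarith)
    have hz0k : z₀ y ≤ kF := by
      refine le_of_sq_le_sq ?_ (by linarith)
      rw [hz0sq]
      linarith [Finset.sum_nonneg fun j (_ : j ∈ Finset.univ) => sq_nonneg (y j : ℝ)]
    have hup : ‖x.toVec‖ ^ 2 ≤ kF ^ 2 + (2 * kF * t + t ^ 2) := by
      rw [hxn]
      have b1 := pow_le_pow_left₀ hzpos.le hz.2 2
      have b2 := mul_le_mul_of_nonneg_right hz0k (show 0 ≤ t by linarith)
      linarith
    have hdist : ‖x.toVec - kF • ω‖ ≤ ρ * kF / 8 := by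
      have b1 := column_point_bound hω hi (x := x) (by linarith) hεk
        (fun j => by rw [hxj]; exact hy j)
        (by rw [hxi]; push_cast; rw [mul_right_comm]; positivity) hlow.le hup
      have b2 : t ≤ kF * ρ / 500 := by linarith
      have b3 : t ^ 2 ≤ kF * t := by
        rw [sq]; exact mul_le_mul_of_nonneg_right (by linarith) (by linarith)
      have b4 := mul_le_mul_of_nonneg_left b2 (show 0 ≤ kF by linarith)
      have b5 : 0 ≤ kF * (kF * ρ) := mul_nonneg (by linarith) (by linarith)
      have b6 : ‖x.toVec - kF • ω‖ * kF ≤ (ρ * kF / 8) * kF := by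
        rw [hε] at b1
        linarith
      exact le_of_mul_le_mul_right b6 (by linarith)
    have hcross := crossing_of_column_point h hω hκ hs hJ1 ht ht1 ht2 hup hdist
    have hlow' : kF < ‖x.toVec‖ := lt_of_pow_lt_pow_left₀ 2 (norm_nonneg _) hlow
    have hsub : ∀ j : ℕ, (x - j • κ).toVec = x.toVec - (j : ℝ) • κ.toVec := fun j => by
      rw [Momentum.toVec_sub, Momentum.toVec_nsmul]
    obtain ⟨p, hp, j, hj, hpj⟩ := exists_mem_of_crossing (x := x) (J := J) hA hlow'
      (by rw [hsub]; exact hcross) (fun j hj => by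
        rw [hsub, sub_right_comm]
        refine (norm_sub_le _ _).trans ?_
        rw [norm_smul, Real.norm_eq_abs, abs_of_nonneg (Nat.cast_nonneg j)]
        have b1 : (j : ℝ) * ‖κ.toVec‖ ≤ J * R :=
          mul_le_mul (Nat.cast_le.2 hj) hκ (norm_nonneg _) (Nat.cast_nonneg _)
        linarith)
    exact Finset.mem_image.2 ⟨(p, j), Finset.mem_product.2 ⟨hp, Finset.mem_range.2 hj⟩, hpj⟩
  have hσ0 : σ ≠ 0 := by
    rintro rfl
    norm_num at hσ
  have hinj : Set.InjOn g S := by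
    rintro ⟨y, z⟩ _ ⟨y', z'⟩ _ hyz
    simp only [hg] at hyz
    obtain ⟨e1, e2⟩ := Fin.insertNth_inj.1 hyz
    obtain rfl := mul_left_cancel₀ hσ0 e1
    obtain rfl := e2
    rfl
  have hle : S.card ≤ A.card * J := by
    refine (Finset.card_le_card_of_injOn g hmaps hinj).trans (Finset.card_image_le.trans ?_)
    rw [Finset.card_product, Finset.card_range]
  have hle' : (S.card : ℝ) ≤ A.card * J := by exact_mod_cast hle
  have hfin : (kF * ρ) ^ 2 * s * J ≤ 320000 * A.card * J := by
    have : (kF * ρ / 200) ^ 2 * (t / 2) = (kF * ρ) ^ 2 * s * J / 320000 := by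
      linear_combination -((kF * ρ) ^ 2 / 320000) * ht
    linarith
  exact le_of_mul_le_mul_right hfin (by linarith)

end CountLower

end

noncomputable section

/-! ### Spherical coordinates -/

theorem norm_sphPoint_sub_sq (θ φ θ' φ' : ℝ) : ‖sphPoint θ φ - sphPoint θ' φ'‖ ^ 2
    = 4 * Real.sin ((θ - θ') / 2) ^ 2
      + 4 * (Real.sin θ * Real.sin θ') * Real.sin ((φ - φ') / 2) ^ 2 := by
  have hs : ∀ x : ℝ, 4 * Real.sin (x / 2) ^ 2 = 2 - 2 * Real.cos x := fun x => by
    have := Real.cos_sq (x / 2)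
    rw [Real.cos_sq', mul_div_cancel₀ x two_ne_zero] at this
    linarith
  rw [hs, mul_right_comm, hs, EuclideanSpace.real_norm_sq_eq, Fin.sum_univ_three, Real.cos_sub,
    Real.cos_sub]
  have e0 : (sphPoint θ φ - sphPoint θ' φ') 0
      = Real.sin θ * Real.cos φ - Real.sin θ' * Real.cos φ' := rfl
  have e1 : (sphPoint θ φ - sphPoint θ' φ') 1
      = Real.sin θ * Real.sin φ - Real.sin θ' * Real.sin φ' := rfl
  have e2 : (sphPoint θ φ - sphPoint θ' φ') 2 = Real.cos θ - Real.cos θ' := rfl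
  rw [e0, e1, e2]
  have h1 := Real.sin_sq_add_cos_sq θ
  have h2 := Real.sin_sq_add_cos_sq θ'
  have h3 := Real.sin_sq_add_cos_sq φ
  have h4 := Real.sin_sq_add_cos_sq φ'
  linear_combination h1 + h2 + Real.sin θ ^ 2 * h3 + Real.sin θ' ^ 2 * h4

theorem norm_sphPoint (θ φ : ℝ) : ‖sphPoint θ φ‖ = 1 := by
  have h : ‖sphPoint θ φ‖ ^ 2 = 1 := by
    rw [EuclideanSpace.real_norm_sq_eq, Fin.sum_univ_three]
    have e0 : sphPoint θ φ 0 = Real.sin θ * Real.cos φ := rfl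
    have e1 : sphPoint θ φ 1 = Real.sin θ * Real.sin φ := rfl
    have e2 : sphPoint θ φ 2 = Real.cos θ := rfl
    rw [e0, e1, e2]
    linear_combination Real.sin_sq_add_cos_sq θ + Real.sin θ ^ 2 * Real.sin_sq_add_cos_sq φ
  exact (pow_eq_one_iff_of_nonneg (norm_nonneg _) two_ne_zero).1 h

/-- The azimuth can be taken in a window centred at any φ₀, so differences from a patch centre stay
in [-π, π], where the chord controls the angle. -/
theorem exists_eq_sphPoint {ω : EuclideanSpace ℝ (Fin 3)} (hω : ‖ω‖ = 1) (φ₀ : ℝ) :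
    ∃ θ ∈ Set.Icc 0 Real.pi, ∃ φ ∈ Set.Icc (φ₀ - Real.pi) (φ₀ + Real.pi), ω = sphPoint θ φ := by
  have h1 : ω 0 ^ 2 + ω 1 ^ 2 + ω 2 ^ 2 = 1 := by
    have := EuclideanSpace.real_norm_sq_eq ω
    rw [hω, Fin.sum_univ_three] at this
    linarith
  have hz : -1 ≤ ω 2 ∧ ω 2 ≤ 1 := abs_le.1 (by
    rw [← sq_le_one_iff_abs_le_one]; nlinarith [sq_nonneg (ω 0), sq_nonneg (ω 1)])
  set w : ℂ := ⟨ω 0, ω 1⟩ with hw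
  have hwn : ‖w‖ = Real.sin (Real.arccos (ω 2)) := by
    rw [Real.sin_arccos, Complex.norm_def, Complex.normSq_mk]
    congr 1; linarith
  set φ := toIocMod Real.two_pi_pos (φ₀ - Real.pi) w.arg with hφ
  have hmem := toIocMod_mem_Ioc Real.two_pi_pos (φ₀ - Real.pi) w.arg
  have harg : w.arg = φ + (toIocDiv Real.two_pi_pos (φ₀ - Real.pi) w.arg : ℤ) * (2 * Real.pi) := by
    have := toIocMod_add_toIocDiv_zsmul Real.two_pi_pos (φ₀ - Real.pi) w.arg
    rw [zsmul_eq_mul] at this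
    exact this.symm
  have hc : Real.cos w.arg = Real.cos φ := by rw [harg, Real.cos_add_int_mul_two_pi]
  have hs : Real.sin w.arg = Real.sin φ := by rw [harg, Real.sin_add_int_mul_two_pi]
  refine ⟨Real.arccos (ω 2), ⟨Real.arccos_nonneg _, Real.arccos_le_pi _⟩, φ,
    ⟨hmem.1.le, by linarith [hmem.2]⟩, ?_⟩
  ext k
  fin_cases k
  · change ω 0 = Real.sin (Real.arccos (ω 2)) * Real.cos φ
    rw [← hwn, ← hc, Complex.norm_mul_cos_arg]
  · change ω 1 = Real.sin (Real.arccos (ω 2)) * Real.sin φ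
    rw [← hwn, ← hs, Complex.norm_mul_sin_arg]
  · change ω 2 = Real.cos (Real.arccos (ω 2))
    rw [Real.cos_arccos hz.1 hz.2]

theorem abs_sin_half_le (x : ℝ) : |Real.sin (x / 2)| ≤ |x| / 2 := by
  have := Real.abs_sin_le_abs (x := x / 2)
  rwa [abs_div, abs_two] at this

theorem abs_le_pi_mul_abs_sin_half {x : ℝ} (hx : |x| ≤ Real.pi) :
    |x| ≤ Real.pi * |Real.sin (x / 2)| := by
  have h1 : |x / 2| ≤ Real.pi / 2 := by rw [abs_div, abs_two]; linarith
  have h2 := Real.mul_abs_le_abs_sin h1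
  rw [abs_div, abs_two] at h2
  have h3 := mul_le_mul_of_nonneg_left h2 Real.pi_pos.le
  have h4 : Real.pi * (2 / Real.pi * (|x| / 2)) = |x| := by
    field_simp
  linarith

theorem norm_sphPoint_sub_le_inclination (θ θ' φ : ℝ) :
    ‖sphPoint θ φ - sphPoint θ' φ‖ ≤ |θ - θ'| := by
  refine le_of_sq_le_sq ?_ (abs_nonneg _)
  rw [norm_sphPoint_sub_sq, sub_self, zero_div, Real.sin_zero]
  have h := pow_le_pow_left₀ (abs_nonneg _) (abs_sin_half_le (θ - θ')) 2
  rw [sq_abs] at h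
  nlinarith

theorem norm_sphPoint_sub_le_azimuth {θ : ℝ} (hθ : 0 ≤ Real.sin θ) (φ φ' : ℝ) :
    ‖sphPoint θ φ - sphPoint θ φ'‖ ≤ Real.sin θ * |φ - φ'| := by
  refine le_of_sq_le_sq ?_ (by positivity)
  rw [norm_sphPoint_sub_sq, sub_self, zero_div, Real.sin_zero]
  have h := pow_le_pow_left₀ (abs_nonneg _) (abs_sin_half_le (φ - φ')) 2
  rw [sq_abs] at h
  have h2 := mul_le_mul_of_nonneg_left h (mul_nonneg hθ hθ)
  nlinarith

namespace PatchSystem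

variable {P : PatchSystem} {K : ℝ}

theorem M_pos_of_fin (i : Fin P.m) : 0 < P.M := by
  have : 0 < P.m := Fin.pos i
  rw [M]; positivity

theorem IsPatchDecomposition.const_pos (hP : P.IsPatchDecomposition K) (i : Fin P.m) : 0 < K := by
  have h1 := (hP.inclination i).2.1
  have h2 := (hP.side_inclination i).2
  have h3 : 0 < P.M ^ (-(1 / 2) : ℝ) := Real.rpow_pos_of_pos (M_pos_of_fin i) _
  by_contra hK
  push Not at hK
  nlinarith

theorem norm_northCenter (i : Fin P.m) : ‖P.northCenter i‖ = 1 := by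
  rw [northCenter]; split_ifs <;> exact norm_sphPoint _ _

/-- Go to the mean azimuth along a circle of latitude, then to the mean inclination along a
meridian; each leg is at most half a sidelength. From the polar cap a meridian alone leads to the
centre. -/
theorem norm_sub_northCenter_le (hP : P.IsPatchDecomposition K) {i : Fin P.m}
    {ω : EuclideanSpace ℝ (Fin 3)} (hω : ω ∈ P.northRegion i) :
    ‖ω - P.northCenter i‖ ≤ K * P.M ^ (-(1 / 2) : ℝ) := by
  obtain ⟨θ, hθ, φ, hφ, rfl⟩ := hω
  obtain ⟨h1, h2, h3⟩ := hP.inclination i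
  have h4 := (hP.side_inclination i).2
  have h5 := (hP.side_azimuth i).2
  rw [northCenter]
  split_ifs with h0
  · have e : sphPoint 0 0 = sphPoint 0 φ := by ext k; fin_cases k <;> simp [sphPoint]
    rw [e]
    refine (norm_sphPoint_sub_le_inclination _ _ _).trans ?_
    rw [sub_zero, abs_of_nonneg (h1.trans hθ.1)]
    linarith [hθ.2]
  · have hs : 0 ≤ Real.sin θ :=
      Real.sin_nonneg_of_nonneg_of_le_pi (h1.trans hθ.1) (by linarith [hθ.2, Real.pi_pos])
    have hs2 : Real.sin θ ≤ Real.sin (P.θ₂ i) :=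
      Real.sin_le_sin_of_le_of_le_pi_div_two (by linarith [hθ.1, Real.pi_pos]) h3 hθ.2
    have e1 := norm_sphPoint_sub_le_azimuth hs φ ((P.φ₁ i + P.φ₂ i) / 2)
    have e2 := norm_sphPoint_sub_le_inclination θ ((P.θ₁ i + P.θ₂ i) / 2) ((P.φ₁ i + P.φ₂ i) / 2)
    have e3 : |φ - (P.φ₁ i + P.φ₂ i) / 2| ≤ (P.φ₂ i - P.φ₁ i) / 2 := by
      rw [abs_le]; constructor <;> linarith [hφ.1, hφ.2]
    have e4 : |θ - (P.θ₁ i + P.θ₂ i) / 2| ≤ (P.θ₂ i - P.θ₁ i) / 2 := by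
      rw [abs_le]; constructor <;> linarith [hθ.1, hθ.2]
    have e5 : Real.sin θ * |φ - (P.φ₁ i + P.φ₂ i) / 2|
        ≤ Real.sin (P.θ₂ i) * ((P.φ₂ i - P.φ₁ i) / 2) :=
      mul_le_mul hs2 e3 (abs_nonneg _) (hs.trans hs2)
    have e6 := norm_sub_le_norm_sub_add_norm_sub (sphPoint θ φ)
      (sphPoint θ ((P.φ₁ i + P.φ₂ i) / 2))
      (sphPoint ((P.θ₁ i + P.θ₂ i) / 2) ((P.φ₁ i + P.φ₂ i) / 2))
    linarith

/-- The chord first bounds the deviation in inclination, so θ and the mean inclination both exceed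
θ₂/4. By concavity both sines are then at least sin(θ₂)/4, and the chord also bounds sin(θ₂) times
the deviation in azimuth, uniformly up to the pole. -/
theorem mem_northRegion_of_norm_sub_le (hP : P.IsPatchDecomposition K) {i : Fin P.m}
    {ω : EuclideanSpace ℝ (Fin 3)} (hω : ‖ω‖ = 1)
    (h : ‖ω - P.northCenter i‖ ≤ K⁻¹ * P.M ^ (-(1 / 2) : ℝ) / 16) : ω ∈ P.northRegion i := by
  obtain ⟨h1, h2, h3⟩ := hP.inclination i
  have h4 := (hP.side_inclination i).1
  have h5 := (hP.side_azimuth i).1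
  have hπ := Real.pi_pos
  have hπ4 := Real.pi_lt_four
  set ν := K⁻¹ * P.M ^ (-(1 / 2) : ℝ) with hν
  have hν0 : 0 < ν := mul_pos (inv_pos.2 (hP.const_pos i)) (Real.rpow_pos_of_pos (M_pos_of_fin i) _)
  rw [northCenter] at h
  split_ifs at h with h0
  -- In the cap the azimuth is unrestricted; centring its window at φ₁ + π gives exactly [φ₁, φ₁ +
  -- 2π].
  · obtain ⟨θ, hθ, φ, hφ, rfl⟩ := exists_eq_sphPoint hω (P.φ₁ i + Real.pi)
    have hcap := hP.cap i h0
    refine ⟨θ, ⟨h0 ▸ hθ.1, ?_⟩, φ, ⟨by linarith [hφ.1], by linarith [hφ.2]⟩, rfl⟩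
    have e1 := pow_le_pow_left₀ (norm_nonneg _) h 2
    rw [norm_sphPoint_sub_sq, Real.sin_zero, sub_zero] at e1
    have e2 : |Real.sin (θ / 2)| ≤ ν / 32 := by
      refine le_of_sq_le_sq ?_ (by positivity)
      rw [sq_abs]; linarith
    have e3 := abs_le_pi_mul_abs_sin_half (x := θ) (by rw [abs_of_nonneg hθ.1]; exact hθ.2)
    rw [abs_of_nonneg hθ.1] at e3
    nlinarith [abs_nonneg (Real.sin (θ / 2))]
  · set θm := (P.θ₁ i + P.θ₂ i) / 2 with hθm
    set φm := (P.φ₁ i + P.φ₂ i) / 2 with hφm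
    obtain ⟨θ, hθ, φ, hφ, rfl⟩ := exists_eq_sphPoint hω φm
    have e1 := pow_le_pow_left₀ (norm_nonneg _) h 2
    rw [norm_sphPoint_sub_sq] at e1
    have hsθ : 0 ≤ Real.sin θ := Real.sin_nonneg_of_nonneg_of_le_pi hθ.1 hθ.2
    have hsm : 0 ≤ Real.sin θm := Real.sin_nonneg_of_nonneg_of_le_pi (by linarith) (by linarith)
    have e2 : |Real.sin ((θ - θm) / 2)| ≤ ν / 32 := by
      refine le_of_sq_le_sq ?_ (by positivity)
      rw [sq_abs]
      have : 0 ≤ 4 * (Real.sin θ * Real.sin θm) * Real.sin ((φ - φm) / 2) ^ 2 := by positivity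
      linarith
    have e3 := abs_le_pi_mul_abs_sin_half (x := θ - θm) (by
      rw [abs_le]; constructor <;> linarith [hθ.1, hθ.2])
    have e4 : |θ - θm| ≤ ν / 8 := by
      have := mul_le_mul hπ4.le e2 (abs_nonneg _) (by norm_num)
      linarith
    obtain ⟨e5, e6⟩ := abs_le.1 e4
    have hs2 : 0 ≤ Real.sin (P.θ₂ i) := Real.sin_nonneg_of_nonneg_of_le_pi (by linarith) (by linarith)
    have hquarter : Real.sin (P.θ₂ i) / 4 ≤ Real.sin (P.θ₂ i / 4) := by
      have hc := strictConcaveOn_sin_Icc.concaveOn.2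
        (show (0 : ℝ) ∈ Set.Icc 0 Real.pi from ⟨le_refl _, hπ.le⟩)
        (show P.θ₂ i ∈ Set.Icc 0 Real.pi from ⟨by linarith, by linarith⟩)
        (show (0 : ℝ) ≤ 3 / 4 by norm_num) (show (0 : ℝ) ≤ 1 / 4 by norm_num) (by norm_num)
      simp only [smul_eq_mul, mul_zero, zero_add, Real.sin_zero] at hc
      rw [show P.θ₂ i / 4 = 1 / 4 * P.θ₂ i by ring]
      linarith
    have hmono : ∀ x, P.θ₂ i / 4 ≤ x → x ≤ Real.pi / 2 → Real.sin (P.θ₂ i) / 4 ≤ Real.sin x :=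
      fun x hx hx' => hquarter.trans
        (Real.sin_le_sin_of_le_of_le_pi_div_two (by linarith) hx' hx)
    have e7 := hmono θ (by linarith) (by linarith)
    have e8 := hmono θm (by linarith) (by linarith)
    have e9 : Real.sin (P.θ₂ i) / 4 * |Real.sin ((φ - φm) / 2)| ≤ ν / 32 := by
      refine le_of_sq_le_sq ?_ (by positivity)
      rw [mul_pow, sq_abs]
      have g1 : (Real.sin (P.θ₂ i) / 4) ^ 2 ≤ Real.sin θ * Real.sin θm := by
        rw [sq]; exact mul_le_mul e7 e8 (by positivity) hsθ
      have g2 := mul_le_mul_of_nonneg_right g1 (sq_nonneg (Real.sin ((φ - φm) / 2)))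
      linarith [sq_nonneg (Real.sin ((θ - θm) / 2))]
    have e10 := abs_le_pi_mul_abs_sin_half (x := φ - φm) (by
      rw [abs_le]; constructor <;> linarith [hφ.1, hφ.2])
    have e11 : Real.sin (P.θ₂ i) * |φ - φm| ≤ Real.sin (P.θ₂ i) * ((P.φ₂ i - P.φ₁ i) / 2) := by
      have g1 := mul_le_mul_of_nonneg_left e10 hs2
      have g2 := mul_le_mul_of_nonneg_left e9 hπ.le
      have g3 := mul_le_mul_of_nonneg_right hπ4.le hν0.le
      linarith
    have hs2' : 0 < Real.sin (P.θ₂ i) :=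
      Real.sin_pos_of_pos_of_lt_pi (by linarith) (by linarith)
    obtain ⟨e12, e13⟩ := abs_le.1 (le_of_mul_le_mul_left e11 hs2')
    exact ⟨θ, ⟨by linarith, by linarith⟩, φ, ⟨by linarith, by linarith⟩, rfl⟩

theorem sign_smul_smul (σ : ℤˣ) (x : EuclideanSpace ℝ (Fin 3)) :
    ((σ : ℤ) : ℝ) • ((σ : ℤ) : ℝ) • x = x := by
  rcases Int.units_eq_one_or σ with rfl | rfl <;> simp

theorem norm_sign_smul (σ : ℤˣ) (x : EuclideanSpace ℝ (Fin 3)) : ‖((σ : ℤ) : ℝ) • x‖ = ‖x‖ := by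
  rcases Int.units_eq_one_or σ with rfl | rfl <;> simp

theorem norm_center (α : P.Patch) : ‖P.center α‖ = 1 := by
  rw [center, norm_sign_smul, norm_northCenter]

theorem norm_sign_smul_sub_northCenter (α : P.Patch) (ω : EuclideanSpace ℝ (Fin 3)) :
    ‖((α.2 : ℤ) : ℝ) • ω - P.northCenter α.1‖ = ‖ω - P.center α‖ := by
  rw [← norm_sign_smul α.2 (ω - P.center α), smul_sub, center, sign_smul_smul]

theorem norm_sub_center_le (hP : P.IsPatchDecomposition K) {α : P.Patch}
    {ω : EuclideanSpace ℝ (Fin 3)} (hω : ω ∈ P.region α) :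
    ‖ω - P.center α‖ ≤ K * P.M ^ (-(1 / 2) : ℝ) := by
  rw [← norm_sign_smul_sub_northCenter]
  exact norm_sub_northCenter_le hP hω

theorem mem_region_of_norm_sub_le (hP : P.IsPatchDecomposition K) {α : P.Patch}
    {ω : EuclideanSpace ℝ (Fin 3)} (hω : ‖ω‖ = 1)
    (h : ‖ω - P.center α‖ ≤ K⁻¹ * P.M ^ (-(1 / 2) : ℝ) / 16) : ω ∈ P.region α := by
  rw [← norm_sign_smul_sub_northCenter] at h
  exact mem_northRegion_of_norm_sub_le hP ((norm_sign_smul _ _).trans hω) h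

theorem norm_sub_smul_center_le (hP : P.IsPatchDecomposition K) {α : P.Patch}
    {x : EuclideanSpace ℝ (Fin 3)} (hx : x ∈ P.patch α) :
    ‖x - ‖x‖ • P.center α‖ ≤ K * P.M ^ (-(1 / 2) : ℝ) * ‖x‖ := by
  obtain ⟨-, -, ω, hω, hxω⟩ := hx
  have h : x - ‖x‖ • P.center α = ‖x‖ • (ω - P.center α) := by rw [smul_sub, ← hxω]
  rw [h, norm_smul, norm_norm, mul_comm]
  exact mul_le_mul_of_nonneg_right (norm_sub_center_le hP hω) (norm_nonneg _)

theorem mem_patch_of_norm_sub_le (hP : P.IsPatchDecomposition K) {α : P.Patch}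
    {x : EuclideanSpace ℝ (Fin 3)} (hkF : 0 < P.kF) (h1 : P.kF - P.R ≤ ‖x‖) (h2 : ‖x‖ ≤ P.kF + P.R)
    (hρ : K⁻¹ * P.M ^ (-(1 / 2) : ℝ) / 16 ≤ 1)
    (h : ‖x - P.kF • P.center α‖ ≤ K⁻¹ * P.M ^ (-(1 / 2) : ℝ) / 16 * P.kF / 4) : x ∈ P.patch α := by
  have hc := norm_center (P := P) α
  have e1 : |‖x‖ - P.kF| ≤ ‖x - P.kF • P.center α‖ := by
    have := abs_norm_sub_norm_le x (P.kF • P.center α)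
    rwa [norm_smul, hc, mul_one, Real.norm_eq_abs, abs_of_pos hkF] at this
  have e2 : P.kF / 2 ≤ ‖x‖ := by
    have := (abs_le.1 e1).1
    have := mul_le_mul_of_nonneg_right hρ hkF.le
    linarith
  have hx0 : 0 < ‖x‖ := by linarith
  refine ⟨h1, h2, ‖x‖⁻¹ • x, mem_region_of_norm_sub_le hP ?_ ?_, ?_⟩
  · rw [norm_smul, norm_inv, norm_norm, inv_mul_cancel₀ hx0.ne']
  · have e3 : ‖x‖⁻¹ • x - P.center α
        = ‖x‖⁻¹ • ((x - P.kF • P.center α) - (‖x‖ - P.kF) • P.center α) := by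
      rw [sub_smul, sub_sub_sub_cancel_right, smul_sub, smul_smul, inv_mul_cancel₀ hx0.ne', one_smul]
    have e4 := norm_sub_le (x - P.kF • P.center α) ((‖x‖ - P.kF) • P.center α)
    rw [norm_smul, hc, mul_one, Real.norm_eq_abs] at e4
    rw [e3, norm_smul, norm_inv, norm_norm, inv_mul_le_iff₀ hx0]
    have hν : 0 ≤ K⁻¹ * P.M ^ (-(1 / 2) : ℝ) / 16 := by
      have := (norm_nonneg _).trans h
      nlinarith
    have := mul_le_mul_of_nonneg_left e2 hν
    linarith
  · rw [smul_smul, mul_inv_cancel₀ hx0.ne', one_smul]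

end PatchSystem

end

noncomputable section

/-! ### The regime of many small patches -/

theorem card_latticeBall_le {r : ℝ} (hr : 1 ≤ r) : ((latticeBall r).card : ℝ) ≤ 27 * r ^ 3 := by
  classical
  have h1 : (latticeBall r).card ≤ (Fintype.piFinset fun _ : Fin 3 => Finset.Icc (-⌊r⌋) ⌊r⌋).card :=
    Finset.card_filter_le _ _
  have h0 : 0 ≤ ⌊r⌋ := Int.floor_nonneg.2 (by linarith)
  rw [Fintype.card_piFinset, Fin.prod_univ_three, Int.card_Icc] at h1
  have h2 : (((⌊r⌋ + 1 - -⌊r⌋).toNat : ℤ) : ℝ) = ((⌊r⌋ + 1 - -⌊r⌋ : ℤ) : ℝ) := by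
    rw [Int.toNat_of_nonneg (by omega)]
  rw [Int.cast_natCast] at h2
  have h3 : (((⌊r⌋ + 1 - -⌊r⌋).toNat : ℕ) : ℝ) ≤ 3 * r := by
    rw [h2]; push_cast; linarith [Int.floor_le r]
  calc ((latticeBall r).card : ℝ) ≤ ((⌊r⌋ + 1 - -⌊r⌋).toNat : ℝ) * (⌊r⌋ + 1 - -⌊r⌋).toNat
        * (⌊r⌋ + 1 - -⌊r⌋).toNat := by exact_mod_cast h1
    _ ≤ (3 * r) * (3 * r) * (3 * r) := by gcongr
    _ = 27 * r ^ 3 := by ring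

theorem le_card_latticeBall {r : ℝ} (hr : 2 ≤ r) : r ^ 3 / 8 ≤ ((latticeBall r).card : ℝ) := by
  classical
  have h0 : 0 ≤ ⌊r / 2⌋ := Int.floor_nonneg.2 (by linarith)
  have h1 : (Fintype.piFinset fun _ : Fin 3 => Finset.Icc (-⌊r / 2⌋) ⌊r / 2⌋).card
      ≤ (latticeBall r).card := by
    refine Finset.card_le_card fun p hp => ?_
    rw [Fintype.mem_piFinset] at hp
    rw [mem_latticeBall]
    refine le_of_sq_le_sq ?_ (by linarith)
    rw [EuclideanSpace.real_norm_sq_eq, Fin.sum_univ_three]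
    have h2 : ∀ i, Momentum.toVec p i ^ 2 ≤ (r / 2) ^ 2 := fun i => by
      have h3 := Finset.mem_Icc.1 (hp i)
      have h4 : (p i : ℝ) ≤ r / 2 := Int.le_floor.1 h3.2
      have h5 : -(r / 2) ≤ (p i : ℝ) := by
        have : ((-⌊r / 2⌋ : ℤ) : ℝ) ≤ p i := Int.cast_le.2 h3.1
        push_cast at this
        linarith [Int.floor_le (r / 2)]
      exact sq_le_sq' h5 h4
    nlinarith [h2 0, h2 1, h2 2]
  rw [Fintype.card_piFinset, Fin.prod_univ_three, Int.card_Icc] at h1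
  have h2 : (((⌊r / 2⌋ + 1 - -⌊r / 2⌋).toNat : ℤ) : ℝ) = ((⌊r / 2⌋ + 1 - -⌊r / 2⌋ : ℤ) : ℝ) := by
    rw [Int.toNat_of_nonneg (by omega)]
  rw [Int.cast_natCast] at h2
  have h3 : r / 2 ≤ (((⌊r / 2⌋ + 1 - -⌊r / 2⌋).toNat : ℕ) : ℝ) := by
    rw [h2]; push_cast; linarith [Int.lt_floor_add_one (r / 2)]
  have h4 : 0 ≤ r / 2 := by linarith
  calc r ^ 3 / 8 = (r / 2) * (r / 2) * (r / 2) := by ring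
    _ ≤ ((⌊r / 2⌋ + 1 - -⌊r / 2⌋).toNat : ℝ) * (⌊r / 2⌋ + 1 - -⌊r / 2⌋).toNat
        * (⌊r / 2⌋ + 1 - -⌊r / 2⌋).toNat := by gcongr
    _ ≤ ((latticeBall r).card : ℝ) := by exact_mod_cast h1

theorem one_le_norm_toVec {k : Momentum} (hk : k ≠ 0) : 1 ≤ ‖k.toVec‖ := by
  obtain ⟨i, hi⟩ := Function.ne_iff.1 hk
  have h1 := PiLp.norm_apply_le k.toVec i
  rw [Momentum.toVec_apply, Real.norm_eq_abs] at h1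
  have h2 : (1 : ℝ) ≤ |(k i : ℝ)| := by
    rw [← Int.cast_abs]; exact_mod_cast Int.one_le_abs hi
  linarith

namespace PatchSystem

variable {P : PatchSystem} {K : ℝ}

theorem ne_zero_of_mem_gammaNor {k : Momentum} (hk : k ∈ P.gammaNor) : k ≠ 0 := by
  rintro rfl
  simp [gammaNor] at hk

theorem norm_lt_of_mem_gammaNor {k : Momentum} (hk : k ∈ P.gammaNor) : ‖k.toVec‖ < P.R := by
  classical
  exact (Finset.mem_filter.1 hk).2.1

theorem one_le_norm_of_mem_gammaNor {k : Momentum} (hk : k ∈ P.gammaNor) : 1 ≤ ‖k.toVec‖ :=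
  one_le_norm_toVec (ne_zero_of_mem_gammaNor hk)

theorem neg_notMem_gammaNor {k : Momentum} (hk : k ∈ P.gammaNor) : -k ∉ P.gammaNor := by
  classical
  intro h
  have h1 := (Finset.mem_filter.1 hk).2.2
  have h2 := (Finset.mem_filter.1 h).2.2
  simp only [Pi.neg_apply] at h2
  omega

/-- The asymptotic regime of the patch decomposition: `M` is large, and the Fermi surface is large
compared with `M`, with `ε` measuring the ratio of consecutive scales. -/
structure IsRegime (P : PatchSystem) (δ ε : ℝ) : Prop where
  one_le_R : 1 ≤ P.R
  fermi_large : 2 ≤ P.kF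
  M_pos : 0 < P.M
  one_le_pow : 1 ≤ P.N ^ δ
  angle_le : P.R * P.N ^ δ * P.M ^ (-(1 / 2) : ℝ) ≤ ε
  transfer_le : P.R * P.N ^ δ ≤ ε * (P.kF * P.M ^ (-(1 / 2) : ℝ))
  sq_le : P.R ^ 2 * (P.N ^ δ) ^ 2 ≤ ε * P.kF

theorem N_bounds (h : 2 ≤ P.kF) : P.kF ^ 3 / 8 ≤ P.N ∧ P.N ≤ 27 * P.kF ^ 3 :=
  ⟨le_card_latticeBall h, card_latticeBall_le (by linarith)⟩

theorem cube_root_N_bounds (h : 2 ≤ P.kF) :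
    P.kF / 2 ≤ P.N ^ (1 / 3 : ℝ) ∧ P.N ^ (1 / 3 : ℝ) ≤ 3 * P.kF := by
  obtain ⟨h1, h2⟩ := N_bounds h
  have hk : 0 ≤ P.kF := by linarith
  have e : ∀ x : ℝ, 0 ≤ x → (x ^ 3) ^ (1 / 3 : ℝ) = x := fun x hx => by
    rw [← Real.rpow_natCast, ← Real.rpow_mul hx]; norm_num
  constructor
  · rw [← e (P.kF / 2) (by positivity)]
    exact Real.rpow_le_rpow (by positivity) (by linarith [show (P.kF / 2) ^ 3 = P.kF ^ 3 / 8 by ring])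
      (by norm_num)
  · rw [← e (3 * P.kF) (by positivity)]
    refine Real.rpow_le_rpow (le_trans (by positivity) h1) ?_ (by norm_num)
    linarith [show (3 * P.kF) ^ 3 = 27 * P.kF ^ 3 by ring]

theorem one_le_N (h : 2 ≤ P.kF) : 1 ≤ P.N := by
  have h1 := (N_bounds h).1
  have : (2 : ℝ) ^ 3 ≤ P.kF ^ 3 := pow_le_pow_left₀ (by norm_num) h 3
  linarith

theorem rpow_neg_half_sq {x : ℝ} (hx : 0 < x) : (x ^ (-(1 / 2) : ℝ)) ^ 2 * x = 1 := by
  rw [← Real.rpow_natCast, ← Real.rpow_mul hx.le]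
  norm_num
  rw [Real.rpow_neg_one, inv_mul_cancel₀ hx.ne']

/-- The momentum `ℓ` only serves to force R ≥ 1, being a nonzero lattice vector shorter than R. The
three ratios are compared after squaring; `sq_le` multiplies the two hypotheses, which eliminates M.
The 9 comes from N^{1/3} ≤ 3k_F. -/
theorem isRegime_of_le {δ ε η : ℝ} (hδ : 0 < δ) (hε : 0 < ε) (hε1 : ε ≤ 1) (hη : 0 < η)
    (hηε : 9 * η ≤ ε ^ 2) (hk : η⁻¹ ≤ P.kF) (h1 : P.R ^ 2 * P.N ^ (2 * δ) ≤ η * P.M)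
    (h2 : P.M ≤ η * (P.N ^ (2 / 3 - 2 * δ) / P.R ^ 4)) {ℓ : Momentum} (hℓ : ℓ ∈ P.gammaNor) :
    P.IsRegime δ ε := by
  have hR : 1 ≤ P.R := (one_le_norm_of_mem_gammaNor hℓ).trans (norm_lt_of_mem_gammaNor hℓ).le
  have hε2 : ε ^ 2 ≤ ε := by rw [sq]; exact mul_le_of_le_one_left hε.le hε1
  have hη1 : η ≤ 1 / 2 := by linarith
  have hkF : 2 ≤ P.kF := by
    have : 2 ≤ η⁻¹ := by rw [le_inv_comm₀ (by norm_num) hη]; linarith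
    linarith
  have hN := one_le_N hkF
  have hN0 : 0 < P.N := by linarith
  set u := P.N ^ δ with hu
  have hu1 : 1 ≤ u := Real.one_le_rpow hN hδ.le
  have e1 : P.N ^ (2 * δ) = u ^ 2 := by
    rw [hu, ← Real.rpow_natCast, ← Real.rpow_mul hN0.le]; congr 1; push_cast; ring
  rw [e1] at h1
  have hM : 0 < P.M := by
    have : 1 ≤ P.R ^ 2 * u ^ 2 := one_le_mul_of_one_le_of_one_le (one_le_pow₀ hR) (one_le_pow₀ hu1)
    by_contra hc
    push Not at hc
    nlinarith
  set μ := P.M ^ (-(1 / 2) : ℝ) with hμ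
  have hμ0 : 0 < μ := Real.rpow_pos_of_pos hM _
  have hμM : μ ^ 2 * P.M = 1 := rpow_neg_half_sq hM
  obtain ⟨-, hν2⟩ := cube_root_N_bounds hkF
  set ν := P.N ^ (1 / 3 : ℝ) with hν
  have hν0 : 0 < ν := Real.rpow_pos_of_pos hN0 _
  have e2 : P.N ^ (2 / 3 - 2 * δ) = ν ^ 2 / u ^ 2 := by
    have e3 : P.N ^ (2 / 3 : ℝ) = ν ^ 2 := by
      rw [hν, ← Real.rpow_natCast, ← Real.rpow_mul hN0.le]; norm_num
    rw [Real.rpow_sub hN0, e1, e3]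
  have h3 : P.M * (P.R ^ 4 * u ^ 2) ≤ η * ν ^ 2 := by
    rw [e2] at h2
    have := mul_le_mul_of_nonneg_right h2 (show 0 ≤ P.R ^ 4 * u ^ 2 by positivity)
    refine this.trans_eq ?_
    field_simp
  have h4 : P.M * (P.R ^ 4 * u ^ 2) ≤ η * (9 * P.kF ^ 2) := by
    refine h3.trans (mul_le_mul_of_nonneg_left ?_ hη.le)
    have := pow_le_pow_left₀ hν0.le hν2 2
    linarith [show (3 * P.kF) ^ 2 = 9 * P.kF ^ 2 by ring]
  have h5 : P.R ^ 2 * u ^ 2 ≤ P.R ^ 4 * u ^ 2 :=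
    mul_le_mul_of_nonneg_right (pow_le_pow_right₀ hR (by norm_num)) (sq_nonneg _)
  refine ⟨hR, hkF, hM, hu1, ?_, ?_, ?_⟩
  · refine le_of_sq_le_sq ?_ hε.le
    have := mul_le_mul_of_nonneg_right h1 (sq_nonneg μ)
    have e3 : η * P.M * μ ^ 2 = η := by linear_combination η * hμM
    rw [e3] at this
    calc (P.R * u * μ) ^ 2 = P.R ^ 2 * u ^ 2 * μ ^ 2 := by ring
      _ ≤ ε ^ 2 := by linarith [sq_nonneg ε]
  · refine le_of_sq_le_sq ?_ (by positivity)
    have h6 := mul_le_mul_of_nonneg_right h4 (sq_nonneg μ)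
    have e3 : P.M * (P.R ^ 4 * u ^ 2) * μ ^ 2 = P.R ^ 4 * u ^ 2 := by
      linear_combination (P.R ^ 4 * u ^ 2) * hμM
    have h7 := mul_le_mul_of_nonneg_right hηε (show 0 ≤ P.kF ^ 2 * μ ^ 2 by positivity)
    calc (P.R * u) ^ 2 = P.R ^ 2 * u ^ 2 := by ring
      _ ≤ (ε * (P.kF * μ)) ^ 2 := by
        rw [show (ε * (P.kF * μ)) ^ 2 = ε ^ 2 * (P.kF ^ 2 * μ ^ 2) by ring]
        linarith
  · refine le_of_sq_le_sq ?_ (by positivity)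
    have h6 := mul_le_mul_of_nonneg_left h1 (show 0 ≤ P.R ^ 2 * u ^ 2 by positivity)
    have h7 := mul_le_mul_of_nonneg_left h5 (show 0 ≤ η * P.M by positivity)
    have h8 := mul_le_mul_of_nonneg_left h4 hη.le
    have h9 : 9 * η ^ 2 ≤ ε ^ 2 := by nlinarith
    have h10 := mul_le_mul_of_nonneg_right h9 (sq_nonneg P.kF)
    calc (P.R ^ 2 * u ^ 2) ^ 2 = P.R ^ 2 * u ^ 2 * (P.R ^ 2 * u ^ 2) := by ring
      _ ≤ (ε * P.kF) ^ 2 := by rw [mul_pow]; linarith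

/-- The constant `c` is K for the circumscribed size of a patch (upper count) and K⁻¹/16 for the
inscribed size (lower count). -/
theorem IsRegime.pairScales {δ ε c s : ℝ} (h : P.IsRegime δ ε) (hN : 0 < P.N) (hc : 0 < c)
    (hε : 1000 * ε ≤ 1) (hε1 : 1000 * (c * ε) ≤ 1) (hε2 : 1000 * ε ≤ c) (hs : P.N ^ (-δ) ≤ s) :
    PairScales P.kF P.R (c * P.M ^ (-(1 / 2) : ℝ)) s := by
  obtain ⟨h1, h2, h3, h4, h5, h6, h7⟩ := h
  rw [Real.rpow_neg hN.le] at hs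
  set u := P.N ^ δ
  set μ := P.M ^ (-(1 / 2) : ℝ) with hμ
  have hμ0 : 0 < μ := Real.rpow_pos_of_pos h3 _
  have hu0 : 0 < u := by linarith
  have hs0 : 0 < s := lt_of_lt_of_le (inv_pos.2 hu0) hs
  have hus : 1 ≤ u * s := by
    have := mul_le_mul_of_nonneg_left hs hu0.le
    rwa [mul_inv_cancel₀ hu0.ne'] at this
  have hRμ : P.R * μ ≤ P.R * u * μ := by
    rw [mul_assoc]
    exact mul_le_mul_of_nonneg_left (le_mul_of_one_le_left hμ0.le h4) (by linarith)
  have hRu : P.R ≤ P.R * u := le_mul_of_one_le_right (by linarith) h4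
  have hkμ : 0 ≤ P.kF * μ := mul_nonneg (by linarith) hμ0.le
  have htr : 1000 * (P.R * u) ≤ P.kF * (c * μ) := by
    have := mul_le_mul_of_nonneg_right hε2 hkμ
    linarith
  refine ⟨h1, hs0, by positivity, ?_, ?_, ?_, by linarith, ?_⟩
  · have a1 : μ ≤ P.R * μ := le_mul_of_one_le_left hμ0.le h1
    have := mul_le_mul_of_nonneg_left ((a1.trans hRμ).trans h5) hc.le
    linarith
  · have a1 := mul_le_mul_of_nonneg_left h5 (show 0 ≤ 1000 * c by positivity)
    have a2 : 1000 * (P.R * (c * μ)) * u ≤ 1 := by linarith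
    have a3 : 1000 * (P.R * (c * μ)) * u ≤ s * u := by linarith
    exact le_of_mul_le_mul_right a3 hu0
  · have a1 := mul_le_mul_of_nonneg_right htr hs0.le
    have a2 := mul_le_mul_of_nonneg_left hus (show 0 ≤ 1000 * P.R by linarith)
    linarith
  · have a1 : P.R ^ 2 ≤ P.R ^ 2 * (u * s) ^ 2 :=
      le_mul_of_one_le_right (sq_nonneg _) (one_le_pow₀ hus)
    have a2 := mul_le_mul_of_nonneg_right h7 (sq_nonneg s)
    have a3 := mul_le_mul_of_nonneg_right hε (show 0 ≤ P.kF * s ^ 2 by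
      have : 0 ≤ P.kF := by linarith
      positivity)
    calc 1000 * P.R ^ 2 ≤ 1000 * (P.R ^ 2 * (u * s) ^ 2) := by linarith
      _ = 1000 * (P.R ^ 2 * u ^ 2 * s ^ 2) := by ring
      _ ≤ P.kF * s ^ 2 := by linarith

theorem mem_pairs {α : P.Patch} {κ p : Momentum} : p ∈ P.pairs α κ ↔ p ∈ latticeBall (P.kF + P.R) ∧
    (p ∉ latticeBall P.kF ∧ p.toVec ∈ P.patch α) ∧
      (p - κ ∈ latticeBall P.kF ∧ (p - κ).toVec ∈ P.patch α) := by
  classical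
  exact Finset.mem_filter

theorem lt_norm_of_mem_pairs {α : P.Patch} {κ p : Momentum} (hp : p ∈ P.pairs α κ) :
    P.kF < ‖p.toVec‖ := by
  have := (mem_pairs.1 hp).2.1.1
  rwa [mem_latticeBall, not_le] at this

theorem norm_sub_le_of_mem_pairs {α : P.Patch} {κ p : Momentum} (hp : p ∈ P.pairs α κ) :
    ‖(p - κ).toVec‖ ≤ P.kF :=
  (mem_latticeBall _ _).1 (mem_pairs.1 hp).2.2.1

/-! ### Pair counts and the gap for the pairs of a patch. -/

section Pairs

variable {δ ε : ℝ} {α : P.Patch} {κ : Momentum}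

theorem card_pairs_patch_le (hP : P.IsPatchDecomposition K) (h : P.IsRegime δ ε)
    (hε : 1000 * ε ≤ 1) (hε1 : 1000 * (K * ε) ≤ 1) (hε2 : 1000 * ε ≤ K) (hκ : ‖κ.toVec‖ ≤ P.R)
    (hs : P.N ^ (-δ) ≤ P.slope κ α) :
    ((P.pairs α κ).card : ℝ)
      ≤ 14000 * ((P.kF * (K * P.M ^ (-(1 / 2) : ℝ))) ^ 2 * P.slope κ α) :=
  card_pairs_le (h.pairScales (lt_of_lt_of_le one_pos (one_le_N h.fermi_large))
      (hP.const_pos α.1) hε hε1 hε2 hs) (norm_center α) hκ rfl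
    (fun _ hp => lt_norm_of_mem_pairs hp) (fun _ hp => norm_sub_le_of_mem_pairs hp)
    fun _ hp => norm_sub_smul_center_le hP (mem_pairs.1 hp).2.1.2

theorem le_card_pairs_patch (hP : P.IsPatchDecomposition K) (h : P.IsRegime δ ε)
    (hε : 1000 * ε ≤ 1) (hε1 : 1000 * (K⁻¹ / 16 * ε) ≤ 1) (hε2 : 1000 * ε ≤ K⁻¹ / 16)
    (hκ : ‖κ.toVec‖ ≤ P.R) (hs : P.N ^ (-δ) ≤ P.slope κ α) :
    (P.kF * (K⁻¹ / 16 * P.M ^ (-(1 / 2) : ℝ))) ^ 2 * P.slope κ α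
      ≤ 320000 * ((P.pairs α κ).card : ℝ) := by
  have hsc := h.pairScales (lt_of_lt_of_le one_pos (one_le_N h.fermi_large))
    (div_pos (inv_pos.2 (hP.const_pos α.1)) (by norm_num)) hε hε1 hε2 hs
  have hkF : 0 < P.kF := by linarith [h.fermi_large]
  have hR := h.one_le_R
  have e : K⁻¹ / 16 * P.M ^ (-(1 / 2) : ℝ) = K⁻¹ * P.M ^ (-(1 / 2) : ℝ) / 16 := by ring
  refine le_card_pairs hsc (norm_center α) hκ rfl fun p h1 h2 h3 h4 => ?_
  have h5 : ‖p.toVec‖ ≤ ‖(p - κ).toVec‖ + ‖κ.toVec‖ := by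
    rw [Momentum.toVec_sub]; exact norm_le_norm_sub_add _ _
  have hρ := hsc.angle_le
  have hρ0 := hsc.angle_pos
  rw [e] at h3 h4 hρ hρ0
  have h6 : ‖p.toVec‖ ≤ P.kF + P.R := by linarith
  refine mem_pairs.2 ⟨(mem_latticeBall _ _).2 h6, ⟨?_, ?_⟩, (mem_latticeBall _ _).2 h2, ?_⟩
  · rw [mem_latticeBall, not_le]; exact h1
  · exact mem_patch_of_norm_sub_le hP hkF (by linarith) h6 (by linarith) h3
  · exact mem_patch_of_norm_sub_le hP hkF (by linarith) (by linarith) (by linarith) h4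

/-- A pair satisfies ‖p‖² - ‖p - κ‖² = 2p·κ - ‖κ‖², which is at least 2‖p‖N^{-δ} up to small errors.
If both modes were within q N^{-δ} of the sphere, it would be at most 4q‖p‖N^{-δ}, contradicting q <
1/2. -/
theorem gap_of_mem_pairs (hP : P.IsPatchDecomposition K) (h : P.IsRegime δ ε) {q : ℝ}
    (hε1 : K * ε + ε < 1 - 2 * q) (hκ : ‖κ.toVec‖ ≤ P.R)
    (hs : P.N ^ (-δ) ≤ P.slope κ α) {p : Momentum} (hp : p ∈ P.pairs α κ) :
    q * P.N ^ (-δ) < |‖p.toVec‖ - P.kF| ∨ q * P.N ^ (-δ) < |‖(p - κ).toVec‖ - P.kF| := by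
  have hN : 0 < P.N := lt_of_lt_of_le one_pos (one_le_N h.fermi_large)
  obtain ⟨h1, h2, h3, h4, h5, -, h7⟩ := h
  have hK := hP.const_pos α.1
  have e1 := lt_norm_of_mem_pairs hp
  have e2 := norm_sub_le_of_mem_pairs hp
  have e3 := le_inner_of_norm_sub_le hκ (norm_sub_smul_center_le hP (mem_pairs.1 hp).2.1.2)
  change ‖p.toVec‖ * P.slope κ α - _ ≤ _ at e3
  have e4 : ‖(p - κ).toVec‖ ^ 2 = ‖p.toVec‖ ^ 2 - 2 * inner ℝ p.toVec κ.toVec + ‖κ.toVec‖ ^ 2 := by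
    rw [Momentum.toVec_sub, norm_sub_sq_real]
  by_contra! hc
  have c1 := (abs_le.1 hc.1).2
  have c2 := (abs_le.1 hc.2).1
  rw [Real.rpow_neg hN.le] at hs c1 c2
  set u := P.N ^ δ
  set μ := P.M ^ (-(1 / 2) : ℝ)
  set x := ‖p.toVec‖
  set y := ‖(p - κ).toVec‖
  have hy : 0 ≤ y := norm_nonneg _
  have hu : 0 < u := by linarith
  have hRu : P.R * μ ≤ ε * u⁻¹ := by
    rw [← div_eq_mul_inv, le_div_iff₀ hu]; linarith
  have hR2 : P.R ^ 2 ≤ ε * P.kF * u⁻¹ := by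
    rw [← div_eq_mul_inv, le_div_iff₀ hu]
    refine le_trans (mul_le_mul_of_nonneg_left ?_ (sq_nonneg _)) h7
    rw [sq]; exact le_mul_of_one_le_left hu.le h4
  have d1 : x ^ 2 - y ^ 2 ≤ 2 * q * u⁻¹ * (2 * x) := by
    have g1 : x - y ≤ 2 * q * u⁻¹ := by linarith
    have g2 : x ^ 2 - y ^ 2 = (x - y) * (x + y) := by ring
    rw [g2]
    exact mul_le_mul g1 (by linarith) (by linarith) (by linarith)
  have d2 : 2 * (x * u⁻¹) * (1 - K * ε) - ε * P.kF * u⁻¹ ≤ x ^ 2 - y ^ 2 := by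
    have g1 := mul_le_mul_of_nonneg_left hs (show 0 ≤ x by linarith)
    have g2 := mul_le_mul_of_nonneg_left hRu (show 0 ≤ 2 * (K * x) by
      have : 0 ≤ x := by linarith
      positivity)
    have g3 := pow_le_pow_left₀ (norm_nonneg _) hκ 2
    linarith
  have hui : 0 < u⁻¹ := inv_pos.2 hu
  have hε0 : 0 ≤ ε * u⁻¹ := by
    have : 0 ≤ P.R * μ := mul_nonneg (by linarith) (Real.rpow_nonneg h3.le _)
    linarith
  have d3 : ε * u⁻¹ * P.kF ≤ ε * u⁻¹ * x := mul_le_mul_of_nonneg_left e1.le hε0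
  have hxu : 0 < x * u⁻¹ := mul_pos (by linarith) hui
  have d4 := mul_lt_mul_of_pos_left hε1 hxu
  nlinarith

end Pairs

end PatchSystem

end

noncomputable section

/-! ### The kernel in block form -/

namespace PatchSystem

open scoped Matrix

variable {P : PatchSystem} {δ : ℝ} {k : Momentum}

theorem mirror_mirror (α : P.Patch) : P.mirror (P.mirror α) = α := by
  simp [mirror]

theorem neg_mem_patch_mirror {α : P.Patch} {x : EuclideanSpace ℝ (Fin 3)} (hx : x ∈ P.patch α) :
    -x ∈ P.patch (P.mirror α) := by
  obtain ⟨h1, h2, ω, hω, hxω⟩ := hx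
  refine ⟨by rwa [norm_neg], by rwa [norm_neg], -ω, ?_, by rw [norm_neg, smul_neg, ← hxω]⟩
  change _ ∈ P.northRegion α.1
  change _ ∈ P.northRegion α.1 at hω
  simpa [mirror] using hω

theorem neg_mem_pairs_mirror {α : P.Patch} {p : Momentum} (hp : p ∈ P.pairs α (-k)) :
    -p ∈ P.pairs (P.mirror α) k := by
  rw [mem_pairs] at hp ⊢
  have e : -p - k = -(p - -k) := by abel
  have hb : ∀ (q : Momentum) (r : ℝ), -q ∈ latticeBall r ↔ q ∈ latticeBall r := fun q r => by
    rw [mem_latticeBall, mem_latticeBall, Momentum.toVec_neg, norm_neg]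
  rw [e, hb, hb, hb, Momentum.toVec_neg, Momentum.toVec_neg]
  exact ⟨hp.1, ⟨hp.2.1.1, neg_mem_patch_mirror hp.2.1.2⟩, hp.2.2.1, neg_mem_patch_mirror hp.2.2.2⟩

theorem card_pairs_mirror_le (α : P.Patch) (k : Momentum) :
    (P.pairs α (-k)).card ≤ (P.pairs (P.mirror α) k).card :=
  Finset.card_le_card_of_injOn (fun p => -p) (fun _ hp => neg_mem_pairs_mirror hp)
    neg_injective.injOn

theorem pairNorm_mirror (α : P.Patch) (k : Momentum) :
    P.pairNorm (P.mirror α) k = P.pairNorm α (-k) := by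
  rw [pairNorm, pairNorm]
  congr 2
  refine le_antisymm ?_ (card_pairs_mirror_le α k)
  have := card_pairs_mirror_le (P.mirror α) (-k)
  rwa [neg_neg, mirror_mirror] at this

theorem not_inMinus_of_inPlus (hN : 0 < P.N) {α : P.Patch} (h : P.InPlus δ k α) :
    ¬ P.InMinus δ k α := by
  rw [InPlus] at h
  rw [InMinus]
  have := Real.rpow_pos_of_pos hN (-δ)
  linarith

theorem inMinus_mirror {α : P.Patch} (h : P.InPlus δ k α) : P.InMinus δ k (P.mirror α) := by
  rw [InMinus, slope_mirror]
  exact neg_le_neg h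

theorem not_inPlus_mirror (hN : 0 < P.N) {α : P.Patch} (h : P.InPlus δ k α) :
    ¬ P.InPlus δ k (P.mirror α) := fun h' => not_inMinus_of_inPlus hN h' (inMinus_mirror h)

theorem toBlocks_of_inPlus {α : P.I δ k} (h : P.InPlus δ k α.1) :
    P.toBlocks δ k α = Sum.inl ⟨α.1, h⟩ := by
  rw [toBlocks, dif_pos h]

theorem toBlocks_of_not_inPlus {α : P.I δ k} (h : ¬ P.InPlus δ k α.1) :
    ∃ h', P.toBlocks δ k α = Sum.inr ⟨P.mirror α.1, h'⟩ := by
  rw [toBlocks, dif_neg h]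
  exact ⟨_, rfl⟩

/-- Positivity of `P.N` makes the threshold for the slope positive, so the two index sets are
disjoint and the reflection exchanges them. -/
theorem toBlocks_bijective (hN : 0 < P.N) : Function.Bijective (P.toBlocks δ k) := by
  constructor
  · intro α β hαβ
    by_cases hα : P.InPlus δ k α.1 <;> by_cases hβ : P.InPlus δ k β.1
    · rw [toBlocks_of_inPlus hα, toBlocks_of_inPlus hβ] at hαβ
      have := Subtype.ext_iff.1 (Sum.inl_injective hαβ)
      exact Subtype.ext this
    · obtain ⟨h', e⟩ := toBlocks_of_not_inPlus hβ
      rw [toBlocks_of_inPlus hα, e] at hαβ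
      exact absurd hαβ Sum.inl_ne_inr
    · obtain ⟨h', e⟩ := toBlocks_of_not_inPlus hα
      rw [toBlocks_of_inPlus hβ, e] at hαβ
      exact absurd hαβ Sum.inr_ne_inl
    · obtain ⟨h', e⟩ := toBlocks_of_not_inPlus hα
      obtain ⟨h'', e'⟩ := toBlocks_of_not_inPlus hβ
      rw [e, e'] at hαβ
      have := Subtype.ext_iff.1 (Sum.inr_injective hαβ)
      refine Subtype.ext ?_
      rw [← mirror_mirror α.1, ← mirror_mirror β.1]
      exact congrArg P.mirror this
  · rintro (i | i)
    · exact ⟨P.incl δ k i, toBlocks_of_inPlus (α := P.incl δ k i) i.2⟩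
    · obtain ⟨h', e⟩ := toBlocks_of_not_inPlus (α := (⟨P.mirror i.1, Or.inr (inMinus_mirror i.2)⟩ :
        P.I δ k)) (not_inPlus_mirror hN i.2)
      refine ⟨_, e.trans (congrArg Sum.inr (Subtype.ext ?_))⟩
      exact mirror_mirror _

/-- The momentum transfer of the pairs of the patch `α`. -/
def signed (P : PatchSystem) (δ : ℝ) (k : Momentum) (α : P.Patch) : Momentum :=
  open scoped Classical in
  if P.InPlus δ k α then k else -k

theorem nPair_eq (α : P.Patch) : P.nPair δ k α = P.pairNorm α (P.signed δ k α) := by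
  rw [nPair, signed]; split_ifs <;> rfl

theorem cStar_eq (α : P.Patch) : P.cStar δ k α = P.bStar α (P.signed δ k α) := by
  rw [cStar, signed]; split_ifs <;> rfl

theorem norm_signed (α : P.Patch) : ‖(P.signed δ k α).toVec‖ = ‖k.toVec‖ := by
  rw [signed]; split_ifs
  · rfl
  · rw [Momentum.toVec_neg, norm_neg]

theorem slope_neg (α : P.Patch) : P.slope (-k) α = -P.slope k α := by
  rw [slope, Momentum.toVec_neg, inner_neg_left]; rfl

theorem le_slope_signed (α : P.I δ k) : P.N ^ (-δ) ≤ P.slope (P.signed δ k α.1) α.1 := by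
  rw [signed]; split_ifs with h
  · exact h
  · have h1 : P.slope k α.1 ≤ -P.N ^ (-δ) := α.2.resolve_left h
    rw [slope_neg]; linarith

theorem nPair_of_inPlus {α : P.Patch} (h : P.InPlus δ k α) : P.nPair δ k α = P.pairNorm α k := by
  rw [nPair, if_pos h]

theorem nPair_mirror {α : P.Patch} (h : ¬ P.InPlus δ k α) (h' : P.InPlus δ k (P.mirror α)) :
    P.nPair δ k (P.mirror α) = P.nPair δ k α := by
  rw [nPair, nPair, if_pos h', if_neg h, pairNorm_mirror]

variable {Vhat : Momentum → ℝ}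

theorem blockd_eq : P.blockd δ k = Matrix.diagonal fun i => |P.slope k i.1| / ‖k.toVec‖ := by
  ext i j
  rw [blockd, Matrix.submatrix_apply, matD, Matrix.diagonal_apply, Matrix.diagonal_apply]
  by_cases h : i = j
  · rw [if_pos (congrArg _ h), if_pos h]; rfl
  · rw [if_neg h, if_neg]
    intro h'
    have := Subtype.ext_iff.1 h'
    exact h (Subtype.ext this)

theorem blockb_eq : P.blockb δ Vhat k = P.coupling Vhat k •
    Matrix.vecMulVec (fun i : P.IPlus δ k => P.nPair δ k i.1) (fun i => P.nPair δ k i.1) := by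
  ext i j
  rw [blockb, Matrix.submatrix_apply, matW, if_pos ⟨fun _ => j.2, fun _ => i.2⟩]
  rfl

theorem matD_apply_blocks (α β : P.I δ k) :
    P.matD δ k α β = Matrix.fromBlocks (P.blockd δ k) 0 0 (P.blockd δ k)
      (P.toBlocks δ k α) (P.toBlocks δ k β) := by
  rw [matD, Matrix.diagonal_apply]
  by_cases hα : P.InPlus δ k α.1 <;> by_cases hβ : P.InPlus δ k β.1
  · rw [toBlocks_of_inPlus hα, toBlocks_of_inPlus hβ, Matrix.fromBlocks_apply₁₁, blockd_eq,
      Matrix.diagonal_apply]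
    simp only [Subtype.ext_iff]
  · obtain ⟨h', e⟩ := toBlocks_of_not_inPlus hβ
    rw [toBlocks_of_inPlus hα, e, Matrix.fromBlocks_apply₁₂, if_neg, Matrix.zero_apply]
    rintro rfl; exact hβ hα
  · obtain ⟨h', e⟩ := toBlocks_of_not_inPlus hα
    rw [toBlocks_of_inPlus hβ, e, Matrix.fromBlocks_apply₂₁, if_neg, Matrix.zero_apply]
    rintro rfl; exact hα hβ
  · obtain ⟨h', e⟩ := toBlocks_of_not_inPlus hα
    obtain ⟨h'', e'⟩ := toBlocks_of_not_inPlus hβ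
    rw [e, e', Matrix.fromBlocks_apply₂₂, blockd_eq, Matrix.diagonal_apply]
    have hi : Function.Injective P.mirror := Function.LeftInverse.injective mirror_mirror
    simp only [hi.eq_iff, Subtype.ext_iff, slope_mirror, abs_neg]

/-- The parameter `s` takes the values 1 and -1, giving both combinations that occur in `matE`. -/
theorem matW_sub_matWt_apply_blocks (s : ℝ) (α β : P.I δ k) :
    P.matW δ Vhat k α β + s * P.matWt δ Vhat k α β
      = Matrix.fromBlocks (P.blockb δ Vhat k) (s • P.blockb δ Vhat k) (s • P.blockb δ Vhat k)
        (P.blockb δ Vhat k) (P.toBlocks δ k α) (P.toBlocks δ k β) := by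
  rw [blockb_eq, matW, matWt]
  by_cases hα : P.InPlus δ k α.1 <;> by_cases hβ : P.InPlus δ k β.1
  · rw [toBlocks_of_inPlus hα, toBlocks_of_inPlus hβ, Matrix.fromBlocks_apply₁₁]
    simp [hα, hβ, Matrix.vecMulVec_apply]
  · obtain ⟨h', e⟩ := toBlocks_of_not_inPlus hβ
    rw [toBlocks_of_inPlus hα, e, Matrix.fromBlocks_apply₁₂]
    simp [hα, hβ, Matrix.vecMulVec_apply, nPair_mirror hβ h']
  · obtain ⟨h', e⟩ := toBlocks_of_not_inPlus hα
    rw [toBlocks_of_inPlus hβ, e, Matrix.fromBlocks_apply₂₁]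
    simp [hα, hβ, Matrix.vecMulVec_apply, nPair_mirror hα h']
  · obtain ⟨h', e⟩ := toBlocks_of_not_inPlus hα
    obtain ⟨h'', e'⟩ := toBlocks_of_not_inPlus hβ
    rw [e, e', Matrix.fromBlocks_apply₂₂]
    simp [hα, hβ, Matrix.vecMulVec_apply, nPair_mirror hα h', nPair_mirror hβ h'']

/-- On even vectors the two couplings cancel, on odd vectors they add up. For the sum of the
couplings the two blocks are exchanged. -/
theorem matD_add_matW_sub_matWt :
    P.matD δ k + P.matW δ Vhat k - P.matWt δ Vhat k
      = blockConj (P.toBlocks δ k) (P.blockd δ k) (P.blockd δ k + (2 : ℝ) • P.blockb δ Vhat k) := by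
  ext α β
  have h1 := matD_apply_blocks α β
  have h2 := matW_sub_matWt_apply_blocks (Vhat := Vhat) (-1) α β
  rw [blockConj_eq, Matrix.sub_apply, Matrix.add_apply, Matrix.submatrix_apply]
  have h3 : P.matD δ k α β + P.matW δ Vhat k α β - P.matWt δ Vhat k α β
      = P.matD δ k α β + (P.matW δ Vhat k α β + -1 * P.matWt δ Vhat k α β) := by ring
  rw [h3, h1, h2]
  rcases P.toBlocks δ k α with i | i <;> rcases P.toBlocks δ k β with j | j <;> simp <;> ring

theorem matD_add_matW_add_matWt :
    P.matD δ k + P.matW δ Vhat k + P.matWt δ Vhat k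
      = blockConj (P.toBlocks δ k) (P.blockd δ k + (2 : ℝ) • P.blockb δ Vhat k) (P.blockd δ k) := by
  ext α β
  have h1 := matD_apply_blocks α β
  have h2 := matW_sub_matWt_apply_blocks (Vhat := Vhat) 1 α β
  rw [blockConj_eq, Matrix.add_apply, Matrix.add_apply, Matrix.submatrix_apply]
  have h3 : P.matD δ k α β + P.matW δ Vhat k α β + P.matWt δ Vhat k α β
      = P.matD δ k α β + (P.matW δ Vhat k α β + 1 * P.matWt δ Vhat k α β) := by ring
  rw [h3, h1, h2]
  rcases P.toBlocks δ k α with i | i <;> rcases P.toBlocks δ k β with j | j <;> simp <;> ring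

theorem slope_pos_of_inPlus (hN : 0 < P.N) (i : P.IPlus δ k) : 0 < P.slope k i.1 :=
  (Real.rpow_pos_of_pos hN (-δ)).trans_le i.2

/-- In block form the product has the same orthogonal factor in both blocks. The constant 8 is the 4
of `frobSq_polarFactor_rankOne_le` for each of the two blocks. -/
theorem matO_mul_matOt (hN : 0 < P.N) (hk : 0 < ‖k.toVec‖) (hg : 0 ≤ P.coupling Vhat k) :
    (P.matO δ Vhat k * P.matOt δ Vhat k)ᵀ * (P.matO δ Vhat k * P.matOt δ Vhat k) = 1 ∧
    frobSq (P.matO δ Vhat k * P.matOt δ Vhat k - 1) ≤ 8 * (∑ i : P.IPlus δ k,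
      2 * P.coupling Vhat k * P.nPair δ k i.1 ^ 2 / (P.slope k i.1 / ‖k.toVec‖)) ^ 2 := by
  have ht := toBlocks_bijective (P := P) (δ := δ) (k := k) hN
  have hs : ∀ i : P.IPlus δ k, |P.slope k i.1| = P.slope k i.1 := fun i =>
    abs_of_pos (slope_pos_of_inPlus hN i)
  have hd : ∀ i : P.IPlus δ k, 0 < P.slope k i.1 / ‖k.toVec‖ := fun i =>
    div_pos (slope_pos_of_inPlus hN i) hk
  have hdd : P.blockd δ k = Matrix.diagonal fun i : P.IPlus δ k => P.slope k i.1 / ‖k.toVec‖ := by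
    rw [blockd_eq]; simp only [hs]
  have hdp : (P.blockd δ k).PosDef := by rw [hdd]; exact Matrix.PosDef.diagonal hd
  obtain ⟨hd₂, hfr⟩ := frobSq_polarFactor_rankOne_le hd hg
    (v := fun i : P.IPlus δ k => P.nPair δ k i.1)
    (d₂ := P.blockd δ k + (2 : ℝ) • P.blockb δ Vhat k) (by rw [hdd, blockb_eq, smul_smul])
  rw [← hdd] at hfr
  have hmain := polarFactor_mul_blockConj ht hdp hd₂
  rw [← matD_add_matW_sub_matWt, ← matD_add_matW_add_matWt] at hmain
  change P.matO δ Vhat k * P.matOt δ Vhat k = _ at hmain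
  set S := symPow (P.blockd δ k) (1 / 2) * symPow (symPow (symPow (P.blockd δ k) (1 / 2)
    * (P.blockd δ k + (2 : ℝ) • P.blockb δ Vhat k) * symPow (P.blockd δ k) (1 / 2)) (1 / 2))
      (-(1 / 2)) with hS
  have hf := symPow_posDef hdp (1 / 2)
  have hE : (symPow (P.blockd δ k) (1 / 2) * (P.blockd δ k + (2 : ℝ) • P.blockb δ Vhat k)
      * symPow (P.blockd δ k) (1 / 2)).PosDef := by
    have := hd₂.conjTranspose_mul_mul_same (B := symPow (P.blockd δ k) (1 / 2))
      (Matrix.mulVec_injective_of_isUnit hf.isUnit)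
    rwa [Matrix.conjTranspose_eq_transpose_of_trivial, transpose_of_posDef hf] at this
  have hSu : IsUnit S := hf.isUnit.mul (symPow_posDef (symPow_posDef hE _) _).isUnit
  obtain ⟨-, -, -, hQ⟩ := exists_polar hSu
  rw [hmain]
  refine ⟨?_, ?_⟩
  · rw [blockConj_transpose, blockConj_mul ht, hQ, blockConj_one ht]
  · rw [frobSq_blockConj_sub_one ht]
    linarith

theorem coupling_nonneg (hV : 0 ≤ Vhat k) (hkF : 0 ≤ P.kF) : 0 ≤ P.coupling Vhat k := by
  rw [coupling, hbar, kappa]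
  have hN : 0 ≤ P.N := Nat.cast_nonneg _
  positivity

theorem star_matL (hN : 0 < P.N) (hk : 0 < ‖k.toVec‖) (hg : 0 ≤ P.coupling Vhat k) (t : ℝ) :
    star (P.matL δ Vhat k t) = -P.matL δ Vhat k t :=
  star_cfc_branchLog (map_ofReal_mem_unitary (matO_mul_matOt hN hk hg).1) t

theorem exists_hsNorm_matL_le {t : ℝ} (ht_pos : 0 < t) (ht_lt : t < 2 * Real.pi) :
    ∃ C > 0, ∀ (P : PatchSystem) (δ : ℝ) (Vhat : Momentum → ℝ) (k : Momentum), 0 < P.N →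
      0 < ‖k.toVec‖ → 0 ≤ P.coupling Vhat k → hsNorm (P.matL δ Vhat k t) ≤ C * ∑ i : P.IPlus δ k,
        2 * P.coupling Vhat k * P.nPair δ k i.1 ^ 2 / (P.slope k i.1 / ‖k.toVec‖) := by
  obtain ⟨C, hC, h⟩ := exists_hsNorm_cfc_branchLog_le ht_pos ht_lt
  -- The factor 3 bounds the square root of the 8 in `matO_mul_matOt`.
  refine ⟨C * 3, by positivity, fun P δ Vhat k hN hk hg => ?_⟩
  obtain ⟨h1, h2⟩ := matO_mul_matOt (δ := δ) hN hk hg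
  refine (h _ _ (map_ofReal_mem_unitary h1)).trans ?_
  rw [hsNorm_map_ofReal_sub_one, mul_assoc]
  refine mul_le_mul_of_nonneg_left (Real.sqrt_le_iff.2 ⟨?_, ?_⟩) hC.le
  · refine mul_nonneg (by norm_num) (Finset.sum_nonneg fun i _ => ?_)
    have := slope_pos_of_inPlus hN i
    positivity
  · refine h2.trans ?_
    rw [mul_pow]
    exact mul_le_mul_of_nonneg_right (by norm_num) (sq_nonneg _)

end PatchSystem

end

noncomputable section

/-! ### The pair operators of the patches -/

/-- The modes of the finite set `Ω` at distance more than `r` from the sphere of radius `kF`. -/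
def gapModes (Ω : Finset Momentum) (kF r : ℝ) : Finset Momentum :=
  open scoped Classical in
  Ω.filter fun p => r < |‖p.toVec‖ - kF|

theorem mem_gapModes {Ω : Finset Momentum} {kF r : ℝ} {p : Momentum} :
    p ∈ gapModes Ω kF r ↔ p ∈ Ω ∧ r < |‖p.toVec‖ - kF| := by
  classical
  exact Finset.mem_filter

/-- Both sides are diagonal in the occupation basis, and restricting to finitely many modes only
lowers the eigenvalues. This is the one passage from bounded number operators to the unbounded one
in the claim. -/
theorem sum_norm_annihilate_modeNumber_le (Ω : Finset Momentum) (kF r : ℝ)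
    (ψ : (diagOp fun S => Real.sqrt (gappedWeight kF r S) * numberWeight S).domain) :
    ∑ p ∈ gapModes Ω kF r, ‖annihilate p (modeNumber Ω ψ)‖ ^ 2
      ≤ ‖diagOp (fun S => Real.sqrt (gappedWeight kF r S) * numberWeight S) ψ‖ ^ 2 := by
  classical
  set y := diagOp (fun S => Real.sqrt (gappedWeight kF r S) * numberWeight S) ψ with hy
  set x := modeNumber Ω (ψ : Fock) with hx
  rw [← re_inner_modeNumber, ← re_inner_self y]
  have h1 := Complex.hasSum_re (lp.hasSum_inner (𝕜 := ℂ) x (modeNumber (gapModes Ω kF r) x))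
  have h2 := Complex.hasSum_re (lp.hasSum_inner (𝕜 := ℂ) y y)
  refine hasSum_le (fun S => ?_) h1 h2
  have e1 : ∀ z : ℂ, ∀ a : ℝ, (inner ℂ z ((a : ℂ) * z)).re = a * ‖z‖ ^ 2 := fun z a => by
    have : inner ℂ z ((a : ℂ) * z) = (a : ℂ) * inner ℂ z z := by
      rw [← smul_eq_mul, inner_smul_right]
    rw [this, inner_self_eq_norm_sq_to_K, Complex.re_ofReal_mul]
    norm_cast
  have e2 : modeNumber (gapModes Ω kF r) x S = (((gapModes Ω kF r ∩ S).card : ℝ) : ℂ) * x S := by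
    rw [modeNumber_apply]; norm_cast
  have e3 : x S = (((Ω ∩ S).card : ℝ) : ℂ) * (ψ : Fock) S := by
    rw [hx, modeNumber_apply]; norm_cast
  have e4 : y S = ((Real.sqrt (gappedWeight kF r S) * numberWeight S : ℝ) : ℂ) * (ψ : Fock) S := rfl
  have e5 : (inner ℂ (y S) (y S)).re = ‖y S‖ ^ 2 := by
    have := e1 (y S) 1
    rwa [Complex.ofReal_one, one_mul, one_mul] at this
  rw [e2, e1, e5, e3, e4, norm_mul, norm_mul, mul_pow, mul_pow, Complex.norm_real, Complex.norm_real,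
    Real.norm_eq_abs, Real.norm_eq_abs, sq_abs, sq_abs, mul_pow,
    Real.sq_sqrt (show 0 ≤ gappedWeight kF r S from Nat.cast_nonneg _), ← mul_assoc]
  refine mul_le_mul_of_nonneg_right (mul_le_mul ?_ ?_ (sq_nonneg _) (Nat.cast_nonneg _))
    (sq_nonneg _)
  · rw [gappedWeight]
    refine Nat.cast_le.2 (Finset.card_le_card fun p hp => ?_)
    rw [Finset.mem_inter] at hp
    exact Finset.mem_filter.2 ⟨hp.2, (mem_gapModes.1 hp.1).2⟩
  · rw [numberWeight]
    exact pow_le_pow_left₀ (Nat.cast_nonneg _)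
      (Nat.cast_le.2 (Finset.card_le_card Finset.inter_subset_right)) 2

namespace PatchSystem

variable {P : PatchSystem} {δ : ℝ} {k ℓ : Momentum}

theorem star_cStar (α : P.Patch) : star (P.cStar δ k α) = P.c δ k α := rfl

theorem star_c (α : P.Patch) : star (P.c δ k α) = P.cStar δ k α := star_star _

theorem c_eq (α : P.Patch) : P.c δ k α = ((P.nPair δ k α : ℂ)⁻¹)
    • pairAnn (P.pairs α (P.signed δ k α)) (P.signed δ k α) 1 := by
  rw [← star_cStar, cStar_eq, bStar, ← star_pairAnn_one, star_smul, star_star, nPair_eq]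
  congr 1
  simp

theorem Z_eq_exp_quadGen (Vhat : Momentum → ℝ) (t s : ℝ) : P.Z δ Vhat t s = NormedSpace.exp ((s : ℂ)
    • quadGen P.gammaNor (fun k (α : P.I δ k) => P.c δ k α.1) fun k => P.matL δ Vhat k t) := by
  simp only [Z, quadGen, star_c]

theorem patch_disjoint {K : ℝ} (hP : P.IsPatchDecomposition K) (hR : 0 ≤ P.R) {α β : P.Patch}
    {x : EuclideanSpace ℝ (Fin 3)} (hα : x ∈ P.patch α) (hβ : x ∈ P.patch β) : α = β := by
  by_contra h
  have := hP.corridor α β h x hα x hβ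
  rw [dist_self] at this
  linarith

theorem ne_sub_of_mem_pairs {α β : P.Patch} {κ κ' p q : Momentum} (hp : p ∈ P.pairs α κ)
    (hq : q ∈ P.pairs β κ') : p ≠ q - κ' := fun h =>
  (mem_pairs.1 hp).2.1.1 (h ▸ (mem_pairs.1 hq).2.2.1)

theorem pairs_subset {α : P.Patch} {κ p : Momentum} (hR : 0 ≤ P.R) (hp : p ∈ P.pairs α κ) :
    p ∈ latticeBall (P.kF + P.R) ∧ p - κ ∈ latticeBall (P.kF + P.R) := by
  refine ⟨(mem_pairs.1 hp).1, ?_⟩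
  rw [mem_latticeBall]
  linarith [norm_sub_le_of_mem_pairs hp]

/-- At most one of ±k lies in `P.gammaNor`, so different momenta never share a transfer and the
scalar part of the commutator carries δ_{kℓ}. -/
theorem signed_eq_iff (hk : k ∈ P.gammaNor) (hℓ : ℓ ∈ P.gammaNor) (α γ : P.Patch)
    (h : P.signed δ k α = P.signed δ ℓ γ) : k = ℓ := by
  rw [signed, signed] at h
  split_ifs at h
  · exact h
  · exact (neg_notMem_gammaNor hℓ (h ▸ hk)).elim
  · exact (neg_notMem_gammaNor hk (h ▸ hℓ)).elim
  · exact neg_injective h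

theorem sum_norm_c_weighted_sq_le {K : ℝ} (hP : P.IsPatchDecomposition K) (hR : 0 ≤ P.R)
    {G : Finset Momentum} (hG : ∀ α : P.I δ k, ∀ p ∈ P.pairs α.1 (P.signed δ k α.1),
      p ∈ G ∨ p - P.signed δ k α.1 ∈ G) (w : Momentum → P.Patch → Momentum → ℂ) {b : ℝ}
    (hw : ∀ α p, ‖w k α p‖ ≤ b) (x : Fock) :
    ∑ α : P.I δ k, ‖(((P.nPair δ k α.1 : ℂ)⁻¹)
        • pairAnn (P.pairs α.1 (P.signed δ k α.1)) (P.signed δ k α.1) (w k α.1)) x‖ ^ 2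
      ≤ b ^ 2 * ∑ p ∈ G, ‖annihilate p x‖ ^ 2 := by
  refine le_trans (le_of_eq (Finset.sum_congr rfl fun α _ => ?_)) (sum_norm_pairAnn_sq_le
    (fun α : P.I δ k => P.pairs α.1 (P.signed δ k α.1)) (fun α => P.signed δ k α.1)
    (fun α => w k α.1) (fun α p _ => hw α.1 p) G hG ?_ ?_ ?_ x)
  · rw [nPair_eq]; rfl
  · rintro α p hp β q hq rfl
    exact Subtype.ext (patch_disjoint hP hR (mem_pairs.1 hp).2.1.2 (mem_pairs.1 hq).2.1.2)
  · intro α p hp β q hq h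
    refine Subtype.ext (patch_disjoint hP hR (mem_pairs.1 hp).2.2.2 ?_)
    rw [h]
    exact (mem_pairs.1 hq).2.2.2
  · intro α p hp β q hq
    exact ne_sub_of_mem_pairs hp hq

/-- Dividing the bound of `pairAnn_commutator` by n_γ n_α ≥ b gives 2/b; for equal indices the
scalar part is n²/n² = 1. Different patches share no mode because of the corridors, so their error
vanishes. -/
theorem exists_commutator_error {K b : ℝ} (hP : P.IsPatchDecomposition K) (hR : 0 ≤ P.R)
    (hb : 0 < b) (hk : k ∈ P.gammaNor) (hℓ : ℓ ∈ P.gammaNor) (γ : P.I δ ℓ) (α : P.I δ k)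
    (hγ : b ≤ P.nPair δ ℓ γ.1 ^ 2) (hα : b ≤ P.nPair δ k α.1 ^ 2) :
    ∃ E : Fock →L[ℂ] Fock,
      P.c δ ℓ γ.1 * star (P.c δ k α.1) - star (P.c δ k α.1) * P.c δ ℓ γ.1
        = (if k = ℓ ∧ γ.1 = α.1 then (1 : ℂ) else 0) • 1 + E ∧
      (α.1 ≠ γ.1 → E = 0) ∧
      ∀ x, ‖E x‖ ≤ 2 / b * ‖modeNumber (latticeBall (P.kF + P.R)) x‖ := by
  set A := P.pairs α.1 (P.signed δ k α.1) with hA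
  set A' := P.pairs γ.1 (P.signed δ ℓ γ.1) with hA'
  obtain ⟨E, h1, h2, h3⟩ := pairAnn_commutator (latticeBall (P.kF + P.R)) A A' (P.signed δ k α.1)
    (P.signed δ ℓ γ.1) (fun p hp => pairs_subset hR hp) (fun p hp => pairs_subset hR hp)
    fun p hp q hq => ⟨ne_sub_of_mem_pairs hp hq, ne_sub_of_mem_pairs hq hp⟩
  have hn : ∀ {j : Momentum} {β : P.Patch}, b ≤ P.nPair δ j β ^ 2 →
      0 < P.nPair δ j β ∧ Real.sqrt b ≤ P.nPair δ j β := by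
    intro j β h
    have h0 : 0 ≤ P.nPair δ j β := by rw [nPair_eq]; exact Real.sqrt_nonneg _
    have h4 : Real.sqrt b ≤ P.nPair δ j β := Real.sqrt_le_iff.2 ⟨h0, h⟩
    exact ⟨(Real.sqrt_pos.2 hb).trans_le h4, h4⟩
  obtain ⟨hγ0, hγ1⟩ := hn hγ
  obtain ⟨hα0, hα1⟩ := hn hα
  set z : ℂ := (P.nPair δ ℓ γ.1 : ℂ)⁻¹ * (P.nPair δ k α.1 : ℂ)⁻¹ with hz
  have hdisj : α.1 ≠ γ.1 → ∀ p ∈ A, ∀ q ∈ A', p ≠ q ∧ p - P.signed δ k α.1 ≠ q - P.signed δ ℓ γ.1 := by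
    intro hne p hp q hq
    constructor
    · rintro rfl
      exact hne (patch_disjoint hP hR (mem_pairs.1 hp).2.1.2 (mem_pairs.1 hq).2.1.2)
    · intro h
      have h4 := (mem_pairs.1 hp).2.2.2
      rw [h] at h4
      exact hne (patch_disjoint hP hR h4 (mem_pairs.1 hq).2.2.2)
  refine ⟨z • E, ?_, fun hne => by rw [h2 (hdisj hne), smul_zero], fun x => ?_⟩
  · have e1 : P.c δ ℓ γ.1 * star (P.c δ k α.1) - star (P.c δ k α.1) * P.c δ ℓ γ.1
        = z • (pairAnn A' (P.signed δ ℓ γ.1) 1 * star (pairAnn A (P.signed δ k α.1) 1)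
          - star (pairAnn A (P.signed δ k α.1) 1) * pairAnn A' (P.signed δ ℓ γ.1) 1) := by
      have hreal : star ((P.nPair δ k α.1 : ℂ)⁻¹) = (P.nPair δ k α.1 : ℂ)⁻¹ := by simp
      rw [c_eq, c_eq, star_smul, hreal, smul_mul_smul_comm, smul_mul_smul_comm, smul_sub, hz, mul_comm
        ((P.nPair δ k α.1 : ℂ)⁻¹)]
    rw [e1, h1, smul_add, smul_smul]
    congr 2
    by_cases h : k = ℓ ∧ γ.1 = α.1
    · obtain ⟨rfl, h⟩ := h
      have hsub : γ = α := Subtype.ext h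
      subst hsub
      have hcard : ((A' ∩ A).card : ℂ) = (P.nPair δ k γ.1 : ℂ) * (P.nPair δ k γ.1 : ℂ) := by
        rw [hA, hA', Finset.inter_self, nPair_eq, pairNorm, ← Complex.ofReal_mul,
          Real.mul_self_sqrt (Nat.cast_nonneg _), Complex.ofReal_natCast]
      have hne : (P.nPair δ k γ.1 : ℂ) ≠ 0 := Complex.ofReal_ne_zero.2 hγ0.ne'
      rw [if_pos rfl, if_pos ⟨rfl, rfl⟩, hcard, hz]
      field_simp
    · rw [if_neg h]
      by_cases hs : P.signed δ k α.1 = P.signed δ ℓ γ.1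
      · have hkl := signed_eq_iff hk hℓ _ _ hs
        have hne : α.1 ≠ γ.1 := fun h' => h ⟨hkl, h'.symm⟩
        have hempty : A' ∩ A = ∅ := by
          rw [← Finset.disjoint_iff_inter_eq_empty, Finset.disjoint_left]
          intro q hq hp
          exact (hdisj hne q hp q hq).1 rfl
        rw [if_pos hs, hempty]; simp
      · rw [if_neg hs, mul_zero]
  · have hzn : ‖z‖ ≤ 1 / b := by
      rw [hz, norm_mul, norm_inv, norm_inv, Complex.norm_real, Complex.norm_real, Real.norm_eq_abs,
        Real.norm_eq_abs, abs_of_pos hγ0, abs_of_pos hα0, ← mul_inv, one_div]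
      refine inv_anti₀ hb ?_
      calc b = Real.sqrt b * Real.sqrt b := (Real.mul_self_sqrt hb.le).symm
        _ ≤ _ := mul_le_mul hγ1 hα1 (Real.sqrt_nonneg _) hγ0.le
    change ‖z • E x‖ ≤ _
    rw [norm_smul]
    calc ‖z‖ * ‖E x‖ ≤ 1 / b * (2 * ‖modeNumber (latticeBall (P.kF + P.R)) x‖) :=
          mul_le_mul hzn (h3 x) (norm_nonneg _) (by positivity)
      _ = _ := by ring

/-- `sum_norm_evolution_sub_le` is applied with Ω the lattice ball of radius k_F + R. It contains
both modes of every pair, so the number operators needed here are bounded and every pair has weight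
exactly 2. -/
theorem sum_norm_pair_evolution_sub_le {K b q t : ℝ} {Vhat : Momentum → ℝ}
    (hP : P.IsPatchDecomposition K) (hR : 0 ≤ P.R) (hb : 0 < b)
    (hn : ∀ k ∈ P.gammaNor, ∀ α : P.I δ k, b ≤ P.nPair δ k α.1 ^ 2)
    (hgap : ∀ k ∈ P.gammaNor, ∀ α : P.I δ k, ∀ p ∈ P.pairs α.1 (P.signed δ k α.1),
      q < |‖p.toVec‖ - P.kF| ∨ q < |‖(p - P.signed δ k α.1).toVec‖ - P.kF|)
    (hL : ∀ k ∈ P.gammaNor, star (P.matL δ Vhat k t) = -P.matL δ Vhat k t)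
    (hℓ : ℓ ∈ P.gammaNor) {s : ℝ} (hs : s ∈ Set.Icc (-1 : ℝ) 1) (ψ : Fock) :
    ∑ γ : P.I δ ℓ, ‖(star (P.Z δ Vhat t s) * P.c δ ℓ γ.1 * P.Z δ Vhat t s
        - ∑ β : P.I δ ℓ, NormedSpace.exp ((s : ℂ) • P.matL δ Vhat ℓ t) γ β • P.c δ ℓ β.1) ψ‖
      ≤ Real.sqrt (Fintype.card (P.I δ ℓ))
        * (2 / b * (∑ k ∈ P.gammaNor, hsNorm (P.matL δ Vhat k t))
        * (Real.exp (2 * ∑ k ∈ P.gammaNor, hsNorm (P.matL δ Vhat k t))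
        * Real.sqrt (∑ p ∈ gapModes (latticeBall (P.kF + P.R)) P.kF q,
          ‖annihilate p (modeNumber (latticeBall (P.kF + P.R)) ψ)‖ ^ 2))) := by
  classical
  set Ω := latticeBall (P.kF + P.R) with hΩ
  set G := gapModes Ω P.kF q with hG
  have hGmem : ∀ k ∈ P.gammaNor, ∀ α : P.I δ k, ∀ p ∈ P.pairs α.1 (P.signed δ k α.1),
      p ∈ G ∨ p - P.signed δ k α.1 ∈ G := fun k hk α p hp => by
    obtain ⟨h1, h2⟩ := pairs_subset hR hp
    exact (hgap k hk α p hp).imp (fun h => mem_gapModes.2 ⟨h1, h⟩) fun h => mem_gapModes.2 ⟨h2, h⟩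
  have hex : ∀ k (γ : P.I δ ℓ) (α : P.I δ k), ∃ E : Fock →L[ℂ] Fock, k ∈ P.gammaNor →
      (P.c δ ℓ γ.1 * star (P.c δ k α.1) - star (P.c δ k α.1) * P.c δ ℓ γ.1
        = (if k = ℓ ∧ γ.1 = α.1 then (1 : ℂ) else 0) • 1 + E ∧
      (α.1 ≠ γ.1 → E = 0) ∧ ∀ x, ‖E x‖ ≤ 2 / b * ‖modeNumber Ω x‖) := fun k γ α => by
    by_cases hk : k ∈ P.gammaNor
    · obtain ⟨E, hE⟩ := exists_commutator_error hP hR hb hk hℓ γ α (hn ℓ hℓ γ) (hn k hk α)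
      exact ⟨E, fun _ => hE⟩
    · exact ⟨0, fun h => absurd h hk⟩
  choose E hE using hex
  set w : Finset Momentum → Momentum → P.Patch → Momentum → ℂ := fun Q k α p =>
    (if p ∈ Q then 1 else 0) + (if p - P.signed δ k α ∈ Q then 1 else 0) with hw
  have hcw : ∀ (Q : Finset Momentum) k (α : P.I δ k), modeNumber Q * P.c δ k α.1
      = P.c δ k α.1 * modeNumber Q - ((P.nPair δ k α.1 : ℂ)⁻¹)
        • pairAnn (P.pairs α.1 (P.signed δ k α.1)) (P.signed δ k α.1) (w Q k α.1) := fun Q k α => by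
    have h := modeNumber_mul_pairAnn Q (P.pairs α.1 (P.signed δ k α.1)) (P.signed δ k α.1) 1
    simp only [Pi.one_apply, one_mul] at h
    rw [c_eq, mul_smul_comm, smul_mul_assoc, h, smul_sub]
  rw [Z_eq_exp_quadGen]
  refine sum_norm_evolution_sub_le P.gammaNor (fun k (α : P.I δ k) => P.c δ k α.1)
    (fun k => P.matL δ Vhat k t) E (fun _ α => α.1) (fun _ => Subtype.val_injective) Ω G
    (fun p hp => (mem_gapModes.1 hp).1) (by positivity) hL hℓ
    (fun k γ α => if k = ℓ ∧ γ.1 = α.1 then 1 else 0) ?_ ?_ (fun k hk γ α => (hE k γ α hk).1) ?_ ?_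
    (fun k hk γ α => (hE k γ α hk).2.1) (fun k hk γ α => (hE k γ α hk).2.2)
    (fun k α => ((P.nPair δ k α.1 : ℂ)⁻¹)
        • pairAnn (P.pairs α.1 (P.signed δ k α.1)) (P.signed δ k α.1) (w G k α.1))
    (fun k _ α => hcw G k α) ?_ ?_ hs ψ
  · intro γ α
    simp only [true_and, Subtype.ext_iff]
  · intro k _ hne γ α
    exact if_neg fun h => hne h.1
  · intro k _ γ β
    rw [c_eq, c_eq]
    exact ((pairAnn_commute _ _ _ _ _ _).smul_left _).smul_right _
  · intro k _ α
    rw [hcw Ω k α]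
    congr 1
    rw [c_eq, smul_comm]
    congr 1
    rw [pairAnn, pairAnn, Finset.smul_sum]
    refine Finset.sum_congr rfl fun p hp => ?_
    obtain ⟨h1, h2⟩ := pairs_subset hR hp
    rw [← hΩ] at h1 h2
    simp only [hw, if_pos h1, if_pos h2, Pi.one_apply]
    rw [smul_smul]
    norm_num
  · intro k hk x
    have h := sum_norm_c_weighted_sq_le hP hR (hGmem k hk) (fun _ _ => 1) (b := 1)
      (fun _ _ => by simp) x
    simp only [one_pow, one_mul, ← c_eq] at h
    exact h
  · intro k hk x
    refine sum_norm_c_weighted_sq_le hP hR (hGmem k hk) (w G) (b := 2) (fun α p => ?_) x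
    rw [hw]
    refine (norm_add_le _ _).trans ?_
    have h1 : ∀ c : Prop, [Decidable c] → ‖(if c then 1 else 0 : ℂ)‖ ≤ 1 := fun c _ => by
      split_ifs <;> simp
    linarith [h1 (p ∈ G), h1 (p - P.signed δ k α ∈ G)]

end PatchSystem

end

noncomputable section

/-! ### The approximate one-particle unitary -/

namespace PatchSystem

variable {P : PatchSystem} {K δ ε : ℝ} {k : Momentum}

theorem card_patch : (Fintype.card P.Patch : ℝ) = P.M := by
  rw [Fintype.card_prod, Fintype.card_fin, Fintype.card_units_int, M]
  push_cast; ring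

theorem card_I_le : (Fintype.card (P.I δ k) : ℝ) ≤ P.M := by
  rw [← card_patch]
  exact Nat.cast_le.2 (Fintype.card_le_of_injective _ Subtype.val_injective)

theorem card_IPlus_le : (Fintype.card (P.IPlus δ k) : ℝ) ≤ P.M := by
  rw [← card_patch]
  exact Nat.cast_le.2 (Fintype.card_le_of_injective _ Subtype.val_injective)

theorem coupling_mul_norm (hkF : 2 ≤ P.kF) (Vhat : Momentum → ℝ) (hk : 0 < ‖k.toVec‖) :
    2 * P.coupling Vhat k * ‖k.toVec‖ = Vhat k / (P.kF * P.N ^ (1 / 3 : ℝ)) := by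
  have hN : 0 < P.N := lt_of_lt_of_le one_pos (one_le_N hkF)
  have hν : 0 < P.N ^ (1 / 3 : ℝ) := Real.rpow_pos_of_pos hN _
  have e : P.N = P.N ^ (1 / 3 : ℝ) * P.N ^ (1 / 3 : ℝ) * P.N ^ (1 / 3 : ℝ) := by
    rw [← Real.rpow_add hN, ← Real.rpow_add hN]; norm_num
  have h2 : P.hbar * P.kappa * P.N = P.kF * P.N ^ (1 / 3 : ℝ) := by
    rw [hbar, kappa, Real.rpow_neg hN.le]
    nth_rewrite 3 [e]
    field_simp
  have hkF0 : 0 < P.kF := by linarith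
  rw [coupling, show 2 * P.hbar * P.kappa * P.N * ‖k.toVec‖
    = 2 * (P.hbar * P.kappa * P.N) * ‖k.toVec‖ by ring, h2]
  field_simp

/-- The upper count is proportional to the slope, which cancels the denominator, and N^{1/3} ≥ k_F/2
absorbs k_F². Each term is then at most 28000 K² V̂(k)/M, and there are at most M terms. -/
theorem sum_coupling_le (hP : P.IsPatchDecomposition K) (h : P.IsRegime δ ε)
    (hε : 1000 * ε ≤ 1) (hε1 : 1000 * (K * ε) ≤ 1) (hε2 : 1000 * ε ≤ K) (hk : k ∈ P.gammaNor)
    {Vhat : Momentum → ℝ} (hV : 0 ≤ Vhat k) :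
    ∑ i : P.IPlus δ k, 2 * P.coupling Vhat k * P.nPair δ k i.1 ^ 2 / (P.slope k i.1 / ‖k.toVec‖)
      ≤ 28000 * K ^ 2 * Vhat k := by
  have hkF := h.fermi_large
  have hN : 0 < P.N := lt_of_lt_of_le one_pos (one_le_N hkF)
  have hk0 : 0 < ‖k.toVec‖ := lt_of_lt_of_le one_pos (one_le_norm_of_mem_gammaNor hk)
  have hν := (cube_root_N_bounds hkF).1
  have hν0 : 0 < P.N ^ (1 / 3 : ℝ) := Real.rpow_pos_of_pos hN _
  have hμ := rpow_neg_half_sq h.M_pos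
  set μ := P.M ^ (-(1 / 2) : ℝ) with hμdef
  have hterm : ∀ i : P.IPlus δ k, 2 * P.coupling Vhat k * P.nPair δ k i.1 ^ 2
      / (P.slope k i.1 / ‖k.toVec‖) ≤ 28000 * K ^ 2 * Vhat k * μ ^ 2 := fun i => by
    have hs := slope_pos_of_inPlus hN i
    have hcard := card_pairs_patch_le hP h hε hε1 hε2 (norm_lt_of_mem_gammaNor hk).le i.2
    have e1 : 2 * P.coupling Vhat k * P.nPair δ k i.1 ^ 2 / (P.slope k i.1 / ‖k.toVec‖)
        = 2 * P.coupling Vhat k * ‖k.toVec‖ * P.nPair δ k i.1 ^ 2 / P.slope k i.1 := by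
      field_simp
    rw [e1, coupling_mul_norm hkF Vhat hk0, nPair_of_inPlus i.2, pairNorm,
      Real.sq_sqrt (Nat.cast_nonneg _), div_le_iff₀ hs, div_mul_eq_mul_div,
      div_le_iff₀ (by positivity)]
    have a1 := mul_le_mul_of_nonneg_left hcard hV
    have a2 := mul_le_mul_of_nonneg_left hν
      (show 0 ≤ 28000 * (Vhat k * K ^ 2 * μ ^ 2 * P.slope k i.1 * P.kF) by positivity)
    refine a1.trans (le_trans (le_of_eq ?_) (a2.trans (le_of_eq ?_))) <;> ring
  refine (Finset.sum_le_sum fun i _ => hterm i).trans ?_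
  rw [Finset.sum_const, nsmul_eq_mul, Finset.card_univ]
  calc (Fintype.card (P.IPlus δ k) : ℝ) * (28000 * K ^ 2 * Vhat k * μ ^ 2)
      ≤ P.M * (28000 * K ^ 2 * Vhat k * μ ^ 2) :=
        mul_le_mul_of_nonneg_right card_IPlus_le (by positivity)
    _ = 28000 * K ^ 2 * Vhat k := by linear_combination (28000 * K ^ 2 * Vhat k) * hμ

/-- The lower count with slope at least N^{-δ} and k_F² ≥ N^{2/3}/9; here 2880000 = 9 · 320000. -/
theorem le_nPair_sq (hP : P.IsPatchDecomposition K) (h : P.IsRegime δ ε) (hε : 1000 * ε ≤ 1)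
    (hε1 : 1000 * (K⁻¹ / 16 * ε) ≤ 1) (hε2 : 1000 * ε ≤ K⁻¹ / 16) (hk : k ∈ P.gammaNor)
    (α : P.I δ k) :
    (K⁻¹ / 16) ^ 2 / 2880000 * (P.N ^ (2 / 3 - δ) / P.M) ≤ P.nPair δ k α.1 ^ 2 := by
  have hkF := h.fermi_large
  have hN : 0 < P.N := lt_of_lt_of_le one_pos (one_le_N hkF)
  have hν := (cube_root_N_bounds hkF).2
  have hν0 : 0 < P.N ^ (1 / 3 : ℝ) := Real.rpow_pos_of_pos hN _
  have hM := h.M_pos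
  have hμ := rpow_neg_half_sq hM
  set μ := P.M ^ (-(1 / 2) : ℝ) with hμdef
  have hμ' : μ ^ 2 = 1 / P.M := by rw [eq_div_iff hM.ne']; exact hμ
  have hκ : ‖(P.signed δ k α.1).toVec‖ ≤ P.R := by
    rw [norm_signed]; exact (norm_lt_of_mem_gammaNor hk).le
  have hs := le_slope_signed α
  have hcard := le_card_pairs_patch hP h hε hε1 hε2 hκ hs
  rw [nPair_eq, pairNorm, Real.sq_sqrt (Nat.cast_nonneg _)]
  have e1 : P.N ^ (2 / 3 - δ) = (P.N ^ (1 / 3 : ℝ)) ^ 2 * P.N ^ (-δ) := by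
    rw [← Real.rpow_natCast, ← Real.rpow_mul hN.le, ← Real.rpow_add hN]
    congr 1; push_cast; ring
  have hν2 : (P.N ^ (1 / 3 : ℝ)) ^ 2 ≤ 9 * P.kF ^ 2 := by
    have := pow_le_pow_left₀ hν0.le hν 2
    linarith [show (3 * P.kF) ^ 2 = 9 * P.kF ^ 2 by ring]
  have hδ0 : 0 < P.N ^ (-δ) := Real.rpow_pos_of_pos hN _
  have a1 : (P.N ^ (1 / 3 : ℝ)) ^ 2 * P.N ^ (-δ)
      ≤ 9 * P.kF ^ 2 * P.slope (P.signed δ k α.1) α.1 :=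
    mul_le_mul hν2 hs hδ0.le (by positivity)
  have a2 := mul_le_mul_of_nonneg_left a1
    (show 0 ≤ (K⁻¹ / 16) ^ 2 / 2880000 * (1 / P.M) by positivity)
  rw [mul_pow, mul_pow, hμ'] at hcard
  rw [e1]
  calc _ = (K⁻¹ / 16) ^ 2 / 2880000 * (1 / P.M) * ((P.N ^ (1 / 3 : ℝ)) ^ 2 * P.N ^ (-δ)) := by ring
    _ ≤ _ := a2
    _ ≤ _ := by linarith

theorem exists_regime_bounds (K : ℝ) {q : ℝ} (hq : q < 1 / 2) : ∃ ε > 0, ε ≤ 1 ∧ 1000 * ε ≤ 1 ∧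
    (0 < K → 1000 * (K * ε) ≤ 1 ∧ 1000 * ε ≤ K ∧ 1000 * (K⁻¹ / 16 * ε) ≤ 1 ∧
      1000 * ε ≤ K⁻¹ / 16 ∧ K * ε + ε < 1 - 2 * q) := by
  -- For K ≤ 0 nothing beyond the smallness of ε is required: a patch decomposition with at least
  -- one patch forces K > 0.
  rcases le_or_gt K 0 with hK | hK
  · exact ⟨1 / 1000, by norm_num, by norm_num, by norm_num, fun h => absurd h hK.not_gt⟩
  set ε := min (min (1 / 1000) (1 / (1000 * K))) (min (K / 1000)
    (min (K⁻¹ / 16000) ((1 - 2 * q) / (2 * (K + 1))))) with hε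
  have h1 : ε ≤ 1 / 1000 := (min_le_left _ _).trans (min_le_left _ _)
  have h2 : ε ≤ 1 / (1000 * K) := (min_le_left _ _).trans (min_le_right _ _)
  have h3 : ε ≤ K / 1000 := (min_le_right _ _).trans (min_le_left _ _)
  have h4 : ε ≤ K⁻¹ / 16000 := (min_le_right _ _).trans ((min_le_right _ _).trans (min_le_left _ _))
  have h5 : ε ≤ (1 - 2 * q) / (2 * (K + 1)) :=
    (min_le_right _ _).trans ((min_le_right _ _).trans (min_le_right _ _))
  have hq' : 0 < 1 - 2 * q := by linarith
  have h0 : 0 < ε := by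
    refine lt_min (lt_min (by norm_num) (by positivity)) (lt_min (by positivity)
      (lt_min (by positivity) (by positivity)))
  refine ⟨ε, h0, by linarith, by linarith, fun _ => ⟨?_, by linarith, ?_, by linarith, ?_⟩⟩
  · rw [le_div_iff₀ (by positivity)] at h2; linarith
  · have := mul_le_mul_of_nonneg_left h3 (inv_pos.2 hK).le
    have e : K⁻¹ * (K / 1000) = 1 / 1000 := by field_simp
    linarith
  · rw [le_div_iff₀ (by positivity)] at h5; linarith

theorem error_scale_eq {N M κ Λ E : ℝ} (hN : 0 < N) (hM : 0 < M) (hκ : 0 < κ) (δ y : ℝ) :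
    Real.sqrt M * (2 / (κ * (N ^ (2 / 3 - δ) / M)) * Λ * (E * y))
      = 2 / κ * Λ * E * N ^ (-(2 / 3) + δ) * M ^ (3 / 2 : ℝ) * y := by
  have e1 : N ^ (-(2 / 3) + δ) = (N ^ (2 / 3 - δ))⁻¹ := by
    rw [← Real.rpow_neg hN.le]; congr 1; ring
  have e2 : M ^ (3 / 2 : ℝ) = Real.sqrt M * M := by
    rw [Real.sqrt_eq_rpow]
    nth_rewrite 3 [← Real.rpow_one M]
    rw [← Real.rpow_add hM]; norm_num
  have hx : 0 < N ^ (2 / 3 - δ) := Real.rpow_pos_of_pos hN _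
  rw [e1, e2]
  field_simp

theorem sum_norm_pair_evolution_sub_le_diagOp (hP : P.IsPatchDecomposition K) (h : P.IsRegime δ ε)
    {q t : ℝ} (hε : 1000 * ε ≤ 1) (hε3 : 1000 * (K⁻¹ / 16 * ε) ≤ 1) (hε4 : 1000 * ε ≤ K⁻¹ / 16)
    (hε5 : K * ε + ε < 1 - 2 * q) {Vhat : Momentum → ℝ} (hV : ∀ k, 0 ≤ Vhat k) {Λ : ℝ}
    (hΛ : ∑ k ∈ P.gammaNor, hsNorm (P.matL δ Vhat k t) ≤ Λ) (hΛ0 : 0 ≤ Λ)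
    {ℓ : Momentum} (hℓ : ℓ ∈ P.gammaNor) {s : ℝ} (hs : s ∈ Set.Icc (-1 : ℝ) 1)
    (ψ : (diagOp fun S =>
      Real.sqrt (gappedWeight P.kF (q * P.N ^ (-δ)) S) * numberWeight S).domain) :
    ∑ γ : P.I δ ℓ, ‖(star (P.Z δ Vhat t s) * P.c δ ℓ γ.1 * P.Z δ Vhat t s
        - ∑ β : P.I δ ℓ, NormedSpace.exp ((s : ℂ) • P.matL δ Vhat ℓ t) γ β • P.c δ ℓ β.1) ψ‖
      ≤ 2 / ((K⁻¹ / 16) ^ 2 / 2880000) * Λ * Real.exp (2 * Λ) * P.N ^ (-(2 / 3) + δ)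
        * P.M ^ (3 / 2 : ℝ) * ‖diagOp (fun S =>
          Real.sqrt (gappedWeight P.kF (q * P.N ^ (-δ)) S) * numberWeight S) ψ‖ := by
  have hkF := h.fermi_large
  have hN : 0 < P.N := lt_of_lt_of_le one_pos (one_le_N hkF)
  have hM := h.M_pos
  have hR := h.one_le_R
  have hm : 0 < P.m := by
    rw [M] at hM
    have : (0 : ℝ) < P.m := by linarith
    exact_mod_cast this
  have hK : 0 < K := hP.const_pos ⟨0, hm⟩
  have hb₀ : 0 < (K⁻¹ / 16) ^ 2 / 2880000 := by positivity
  have hmain := sum_norm_pair_evolution_sub_le (t := t) (Vhat := Vhat) (q := q * P.N ^ (-δ)) hP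
    (by linarith) (mul_pos hb₀ (div_pos (Real.rpow_pos_of_pos hN (2 / 3 - δ)) hM))
    (fun k hk α => le_nPair_sq hP h hε hε3 hε4 hk α)
    (fun k hk α p hp => gap_of_mem_pairs hP h hε5
      (by rw [norm_signed]; exact (norm_lt_of_mem_gammaNor hk).le) (le_slope_signed α) hp)
    (fun k hk => star_matL hN (lt_of_lt_of_le one_pos (one_le_norm_of_mem_gammaNor hk))
      (coupling_nonneg (hV k) (by linarith)) t) hℓ hs (ψ : Fock)
  have hY := Real.sqrt_le_iff.2 ⟨norm_nonneg _, sum_norm_annihilate_modeNumber_le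
    (latticeBall (P.kF + P.R)) P.kF (q * P.N ^ (-δ)) ψ⟩
  have hsum0 : 0 ≤ ∑ k ∈ P.gammaNor, hsNorm (P.matL δ Vhat k t) :=
    Finset.sum_nonneg fun _ _ => hsNorm_nonneg _
  have hexp := Real.exp_le_exp.2 (mul_le_mul_of_nonneg_left hΛ (zero_le_two (α := ℝ)))
  have hNM : 0 ≤ P.N ^ (2 / 3 - δ) / P.M := div_nonneg (Real.rpow_nonneg hN.le _) hM.le
  refine hmain.trans (le_trans ?_ (error_scale_eq hN hM hb₀ δ _).le)
  refine mul_le_mul (Real.sqrt_le_sqrt card_I_le) (mul_le_mul (mul_le_mul_of_nonneg_left hΛ ?_)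
    (mul_le_mul hexp hY (Real.sqrt_nonneg _) (Real.exp_pos _).le)
    (mul_nonneg (Real.exp_pos _).le (Real.sqrt_nonneg _)) ?_) ?_ (Real.sqrt_nonneg _)
  · exact div_nonneg zero_le_two (mul_nonneg hb₀.le hNM)
  · exact mul_nonneg (div_nonneg zero_le_two (mul_nonneg hb₀.le hNM)) hΛ0
  · exact mul_nonneg (mul_nonneg (div_nonneg zero_le_two (mul_nonneg hb₀.le hNM)) hsum0)
      (mul_nonneg (Real.exp_pos _).le (Real.sqrt_nonneg _))

theorem sum_hsNorm_matL_le (hP : P.IsPatchDecomposition K) (h : P.IsRegime δ ε)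
    (hε : 1000 * ε ≤ 1) (hε1 : 1000 * (K * ε) ≤ 1) (hε2 : 1000 * ε ≤ K) {Vhat : Momentum → ℝ}
    (hV : ∀ k, 0 ≤ Vhat k) (hV' : Summable Vhat) {C t : ℝ} (hC : 0 ≤ C)
    (hL : ∀ k ∈ P.gammaNor, hsNorm (P.matL δ Vhat k t) ≤ C * ∑ i : P.IPlus δ k,
      2 * P.coupling Vhat k * P.nPair δ k i.1 ^ 2 / (P.slope k i.1 / ‖k.toVec‖)) :
    ∑ k ∈ P.gammaNor, hsNorm (P.matL δ Vhat k t) ≤ C * (28000 * K ^ 2 * ∑' k, Vhat k) := by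
  calc _ ≤ ∑ k ∈ P.gammaNor, C * (28000 * K ^ 2 * Vhat k) := Finset.sum_le_sum fun k hk =>
        (hL k hk).trans (mul_le_mul_of_nonneg_left
          (sum_coupling_le hP h hε hε1 hε2 hk (hV k)) hC)
    _ = C * (28000 * K ^ 2 * ∑ k ∈ P.gammaNor, Vhat k) := by rw [← Finset.mul_sum, ← Finset.mul_sum]
    _ ≤ _ := mul_le_mul_of_nonneg_left (mul_le_mul_of_nonneg_left
        (hV'.sum_le_tsum P.gammaNor fun k _ => hV k) (by positivity)) hC

end PatchSystem

end

theorem lemma6p4 (Vhat : Momentum → ℝ) (hV_nonneg : ∀ k, 0 ≤ Vhat k) (hV_summable : Summable Vhat)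
    (δ : ℝ) (hδ_pos : 0 < δ) (hδ_lt : δ < 1 / 6)
    (t : ℝ) (ht_pos : 0 < t) (ht_lt : t < 2 * Real.pi)
    (q : ℝ) (hq_pos : 0 < q) (hq_lt : q < 1 / 2) (K : ℝ) :
    ∃ C > 0, ∃ η > 0, ∀ P : PatchSystem, P.IsPatchDecomposition K →
      η⁻¹ ≤ P.kF →
      P.R ^ 2 * P.N ^ (2 * δ) ≤ η * P.M →
      P.M ≤ η * (P.N ^ (2 / 3 - 2 * δ) / P.R ^ 4) →
      ∀ ℓ ∈ P.gammaNor, ∀ s ∈ Set.Icc (-1 : ℝ) 1,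
        ∃ F : P.I δ ℓ → (Fock →L[ℂ] Fock),
          (∀ γ : P.I δ ℓ,
            ContinuousLinearMap.adjoint (P.Z δ Vhat t s) * P.c δ ℓ γ.1 * P.Z δ Vhat t s =
              ∑ β : P.I δ ℓ, NormedSpace.exp ((s : ℂ) • P.matL δ Vhat ℓ t) γ β • P.c δ ℓ β.1
                + F γ) ∧
          ∀ ψ : (diagOp fun S =>
              Real.sqrt (gappedWeight P.kF (q * P.N ^ (-δ)) S) * numberWeight S).domain,
            ∑ γ : P.I δ ℓ, ‖F γ ψ‖ ≤
              C * P.N ^ (-(2 / 3) + δ) * P.M ^ (3 / 2 : ℝ) *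
                ‖diagOp (fun S =>
                  Real.sqrt (gappedWeight P.kF (q * P.N ^ (-δ)) S) * numberWeight S) ψ‖ := by
  obtain ⟨CL, hCL, hlog⟩ := PatchSystem.exists_hsNorm_matL_le ht_pos ht_lt
  obtain ⟨ε, hε0, hε1, hε, hεK⟩ := PatchSystem.exists_regime_bounds K hq_lt
  have hV0 : 0 ≤ ∑' k, Vhat k := tsum_nonneg hV_nonneg
  set Λ := CL * (28000 * K ^ 2 * ∑' k, Vhat k) with hΛ
  have hΛ0 : 0 ≤ Λ := by positivity
  -- The summand 1 keeps the constant positive when Λ vanishes, for instance for zero potential. The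
  -- value η = ε²/9 is what `isRegime_of_le` needs. The operators `F γ` are defined as the
  -- differences, so only their bound remains to be shown.
  refine ⟨2 / ((K⁻¹ / 16) ^ 2 / 2880000) * Λ * Real.exp (2 * Λ) + 1, by positivity, ε ^ 2 / 9,
    by positivity, fun P hP hk h1 h2 ℓ hℓ s hs =>
      ⟨fun γ => _, fun γ => (add_sub_cancel _ _).symm, fun ψ => ?_⟩⟩
  have hreg : P.IsRegime δ ε :=
    PatchSystem.isRegime_of_le hδ_pos hε0 hε1 (by positivity) (by linarith) hk h1 h2 hℓ
  have hN : 0 < P.N := lt_of_lt_of_le one_pos (PatchSystem.one_le_N hreg.fermi_large)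
  have hM := hreg.M_pos
  have hm : 0 < P.m := by
    rw [PatchSystem.M] at hM
    have : (0 : ℝ) < P.m := by linarith
    exact_mod_cast this
  obtain ⟨k1, k2, k3, k4, k5⟩ := hεK (hP.const_pos ⟨0, hm⟩)
  have hsum := PatchSystem.sum_hsNorm_matL_le hP hreg hε k1 k2 hV_nonneg hV_summable hCL.le
    fun k hk => hlog P δ Vhat k hN
      (lt_of_lt_of_le one_pos (PatchSystem.one_le_norm_of_mem_gammaNor hk))
      (PatchSystem.coupling_nonneg (hV_nonneg k) (by linarith [hreg.fermi_large]))
  refine (PatchSystem.sum_norm_pair_evolution_sub_le_diagOp hP hreg hε k3 k4 k5 hV_nonneg hsum hΛ0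
    hℓ hs ψ).trans ?_
  refine mul_le_mul_of_nonneg_right (mul_le_mul_of_nonneg_right (mul_le_mul_of_nonneg_right
    (by linarith) (Real.rpow_nonneg hN.le _)) (Real.rpow_nonneg hM.le _)) (norm_nonneg _)
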